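/- Let $\Bbbk$ be a field of characteristic $0$ and $(V,d)$ a dg vector space ($\mathbb Z$-graded, $d$ of degree $+1$). For $m,n,G\ge 0$ put $\chi=2G+m+n-2$; the index $(m,n,G)$ is \emph{stable} if $\chi>0$. The closed Frobenius properad $\mathcal F$ has one generator $p_{m,n,\chi}$ of degree $0$ ($m$ outputs, $n$ inputs) for each stable $(m,n,G)$, trivial symmetric group actions and zero differential, and every properadic composition (gluing a nonempty set of inputs to outputs) sends $p\otimes p$ to $p$, with $\chi$ additive. Its cobar complex $\mathcal{CF}$ is the free properad on the linear dual of $\mathcal F$ placed in degree $1$; its differential is the derivation that sends a generator to the sum, over all splittings into two stable vertices joined by $k\ge1$ edges, of $\frac1{k!}$ times the dual of the composition. An algebra over $\mathcal{CF}$ on $V$ is a morphism of dg properads from $\mathcal{CF}$ to the endomorphism properad of $V$. \textbf{(1)} Evaluation on the dual generators, $f_{m,n,\chi}=\alpha(p^\#_{m,n,\chi})$, is a bijection from algebras $\alpha$ over $\mathcal{CF}$ on $V$ to (generalized) $IBL_\infty$-structures on $V$, i.e. families of degree $1$ linear maps $f_{m,n,\chi}:V^{\otimes n}\to V^{\otimes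 m}$, $(m,n,G)$ stable, graded symmetric in inputs and in outputs, with $$ d\circ f_{m,n,\chi}+f_{m,n,\chi}\circ d=\sum_{\substack{m_1+m_2=m,\ n_1+n_2=n\\ k\ge 1,\ G_1+G_2+k-1=G}}\frac1{k!}\sum_{\rho,\sigma}\rho\,\bigl(f_{m_1,n_1+k,\chi_1}\circ_k f_{k+m_2,n_2,\chi_2}\bigr)\sigma^{-1}, $$ where only stable indices occur, $\circ_k$ glues the last $k$ inputs of the first map to the first $k$ outputs of the second one (with Koszul signs), and $\rho,\sigma$ run over the shuffles that distribute outputs and inputs (equivalently, over all permutations, after division by $m_1!\,m_2!\,n_1!\,n_2!$). \textbf{(2)} Suppose $V$ is finite dimensional with homogeneous basis $a_i$ and dual basis $\phi^i$. Then $$ L=\sum_{m,n,\chi}\sum_{I,J}\frac1{m!\,n!}f^{\chi,J}_I\,a_J\otimes\phi^I, $$ where $f^{\chi,J}_I$ is the coefficient of $a_{j_1}\otimes\cdots\otimes a_{j_m}$ in $f_{m,n,\chi}(a_{i_n}\otimes\cdots\otimes a_{i_1})$, defines a bijection from graded symmetric families of degree $1$ operations to degree $1$ elements of $\prod_{m,n,\chi}S^m(V)\otimes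 S^n(V^\#)$. It induces a bijection from algebras over $\mathcal{CF}$ on $V$ to degree $1$ elements $L$ satisfying the master equation $\tilde d L+L\circ L=0$. Here $\tilde d$ is minus the differential induced by $d$, and $K\circ L$ is the sum over all contractions, along a bijection, of a nonempty set of $\phi$'s in $K$ with a set of $a$'s in $L$. \textbf{(3)} Both statements also hold when everywhere only indices with $m,n\ge1$ are kept. For operations with nonempty inputs and outputs (and also for all stable operations) and $V$ as in (2), let $D$ be the derivation $-d$ of $S(V)$ and $L_\chi=\sum_{m,n}\sum_{I,J}\frac1{m!\,n!}f^{\chi,J}_I\,a_J\,\partial_{a_{i_1}}\cdots\partial_{a_{i_n}}$, and let $L=\sum_\chi\tau^\chi L_\chi$ act on $S(V)[[\tau]]$, with $\tau$ a formal variable of degree $0$. Then $D+L$ is an operator of degree $1$, and the graded symmetric degree $1$ operations $f$ form an $IBL_\infty$-structure if and only if $(D+L)^2=0$. -/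

import Mathlib

open scoped TensorProduct DirectSum

universe u v w

noncomputable section

namespace IBL

/-! ### Bijections of standard finite sets -/

/-- Disjoint union of two bijections, `Fin (a + b)` being `Fin a ⊔ Fin b`. -/
def sumMap {a a' b b' : ℕ} (e : Fin a ≃ Fin a') (f : Fin b ≃ Fin b') :
    Fin (a + b) ≃ Fin (a' + b') :=
  finSumFinEquiv.symm.trans ((Equiv.sumCongr e f).trans finSumFinEquiv)

/-- The order preserving bijection `(a ⊔ b) ⊔ c ≃ a ⊔ (b ⊔ c)`. -/
def assocMap (a b c : ℕ) : Fin ((a + b) + c) ≃ Fin (a + (b + c)) :=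
  finCongr (Nat.add_assoc a b c)

/-- The block permutation `a ⊔ (b ⊔ c) ≃ b ⊔ (a ⊔ c)`. -/
def swapFirst (a b c : ℕ) : Fin (a + (b + c)) ≃ Fin (b + (a + c)) :=
  (assocMap a b c).symm.trans ((sumMap finAddFlip (Equiv.refl _)).trans (assocMap b a c))

/-- The block permutation `(a ⊔ b) ⊔ c ≃ (a ⊔ c) ⊔ b`. -/
def swapLast (a b c : ℕ) : Fin ((a + b) + c) ≃ Fin ((a + c) + b) :=
  (assocMap a b c).trans ((sumMap (Equiv.refl _) finAddFlip).trans (assocMap a c b).symm)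

/-- The block permutation `(a ⊔ b) ⊔ (c ⊔ d) ≃ (a ⊔ c) ⊔ (b ⊔ d)`. -/
def midSwap (a b c d : ℕ) : Fin ((a + b) + (c + d)) ≃ Fin ((a + c) + (b + d)) :=
  (assocMap a b (c + d)).trans
    ((sumMap (Equiv.refl _) (swapFirst b c d)).trans (assocMap a c (b + d)).symm)

/-! ### Properads and the Frobenius properad -/

/-- A `k`-linear properad in skeletal form, with finite dimensional components (in degree `0`, with
zero differential). `X m n G` is the component with `m` outputs, `n` inputs and genus `G`;
`χ = 2 G + m + n - 2` is additive under composition.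
`act ρ σ` is the functoriality in bijections of outputs and of inputs (the equation `G = G'` only
transports along an equality of genera).
`comp j x y` glues the last `j + 1` inputs of `x` in order to the first `j + 1` outputs of `y`; the
gluing along an arbitrary bijection between nonempty sets of inputs of `x` and of outputs of `y`
is obtained from it with `act`. -/
structure Properad (k : Type u) [Field k] where
  X : ℕ → ℕ → ℕ → Type u
  [grp : ∀ m n G, AddCommGroup (X m n G)]
  [mod : ∀ m n G, Module k (X m n G)]
  [fin : ∀ m n G, Module.Finite k (X m n G)]
  act : ∀ {m n G m' n' G' : ℕ}, (Fin m ≃ Fin m') → (Fin n ≃ Fin n') → G = G' →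
    X m n G →ₗ[k] X m' n' G'
  comp : ∀ {m₁ n₁ G₁ m₂ n₂ G₂ : ℕ} (j : ℕ), X m₁ (n₁ + (j + 1)) G₁ →ₗ[k]
    X ((j + 1) + m₂) n₂ G₂ →ₗ[k] X (m₁ + m₂) (n₁ + n₂) (G₁ + G₂ + j)
  act_id : ∀ {m n G : ℕ} (x : X m n G), act (Equiv.refl _) (Equiv.refl _) rfl x = x
  act_act : ∀ {m n G m' n' G' m'' n'' G'' : ℕ} (ρ : Fin m ≃ Fin m') (σ : Fin n ≃ Fin n')
    (h : G = G') (ρ' : Fin m' ≃ Fin m'') (σ' : Fin n' ≃ Fin n'') (h' : G' = G'') (x : X m n G),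
    act ρ' σ' h' (act ρ σ h x) = act (ρ.trans ρ') (σ.trans σ') (h.trans h') x
  /-- equivariance -/
  comp_act : ∀ {m₁ n₁ G₁ m₂ n₂ G₂ m₁' n₁' G₁' m₂' n₂' G₂' j : ℕ}
    (ρ₁ : Fin m₁ ≃ Fin m₁') (σ₁ : Fin n₁ ≃ Fin n₁') (ρ₂ : Fin m₂ ≃ Fin m₂')
    (σ₂ : Fin n₂ ≃ Fin n₂') (τ : Fin (j + 1) ≃ Fin (j + 1)) (h₁ : G₁ = G₁') (h₂ : G₂ = G₂')
    (x : X m₁ (n₁ + (j + 1)) G₁) (y : X ((j + 1) + m₂) n₂ G₂),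
    comp j (act ρ₁ (sumMap σ₁ τ) h₁ x) (act (sumMap τ ρ₂) σ₂ h₂ y) =
      act (sumMap ρ₁ ρ₂) (sumMap σ₁ σ₂) (by rw [h₁, h₂]) (comp j x y)
  /-- associativity: `i + 1` edges from `y` to `x`, `j + 1` from `z` to `y`, `e` from `z` to `x` -/
  assoc : ∀ {m₁ n₁ G₁ m₂ n₂ G₂ m₃ n₃ G₃ e i j : ℕ}
    (x : X m₁ ((n₁ + e) + (i + 1)) G₁) (y : X ((i + 1) + m₂) (n₂ + (j + 1)) G₂)
    (z : X (e + ((j + 1) + m₃)) n₃ G₃),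
    act (assocMap _ _ _) (assocMap _ _ _)
      (show G₁ + G₂ + i + G₃ + (e + j) = G₁ + (G₂ + G₃ + j) + (e + i) by omega)
      (comp (e + j) (act (Equiv.refl _) (midSwap n₁ e n₂ (j + 1)) rfl (comp i x y))
        (act (assocMap e (j + 1) m₃).symm (Equiv.refl _) rfl z)) =
    comp (e + i) (act (Equiv.refl _) (assocMap n₁ e (i + 1)) rfl x)
      (act ((midSwap (i + 1) m₂ e m₃).trans
          (sumMap (finAddFlip : Fin ((i + 1) + e) ≃ Fin (e + (i + 1))) (Equiv.refl _)))
        (Equiv.refl _) rfl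
        (comp j y (act (swapFirst _ _ _) (Equiv.refl _) rfl z)))
  /-- associativity: `x` and `y` both glued to outputs of `z`, no edges between `x` and `y` -/
  assoc_out : ∀ {m₁ n₁ G₁ m₂ n₂ G₂ m₃ n₃ G₃ i j : ℕ}
    (x : X m₁ (n₁ + (i + 1)) G₁) (y : X m₂ (n₂ + (j + 1)) G₂)
    (z : X ((i + 1) + ((j + 1) + m₃)) n₃ G₃),
    comp i x (act (swapFirst _ _ _) (Equiv.refl _) rfl
        (comp j y (act (swapFirst _ _ _) (Equiv.refl _) rfl z))) =
    act (swapFirst _ _ _) (swapFirst _ _ _)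
      (show G₂ + (G₁ + G₃ + i) + j = G₁ + (G₂ + G₃ + j) + i by omega)
      (comp j y (act (swapFirst _ _ _) (Equiv.refl _) rfl (comp i x z)))
  /-- associativity: `y` and `z` both glued to inputs of `x`, no edges between `y` and `z` -/
  assoc_in : ∀ {m₁ n₁ G₁ m₂ n₂ G₂ m₃ n₃ G₃ i j : ℕ}
    (x : X m₁ ((n₁ + (i + 1)) + (j + 1)) G₁) (y : X ((i + 1) + m₂) n₂ G₂)
    (z : X ((j + 1) + m₃) n₃ G₃),
    comp j (act (Equiv.refl _) (swapLast _ _ _) rfl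
        (comp i (act (Equiv.refl _) (swapLast _ _ _) rfl x) y)) z =
    act (swapLast _ _ _) (swapLast _ _ _)
      (show G₁ + G₃ + j + G₂ + i = G₁ + G₂ + i + G₃ + j by omega)
      (comp i (act (Equiv.refl _) (swapLast _ _ _) rfl (comp j x z)) y)

attribute [instance] Properad.grp Properad.mod Properad.fin

/-- The vertices that are allowed: stable ones (`χ = 2 G + m + n - 2 > 0`) and, if `ne = true`,
with at least one output and at least one input. -/
def Adm (ne : Bool) (m n G : ℕ) : Prop :=
  2 < 2 * G + m + n ∧ (ne = true → 0 < m ∧ 0 < n)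

theorem Adm.comp {ne : Bool} {m₁ n₁ G₁ m₂ n₂ G₂ j : ℕ} (h₁ : Adm ne m₁ (n₁ + (j + 1)) G₁)
    (h₂ : Adm ne ((j + 1) + m₂) n₂ G₂) : Adm ne (m₁ + m₂) (n₁ + n₂) (G₁ + G₂ + j) := by
  obtain ⟨a, b⟩ := h₁
  obtain ⟨c, d⟩ := h₂
  refine ⟨by omega, fun h => ⟨?_, ?_⟩⟩
  · have := b h
    omega
  · have := d h
    omega

/-- The components of the Frobenius properad: `k` for allowed indices, zero otherwise. -/
abbrev FrobX (k : Type u) (ne : Bool) (m n G : ℕ) : Type u := PLift (Adm ne m n G) → k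

open Classical in
/-- The functional dual to the generator `p_{m,n,G}` of the Frobenius properad (zero if the index
is not allowed). -/
def frobDual (k : Type u) [Field k] (ne : Bool) (m n G : ℕ) : FrobX k ne m n G →ₗ[k] k :=
  if h : Adm ne m n G then LinearMap.proj ⟨h⟩ else 0

theorem frobDual_apply {k : Type u} [Field k] {ne : Bool} {m n G : ℕ} (x : FrobX k ne m n G)
    (h : PLift (Adm ne m n G)) : frobDual k ne m n G x = x h := by
  have h' := h.down
  simp [frobDual, h']

theorem frobDual_not {k : Type u} [Field k] {ne : Bool} {m n G : ℕ} (x : FrobX k ne m n G)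
    (h : ¬ Adm ne m n G) : frobDual k ne m n G x = 0 := by
  simp [frobDual, h]

theorem frob_ext {k : Type u} [Field k] {ne : Bool} {m n G : ℕ} {x y : FrobX k ne m n G}
    (h : frobDual k ne m n G x = frobDual k ne m n G y) : x = y := by
  funext a
  rwa [frobDual_apply x a, frobDual_apply y a] at h

/-- Relabelling in the Frobenius properad: generator goes to generator. -/
def frobAct (k : Type u) [Field k] (ne : Bool) {m n G m' n' G' : ℕ}
    (_ρ : Fin m ≃ Fin m') (_σ : Fin n ≃ Fin n') (_h : G = G') :
    FrobX k ne m n G →ₗ[k] FrobX k ne m' n' G' :=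
  LinearMap.pi fun _ => frobDual k ne m n G

/-- Composition in the Frobenius properad: a pair of generators goes to the generator. -/
def frobComp (k : Type u) [Field k] (ne : Bool) (m₁ n₁ G₁ m₂ n₂ G₂ m n G : ℕ) :
    FrobX k ne m₁ n₁ G₁ →ₗ[k] FrobX k ne m₂ n₂ G₂ →ₗ[k] FrobX k ne m n G :=
  LinearMap.mk₂ k (fun x y _ => frobDual k ne m₁ n₁ G₁ x * frobDual k ne m₂ n₂ G₂ y)
    (by intros; funext; simp [add_mul]) (by intros; funext; simp [mul_assoc])
    (by intros; funext; simp [mul_add]) (by intros; funext; simp [mul_left_comm])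

theorem frobDual_act {k : Type u} [Field k] {ne : Bool} {m n G m' n' G' : ℕ}
    (ρ : Fin m ≃ Fin m') (σ : Fin n ≃ Fin n') (h : G = G') (x : FrobX k ne m n G) :
    frobDual k ne m' n' G' (frobAct k ne ρ σ h x) = frobDual k ne m n G x := by
  have hm : m = m' := by simpa using Fintype.card_congr ρ
  have hn : n = n' := by simpa using Fintype.card_congr σ
  subst hm hn h
  by_cases a : Adm ne m n G
  · rw [frobDual_apply _ ⟨a⟩]
    rfl
  · rw [frobDual_not _ a, frobDual_not _ a]

theorem frobDual_comp {k : Type u} [Field k] {ne : Bool} {m₁ n₁ G₁ m₂ n₂ G₂ j : ℕ}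
    (x : FrobX k ne m₁ (n₁ + (j + 1)) G₁) (y : FrobX k ne ((j + 1) + m₂) n₂ G₂) :
    frobDual k ne (m₁ + m₂) (n₁ + n₂) (G₁ + G₂ + j) (frobComp k ne _ _ _ _ _ _ _ _ _ x y) =
      frobDual k ne _ _ _ x * frobDual k ne _ _ _ y := by
  by_cases h : Adm ne (m₁ + m₂) (n₁ + n₂) (G₁ + G₂ + j)
  · rw [frobDual_apply _ ⟨h⟩]
    rfl
  · rw [frobDual_not _ h]
    by_cases h₁ : Adm ne m₁ (n₁ + (j + 1)) G₁
    · rw [frobDual_not y fun h₂ => h (h₁.comp h₂), mul_zero]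
    · rw [frobDual_not x h₁, zero_mul]

/-- The (closed, commutative) Frobenius properad: one generator `p_{m,n,G}` for every stable
`(m, n, G)`, trivial relabelling, `p ∘ p = p`. For `ne = true` only the components with nonempty
outputs and inputs are kept. -/
def frob (k : Type u) [Field k] (ne : Bool) : Properad k where
  X := FrobX k ne
  act ρ σ h := frobAct k ne ρ σ h
  comp _ := frobComp k ne _ _ _ _ _ _ _ _ _
  act_id x := frob_ext (by simp only [frobDual_act])
  act_act ρ σ h ρ' σ' h' x := frob_ext (by simp only [frobDual_act])
  comp_act ρ₁ σ₁ ρ₂ σ₂ τ h₁ h₂ x y := frob_ext (by simp only [frobDual_act, frobDual_comp])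
  assoc x y z := frob_ext (by
    simp only [frobDual_act, frobDual_comp, mul_assoc])
  assoc_out x y z := frob_ext (by
    simp only [frobDual_act, frobDual_comp, mul_left_comm])
  assoc_in x y z := frob_ext (by
    simp only [frobDual_act, frobDual_comp, mul_right_comm])

/-! ### Sums over two-vertex splittings -/

section Split

variable {k : Type u} [Field k] {M : Type v} [AddCommGroup M] [Module k M]

variable (k) in
/-- The sum over all ways of splitting a vertex with `m` outputs, `n` inputs and genus `G` into two
vertices joined by `j + 1 ≥ 1` edges, the first one with `m₁` outputs and `n₁` inputs outside of the
edges and of genus `G₁`, the second one with `m₂`, `n₂` and `G₂`. The distributions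
`[m] = C₁ ⊔ C₂`, `[n] = D₁ ⊔ D₂` are given by bijections `ρ`, `σ`; the division by
`m₁! m₂! n₁! n₂!` takes care of the orders on `C₁, C₂, D₁, D₂`, and the division by
`(j + 1)!` of the permutations of the edges. -/
def splitSum (m n G : ℕ)
    (F : ∀ m₁ m₂ n₁ n₂ G₁ G₂ j : ℕ, (Fin (m₁ + m₂) ≃ Fin m) → (Fin (n₁ + n₂) ≃ Fin n) →
      G₁ + G₂ + j = G → M) : M :=
  ∑ m₁ ∈ Finset.range (m + 1), ∑ m₂ ∈ Finset.range (m + 1),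
    ∑ n₁ ∈ Finset.range (n + 1), ∑ n₂ ∈ Finset.range (n + 1),
      ∑ G₁ ∈ Finset.range (G + 1), ∑ G₂ ∈ Finset.range (G + 1), ∑ j ∈ Finset.range (G + 1),
        if h : G₁ + G₂ + j = G then
          (((j + 1).factorial * m₁.factorial * m₂.factorial * n₁.factorial * n₂.factorial : ℕ) :
              k)⁻¹ •
            ∑ ρ : Fin (m₁ + m₂) ≃ Fin m, ∑ σ : Fin (n₁ + n₂) ≃ Fin n, F m₁ m₂ n₁ n₂ G₁ G₂ j ρ σ h
        else 0

theorem map_splitSum {N : Type w} [AddCommGroup N] [Module k N] (f : M →ₗ[k] N) {m n G : ℕ}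
    (F : ∀ m₁ m₂ n₁ n₂ G₁ G₂ j : ℕ, (Fin (m₁ + m₂) ≃ Fin m) → (Fin (n₁ + n₂) ≃ Fin n) →
      G₁ + G₂ + j = G → M) :
    f (splitSum k m n G F) =
      splitSum k m n G fun m₁ m₂ n₁ n₂ G₁ G₂ j ρ σ h => f (F m₁ m₂ n₁ n₂ G₁ G₂ j ρ σ h) := by
  simp only [splitSum, map_sum, apply_dite f, map_smul, map_zero]

theorem splitSum_add {m n G : ℕ}
    (F F' : ∀ m₁ m₂ n₁ n₂ G₁ G₂ j : ℕ, (Fin (m₁ + m₂) ≃ Fin m) → (Fin (n₁ + n₂) ≃ Fin n) →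
      G₁ + G₂ + j = G → M) :
    (splitSum k m n G fun m₁ m₂ n₁ n₂ G₁ G₂ j ρ σ h =>
      F m₁ m₂ n₁ n₂ G₁ G₂ j ρ σ h + F' m₁ m₂ n₁ n₂ G₁ G₂ j ρ σ h) =
      splitSum k m n G F + splitSum k m n G F' := by
  simp only [splitSum, ← Finset.sum_add_distrib]
  refine Finset.sum_congr rfl fun _ _ => Finset.sum_congr rfl fun _ _ => Finset.sum_congr rfl
    fun _ _ => Finset.sum_congr rfl fun _ _ => Finset.sum_congr rfl fun _ _ =>
    Finset.sum_congr rfl fun _ _ => Finset.sum_congr rfl fun _ _ => ?_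
  split_ifs
  · simp only [← smul_add, Finset.sum_add_distrib]
  · simp

theorem splitSum_mem {m n G : ℕ} (S : Submodule k M)
    (F : ∀ m₁ m₂ n₁ n₂ G₁ G₂ j : ℕ, (Fin (m₁ + m₂) ≃ Fin m) → (Fin (n₁ + n₂) ≃ Fin n) →
      G₁ + G₂ + j = G → M)
    (hF : ∀ m₁ m₂ n₁ n₂ G₁ G₂ j ρ σ h, F m₁ m₂ n₁ n₂ G₁ G₂ j ρ σ h ∈ S) :
    splitSum k m n G F ∈ S := by
  unfold splitSum
  refine S.sum_mem fun _ _ => S.sum_mem fun _ _ => S.sum_mem fun _ _ => S.sum_mem fun _ _ =>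
    S.sum_mem fun _ _ => S.sum_mem fun _ _ => S.sum_mem fun _ _ => ?_
  split_ifs
  · exact S.smul_mem _ (S.sum_mem fun _ _ => S.sum_mem fun _ _ => hF _ _ _ _ _ _ _ _ _ _)
  · exact S.zero_mem

theorem splitSum_reindex {m n G m' n' G' : ℕ} (ρ₀ : Fin m ≃ Fin m') (σ₀ : Fin n ≃ Fin n')
    (h₀ : G = G')
    (F : ∀ m₁ m₂ n₁ n₂ G₁ G₂ j : ℕ, (Fin (m₁ + m₂) ≃ Fin m') → (Fin (n₁ + n₂) ≃ Fin n') →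
      G₁ + G₂ + j = G' → M) :
    (splitSum k m n G fun m₁ m₂ n₁ n₂ G₁ G₂ j ρ σ h =>
      F m₁ m₂ n₁ n₂ G₁ G₂ j (ρ.trans ρ₀) (σ.trans σ₀) (h.trans h₀)) = splitSum k m' n' G' F := by
  have hm : m = m' := by simpa using Fintype.card_congr ρ₀
  have hn : n = n' := by simpa using Fintype.card_congr σ₀
  subst hm hn h₀
  unfold splitSum
  refine Finset.sum_congr rfl fun _ _ => Finset.sum_congr rfl fun _ _ => Finset.sum_congr rfl
    fun _ _ => Finset.sum_congr rfl fun _ _ => Finset.sum_congr rfl fun _ _ =>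
    Finset.sum_congr rfl fun _ _ => Finset.sum_congr rfl fun _ _ => ?_
  split_ifs
  · congr 1
    refine Fintype.sum_equiv (Equiv.equivCongr (Equiv.refl _) ρ₀) _ _ fun ρ => ?_
    refine Fintype.sum_equiv (Equiv.equivCongr (Equiv.refl _) σ₀) _ _ fun σ => ?_
    rfl
  · rfl

end Split

/-! ### The cobar complex -/

/-- Formal composites of generators: `gen φ` with `φ` in the dual of a component of `P`, of degree
`1`; relabellings; gluings of the last `j + 1` inputs of one composite to the first `j + 1` outputs
of another one. -/
inductive Term {k : Type u} [Field k] (P : Properad k) : ℕ → ℕ → ℕ → Type u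
  | gen {m n G : ℕ} (φ : Module.Dual k (P.X m n G)) : Term P m n G
  | act {m n G m' n' G' : ℕ} (ρ : Fin m ≃ Fin m') (σ : Fin n ≃ Fin n') (h : G = G')
      (t : Term P m n G) : Term P m' n' G'
  | comp {m₁ n₁ G₁ m₂ n₂ G₂ : ℕ} (j : ℕ) (t : Term P m₁ (n₁ + (j + 1)) G₁)
      (s : Term P ((j + 1) + m₂) n₂ G₂) : Term P (m₁ + m₂) (n₁ + n₂) (G₁ + G₂ + j)

section Free

variable {k : Type u} [Field k] (P : Properad k)

/-- The degree of a formal composite is its number of generators. -/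
def Term.deg {P : Properad k} : {m n G : ℕ} → Term P m n G → ℕ
  | _, _, _, .gen _ => 1
  | _, _, _, .act _ _ _ t => t.deg
  | _, _, _, .comp _ t s => t.deg + s.deg

/-- Linear combinations of formal composites. -/
abbrev Pre (m n G : ℕ) : Type u := Term P m n G →₀ k

variable {P}

/-- A formal composite as a linear combination. -/
def single {m n G : ℕ} (t : Term P m n G) : Pre P m n G := Finsupp.single t 1

/-- Relabelling of linear combinations. -/
def preAct {m n G m' n' G' : ℕ} (ρ : Fin m ≃ Fin m') (σ : Fin n ≃ Fin n') (h : G = G') :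
    Pre P m n G →ₗ[k] Pre P m' n' G' :=
  Finsupp.lmapDomain k k (Term.act ρ σ h)

/-- Composition of linear combinations. -/
def preComp {m₁ n₁ G₁ m₂ n₂ G₂ : ℕ} (j : ℕ) : Pre P m₁ (n₁ + (j + 1)) G₁ →ₗ[k]
    Pre P ((j + 1) + m₂) n₂ G₂ →ₗ[k] Pre P (m₁ + m₂) (n₁ + n₂) (G₁ + G₂ + j) :=
  Finsupp.lift _ k _ fun t => Finsupp.lmapDomain k k (Term.comp j t)

/-- The relations of the free properad on the suspended linear dual of `P`: linearity and
equivariance in the generators, the properad axioms (with the Koszul sign where two composites are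
exchanged), and their consequences under relabelling and composition. -/
inductive Rel : {m n G : ℕ} → Pre P m n G → Prop
  | gen_add {m n G : ℕ} (φ ψ : Module.Dual k (P.X m n G)) :
      Rel (single (.gen (φ + ψ)) - (single (.gen φ) + single (.gen ψ)))
  | gen_smul {m n G : ℕ} (c : k) (φ : Module.Dual k (P.X m n G)) :
      Rel (single (.gen (c • φ)) - c • single (.gen φ))
  | gen_act {m n G m' n' G' : ℕ} (ρ : Fin m ≃ Fin m') (σ : Fin n ≃ Fin n') (h : G = G')
      (φ : Module.Dual k (P.X m n G)) :
      Rel (single (.act ρ σ h (.gen φ)) -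
        single (.gen (φ.comp (P.act ρ.symm σ.symm h.symm))))
  | act_id {m n G : ℕ} (t : Term P m n G) :
      Rel (single (.act (Equiv.refl _) (Equiv.refl _) rfl t) - single t)
  | act_act {m n G m' n' G' m'' n'' G'' : ℕ} (ρ : Fin m ≃ Fin m') (σ : Fin n ≃ Fin n')
      (h : G = G') (ρ' : Fin m' ≃ Fin m'') (σ' : Fin n' ≃ Fin n'') (h' : G' = G'')
      (t : Term P m n G) :
      Rel (single (.act ρ' σ' h' (.act ρ σ h t)) -
        single (.act (ρ.trans ρ') (σ.trans σ') (h.trans h') t))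
  | comp_act {m₁ n₁ G₁ m₂ n₂ G₂ m₁' n₁' G₁' m₂' n₂' G₂' j : ℕ}
      (ρ₁ : Fin m₁ ≃ Fin m₁') (σ₁ : Fin n₁ ≃ Fin n₁') (ρ₂ : Fin m₂ ≃ Fin m₂')
      (σ₂ : Fin n₂ ≃ Fin n₂') (τ : Fin (j + 1) ≃ Fin (j + 1)) (h₁ : G₁ = G₁') (h₂ : G₂ = G₂')
      (t : Term P m₁ (n₁ + (j + 1)) G₁) (s : Term P ((j + 1) + m₂) n₂ G₂) :
      Rel (single (.comp j (.act ρ₁ (sumMap σ₁ τ) h₁ t) (.act (sumMap τ ρ₂) σ₂ h₂ s)) -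
        single (.act (sumMap ρ₁ ρ₂) (sumMap σ₁ σ₂)
          (show G₁ + G₂ + j = G₁' + G₂' + j by rw [h₁, h₂]) (.comp j t s)))
  | assoc {m₁ n₁ G₁ m₂ n₂ G₂ m₃ n₃ G₃ e i j : ℕ}
      (x : Term P m₁ ((n₁ + e) + (i + 1)) G₁) (y : Term P ((i + 1) + m₂) (n₂ + (j + 1)) G₂)
      (z : Term P (e + ((j + 1) + m₃)) n₃ G₃) :
      Rel (single (.act (assocMap _ _ _) (assocMap _ _ _)
          (show G₁ + G₂ + i + G₃ + (e + j) = G₁ + (G₂ + G₃ + j) + (e + i) by omega)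
          (.comp (e + j) (.act (Equiv.refl _) (midSwap n₁ e n₂ (j + 1)) rfl (.comp i x y))
            (.act (assocMap e (j + 1) m₃).symm (Equiv.refl _) rfl z))) -
        single (.comp (e + i) (.act (Equiv.refl _) (assocMap n₁ e (i + 1)) rfl x)
          (.act ((midSwap (i + 1) m₂ e m₃).trans
              (sumMap (finAddFlip : Fin ((i + 1) + e) ≃ Fin (e + (i + 1))) (Equiv.refl _)))
            (Equiv.refl _) rfl
            (.comp j y (.act (swapFirst _ _ _) (Equiv.refl _) rfl z)))))
  | assoc_out {m₁ n₁ G₁ m₂ n₂ G₂ m₃ n₃ G₃ i j : ℕ}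
      (x : Term P m₁ (n₁ + (i + 1)) G₁) (y : Term P m₂ (n₂ + (j + 1)) G₂)
      (z : Term P ((i + 1) + ((j + 1) + m₃)) n₃ G₃) :
      Rel (single (.comp i x (.act (swapFirst _ _ _) (Equiv.refl _) rfl
          (.comp j y (.act (swapFirst _ _ _) (Equiv.refl _) rfl z)))) -
        (-1 : k) ^ (x.deg * y.deg) • single (.act (swapFirst _ _ _) (swapFirst _ _ _)
          (show G₂ + (G₁ + G₃ + i) + j = G₁ + (G₂ + G₃ + j) + i by omega)
          (.comp j y (.act (swapFirst _ _ _) (Equiv.refl _) rfl (.comp i x z)))))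
  | assoc_in {m₁ n₁ G₁ m₂ n₂ G₂ m₃ n₃ G₃ i j : ℕ}
      (x : Term P m₁ ((n₁ + (i + 1)) + (j + 1)) G₁) (y : Term P ((i + 1) + m₂) n₂ G₂)
      (z : Term P ((j + 1) + m₃) n₃ G₃) :
      Rel (single (.comp j (.act (Equiv.refl _) (swapLast _ _ _) rfl
          (.comp i (.act (Equiv.refl _) (swapLast _ _ _) rfl x) y)) z) -
        (-1 : k) ^ (y.deg * z.deg) • single (.act (swapLast _ _ _) (swapLast _ _ _)
          (show G₁ + G₃ + j + G₂ + i = G₁ + G₂ + i + G₃ + j by omega)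
          (.comp i (.act (Equiv.refl _) (swapLast _ _ _) rfl (.comp j x z)) y)))
  | act {m n G m' n' G' : ℕ} (ρ : Fin m ≃ Fin m') (σ : Fin n ≃ Fin n') (h : G = G')
      {x : Pre P m n G} : Rel x → Rel (preAct ρ σ h x)
  | comp_left {m₁ n₁ G₁ m₂ n₂ G₂ j : ℕ} {x : Pre P m₁ (n₁ + (j + 1)) G₁}
      (s : Term P ((j + 1) + m₂) n₂ G₂) : Rel x → Rel (preComp j x (single s))
  | comp_right {m₁ n₁ G₁ m₂ n₂ G₂ j : ℕ} (t : Term P m₁ (n₁ + (j + 1)) G₁)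
      {y : Pre P ((j + 1) + m₂) n₂ G₂} : Rel y → Rel (preComp j (single t) y)

variable (P)

/-- The underlying graded properad of the cobar complex of `P`: the free properad generated by the
linear dual of `P` placed in degree `1`. -/
abbrev Cobar (m n G : ℕ) : Type u := Pre P m n G ⧸ Submodule.span k {x : Pre P m n G | Rel x}

variable {P}

/-- The class of a formal composite. -/
def mk {m n G : ℕ} (t : Term P m n G) : Cobar P m n G := Submodule.Quotient.mk (single t)

theorem preAct_single {m n G m' n' G' : ℕ} (ρ : Fin m ≃ Fin m') (σ : Fin n ≃ Fin n') (h : G = G')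
    (t : Term P m n G) : preAct ρ σ h (single t) = single (.act ρ σ h t) := by
  simp [preAct, single]

theorem preComp_single {m₁ n₁ G₁ m₂ n₂ G₂ j : ℕ} (t : Term P m₁ (n₁ + (j + 1)) G₁)
    (s : Term P ((j + 1) + m₂) n₂ G₂) :
    preComp j (single t) (single s) = single (.comp j t s) := by
  simp [preComp, single]

/-- Relabelling in the cobar complex. -/
def Cobar.act {m n G m' n' G' : ℕ} (ρ : Fin m ≃ Fin m') (σ : Fin n ≃ Fin n') (h : G = G') :
    Cobar P m n G →ₗ[k] Cobar P m' n' G' :=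
  Submodule.mapQ _ _ (preAct ρ σ h) (Submodule.span_le.2 fun _ hx =>
    Submodule.subset_span (Rel.act ρ σ h hx))

theorem preComp_mem_left {m₁ n₁ G₁ m₂ n₂ G₂ j : ℕ} {x : Pre P m₁ (n₁ + (j + 1)) G₁} (hx : Rel x)
    (y : Pre P ((j + 1) + m₂) n₂ G₂) :
    preComp j x y ∈ Submodule.span k {z : Pre P (m₁ + m₂) (n₁ + n₂) (G₁ + G₂ + j) | Rel z} := by
  induction y using Finsupp.induction_linear with
  | zero => simp
  | add f g hf hg => rw [map_add]; exact add_mem hf hg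
  | single s c =>
    rw [show Finsupp.single s c = c • single s by simp [single], map_smul]
    exact Submodule.smul_mem _ _ (Submodule.subset_span (Rel.comp_left s hx))

theorem preComp_mem_right {m₁ n₁ G₁ m₂ n₂ G₂ j : ℕ} (x : Pre P m₁ (n₁ + (j + 1)) G₁)
    {y : Pre P ((j + 1) + m₂) n₂ G₂} (hy : Rel y) :
    preComp j x y ∈ Submodule.span k {z : Pre P (m₁ + m₂) (n₁ + n₂) (G₁ + G₂ + j) | Rel z} := by
  induction x using Finsupp.induction_linear with
  | zero => simp
  | add f g hf hg => rw [map_add, LinearMap.add_apply]; exact add_mem hf hg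
  | single s c =>
    rw [show Finsupp.single s c = c • single s by simp [single], map_smul, LinearMap.smul_apply]
    exact Submodule.smul_mem _ _ (Submodule.subset_span (Rel.comp_right s hy))

/-- Composition in the cobar complex. -/
def Cobar.comp {m₁ n₁ G₁ m₂ n₂ G₂ : ℕ} (j : ℕ) : Cobar P m₁ (n₁ + (j + 1)) G₁ →ₗ[k]
    Cobar P ((j + 1) + m₂) n₂ G₂ →ₗ[k] Cobar P (m₁ + m₂) (n₁ + n₂) (G₁ + G₂ + j) :=
  Submodule.liftQ _
    (Submodule.liftQ _ ((preComp j).compr₂ (Submodule.mkQ _)).flip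
      (Submodule.span_le.2 fun _ hy => LinearMap.ext fun x =>
        (Submodule.Quotient.mk_eq_zero _).2 (preComp_mem_right x hy))).flip
    (Submodule.span_le.2 fun _ hx => LinearMap.ext fun y => by
      obtain ⟨y, rfl⟩ := Submodule.Quotient.mk_surjective _ y
      exact (Submodule.Quotient.mk_eq_zero _).2 (preComp_mem_left hx y))

theorem act_mk {m n G m' n' G' : ℕ} (ρ : Fin m ≃ Fin m') (σ : Fin n ≃ Fin n') (h : G = G')
    (t : Term P m n G) : Cobar.act ρ σ h (mk t) = mk (.act ρ σ h t) :=
  congrArg Submodule.Quotient.mk (preAct_single ρ σ h t)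

theorem comp_mk {m₁ n₁ G₁ m₂ n₂ G₂ j : ℕ} (t : Term P m₁ (n₁ + (j + 1)) G₁)
    (s : Term P ((j + 1) + m₂) n₂ G₂) : Cobar.comp j (mk t) (mk s) = mk (.comp j t s) :=
  congrArg Submodule.Quotient.mk (preComp_single t s)

@[elab_as_elim]
theorem Cobar.ind {m n G : ℕ} {p : Cobar P m n G → Prop} (x : Cobar P m n G)
    (hmk : ∀ t, p (mk t)) (h0 : p 0) (hadd : ∀ x y, p x → p y → p (x + y))
    (hsmul : ∀ (c : k) x, p x → p (c • x)) : p x := by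
  obtain ⟨x, rfl⟩ := Submodule.Quotient.mk_surjective _ x
  induction x using Finsupp.induction_linear with
  | zero => exact h0
  | add f g hf hg => exact hadd _ _ hf hg
  | single t c =>
    rw [show Finsupp.single t c = c • single t by simp [single]]
    exact hsmul c _ (hmk t)

theorem mk_eq {m n G : ℕ} {x y : Pre P m n G} (h : Rel (x - y)) :
    (Submodule.Quotient.mk x : Cobar P m n G) = Submodule.Quotient.mk y :=
  (Submodule.Quotient.eq _).2 (Submodule.subset_span h)

theorem Cobar.act_act {m n G m' n' G' m'' n'' G'' : ℕ} (ρ : Fin m ≃ Fin m') (σ : Fin n ≃ Fin n')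
    (h : G = G') (ρ' : Fin m' ≃ Fin m'') (σ' : Fin n' ≃ Fin n'') (h' : G' = G'')
    (x : Cobar P m n G) :
    act ρ' σ' h' (act ρ σ h x) = act (ρ.trans ρ') (σ.trans σ') (h.trans h') x := by
  induction x using Cobar.ind with
  | hmk t => simp only [act_mk]; exact mk_eq (Rel.act_act ρ σ h ρ' σ' h' t)
  | h0 => simp only [map_zero]
  | hadd x y hx hy => simp only [map_add, hx, hy]
  | hsmul c x hx => simp only [map_smul, hx]

theorem Cobar.act_id {m n G : ℕ} (x : Cobar P m n G) :
    act (Equiv.refl _) (Equiv.refl _) rfl x = x := by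
  induction x using Cobar.ind with
  | hmk t => simp only [act_mk]; exact mk_eq (Rel.act_id t)
  | h0 => simp only [map_zero]
  | hadd x y hx hy => simp only [map_add, hx, hy]
  | hsmul c x hx => simp only [map_smul, hx]

theorem Cobar.comp_act {m₁ n₁ G₁ m₂ n₂ G₂ m₁' n₁' G₁' m₂' n₂' G₂' j : ℕ}
    (ρ₁ : Fin m₁ ≃ Fin m₁') (σ₁ : Fin n₁ ≃ Fin n₁') (ρ₂ : Fin m₂ ≃ Fin m₂')
    (σ₂ : Fin n₂ ≃ Fin n₂') (τ : Fin (j + 1) ≃ Fin (j + 1)) (h₁ : G₁ = G₁') (h₂ : G₂ = G₂')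
    (x : Cobar P m₁ (n₁ + (j + 1)) G₁) (y : Cobar P ((j + 1) + m₂) n₂ G₂) :
    comp j (act ρ₁ (sumMap σ₁ τ) h₁ x) (act (sumMap τ ρ₂) σ₂ h₂ y) =
      act (sumMap ρ₁ ρ₂) (sumMap σ₁ σ₂)
        (show G₁ + G₂ + j = G₁' + G₂' + j by rw [h₁, h₂]) (comp j x y) := by
  induction x using Cobar.ind with
  | hmk t =>
    induction y using Cobar.ind with
    | hmk s =>
      simp only [act_mk, comp_mk]
      exact mk_eq (Rel.comp_act ρ₁ σ₁ ρ₂ σ₂ τ h₁ h₂ t s)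
    | h0 => simp only [map_zero]
    | hadd x y hx hy => simp only [map_add, hx, hy]
    | hsmul c x hx => simp only [map_smul, hx]
  | h0 => simp only [map_zero, LinearMap.zero_apply]
  | hadd x y hx hy => simp only [map_add, LinearMap.add_apply, hx, hy]
  | hsmul c x hx => simp only [map_smul, LinearMap.smul_apply, hx]

theorem Cobar.assoc {m₁ n₁ G₁ m₂ n₂ G₂ m₃ n₃ G₃ e i j : ℕ}
    (x : Cobar P m₁ ((n₁ + e) + (i + 1)) G₁) (y : Cobar P ((i + 1) + m₂) (n₂ + (j + 1)) G₂)
    (z : Cobar P (e + ((j + 1) + m₃)) n₃ G₃) :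
    act (assocMap _ _ _) (assocMap _ _ _)
      (show G₁ + G₂ + i + G₃ + (e + j) = G₁ + (G₂ + G₃ + j) + (e + i) by omega)
      (comp (e + j) (act (Equiv.refl _) (midSwap n₁ e n₂ (j + 1)) rfl (comp i x y))
        (act (assocMap e (j + 1) m₃).symm (Equiv.refl _) rfl z)) =
    comp (e + i) (act (Equiv.refl _) (assocMap n₁ e (i + 1)) rfl x)
      (act ((midSwap (i + 1) m₂ e m₃).trans
          (sumMap (finAddFlip : Fin ((i + 1) + e) ≃ Fin (e + (i + 1))) (Equiv.refl _)))
        (Equiv.refl _) rfl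
        (comp j y (act (swapFirst _ _ _) (Equiv.refl _) rfl z))) := by
  induction x using Cobar.ind with
  | hmk x =>
    induction y using Cobar.ind with
    | hmk y =>
      induction z using Cobar.ind with
      | hmk z =>
        simp only [act_mk, comp_mk]
        exact mk_eq (Rel.assoc x y z)
      | h0 => simp only [map_zero]
      | hadd x y hx hy => simp only [map_add, hx, hy]
      | hsmul c x hx => simp only [map_smul, hx]
    | h0 => simp only [map_zero, LinearMap.zero_apply]
    | hadd x y hx hy => simp only [map_add, LinearMap.add_apply, hx, hy]
    | hsmul c x hx => simp only [map_smul, LinearMap.smul_apply, hx]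
  | h0 => simp only [map_zero, LinearMap.zero_apply]
  | hadd x y hx hy => simp only [map_add, LinearMap.add_apply, hx, hy]
  | hsmul c x hx => simp only [map_smul, LinearMap.smul_apply, hx]

variable (P) in
/-- The elements of degree `e` of the cobar complex. -/
def Cobar.degree (m n G e : ℕ) : Submodule k (Cobar P m n G) :=
  Submodule.span k {x | ∃ t : Term P m n G, t.deg = e ∧ mk t = x}

theorem mk_mem_degree {m n G : ℕ} (t : Term P m n G) : mk t ∈ Cobar.degree P m n G t.deg :=
  Submodule.subset_span ⟨t, rfl, rfl⟩

theorem act_mem_degree {m n G m' n' G' e : ℕ} (ρ : Fin m ≃ Fin m') (σ : Fin n ≃ Fin n')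
    (h : G = G') {x : Cobar P m n G} (hx : x ∈ Cobar.degree P m n G e) :
    Cobar.act ρ σ h x ∈ Cobar.degree P m' n' G' e := by
  induction hx using Submodule.span_induction with
  | mem x hx =>
    obtain ⟨t, rfl, rfl⟩ := hx
    rw [act_mk]
    exact mk_mem_degree (Term.act ρ σ h t)
  | zero => rw [map_zero]; exact zero_mem _
  | add x y _ _ hx hy => rw [map_add]; exact add_mem hx hy
  | smul c x _ hx => rw [map_smul]; exact Submodule.smul_mem _ c hx

theorem comp_mem_degree {m₁ n₁ G₁ m₂ n₂ G₂ j e f : ℕ} {x : Cobar P m₁ (n₁ + (j + 1)) G₁}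
    {y : Cobar P ((j + 1) + m₂) n₂ G₂} (hx : x ∈ Cobar.degree P _ _ _ e)
    (hy : y ∈ Cobar.degree P _ _ _ f) : Cobar.comp j x y ∈ Cobar.degree P _ _ _ (e + f) := by
  induction hx using Submodule.span_induction with
  | mem x hx =>
    obtain ⟨t, rfl, rfl⟩ := hx
    induction hy using Submodule.span_induction with
    | mem y hy =>
      obtain ⟨s, rfl, rfl⟩ := hy
      rw [comp_mk]
      exact mk_mem_degree (Term.comp j t s)
    | zero => rw [map_zero]; exact zero_mem _
    | add x y _ _ hx hy => rw [map_add]; exact add_mem hx hy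
    | smul c x _ hx => rw [map_smul]; exact Submodule.smul_mem _ c hx
  | zero => rw [map_zero, LinearMap.zero_apply]; exact zero_mem _
  | add x y _ _ hx hy => rw [map_add, LinearMap.add_apply]; exact add_mem hx hy
  | smul c x _ hx => rw [map_smul, LinearMap.smul_apply]; exact Submodule.smul_mem _ c hx

theorem Cobar.assoc_out {m₁ n₁ G₁ m₂ n₂ G₂ m₃ n₃ G₃ i j e f : ℕ}
    {x : Cobar P m₁ (n₁ + (i + 1)) G₁} {y : Cobar P m₂ (n₂ + (j + 1)) G₂}
    (hx : x ∈ degree P _ _ _ e) (hy : y ∈ degree P _ _ _ f)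
    (z : Cobar P ((i + 1) + ((j + 1) + m₃)) n₃ G₃) :
    comp i x (act (swapFirst _ _ _) (Equiv.refl _) rfl
        (comp j y (act (swapFirst _ _ _) (Equiv.refl _) rfl z))) =
    (-1 : k) ^ (e * f) • act (swapFirst _ _ _) (swapFirst _ _ _)
      (show G₂ + (G₁ + G₃ + i) + j = G₁ + (G₂ + G₃ + j) + i by omega)
      (comp j y (act (swapFirst _ _ _) (Equiv.refl _) rfl (comp i x z))) := by
  induction hx using Submodule.span_induction with
  | mem x hx =>
    obtain ⟨x, rfl, rfl⟩ := hx
    induction hy using Submodule.span_induction with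
    | mem y hy =>
      obtain ⟨y, rfl, rfl⟩ := hy
      induction z using Cobar.ind with
      | hmk z =>
        simp only [act_mk, comp_mk]
        exact mk_eq (Rel.assoc_out x y z)
      | h0 => simp only [map_zero, smul_zero]
      | hadd x y hx hy => simp only [map_add, smul_add, hx, hy]
      | hsmul c x hx => simp only [map_smul, hx, smul_comm c]
    | zero => simp only [map_zero, LinearMap.zero_apply, smul_zero]
    | add x y _ _ hx hy => simp only [map_add, LinearMap.add_apply, smul_add, hx, hy]
    | smul c x _ hx => simp only [map_smul, LinearMap.smul_apply, hx, smul_comm c]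
  | zero => simp only [map_zero, LinearMap.zero_apply, smul_zero]
  | add x y _ _ hx hy => simp only [map_add, LinearMap.add_apply, smul_add, hx, hy]
  | smul c x _ hx => simp only [map_smul, LinearMap.smul_apply, hx, smul_comm c]

theorem Cobar.assoc_in {m₁ n₁ G₁ m₂ n₂ G₂ m₃ n₃ G₃ i j e f : ℕ}
    (x : Cobar P m₁ ((n₁ + (i + 1)) + (j + 1)) G₁) {y : Cobar P ((i + 1) + m₂) n₂ G₂}
    {z : Cobar P ((j + 1) + m₃) n₃ G₃}
    (hy : y ∈ degree P _ _ _ e) (hz : z ∈ degree P _ _ _ f) :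
    comp j (act (Equiv.refl _) (swapLast _ _ _) rfl
        (comp i (act (Equiv.refl _) (swapLast _ _ _) rfl x) y)) z =
    (-1 : k) ^ (e * f) • act (swapLast _ _ _) (swapLast _ _ _)
      (show G₁ + G₃ + j + G₂ + i = G₁ + G₂ + i + G₃ + j by omega)
      (comp i (act (Equiv.refl _) (swapLast _ _ _) rfl (comp j x z)) y) := by
  induction hy using Submodule.span_induction with
  | mem y hy =>
    obtain ⟨y, rfl, rfl⟩ := hy
    induction hz using Submodule.span_induction with
    | mem z hz =>
      obtain ⟨z, rfl, rfl⟩ := hz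
      induction x using Cobar.ind with
      | hmk x =>
        simp only [act_mk, comp_mk]
        exact mk_eq (Rel.assoc_in x y z)
      | h0 => simp only [map_zero, LinearMap.zero_apply, smul_zero]
      | hadd x y hx hy => simp only [map_add, LinearMap.add_apply, smul_add, hx, hy]
      | hsmul c x hx => simp only [map_smul, LinearMap.smul_apply, hx, smul_comm c]
    | zero => simp only [map_zero, LinearMap.zero_apply, smul_zero]
    | add x y _ _ hx hy => simp only [map_add, LinearMap.add_apply, smul_add, hx, hy]
    | smul c x _ hx => simp only [map_smul, LinearMap.smul_apply, hx, smul_comm c]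
  | zero => simp only [map_zero, LinearMap.zero_apply, smul_zero]
  | add x y _ _ hx hy => simp only [map_add, LinearMap.add_apply, smul_add, hx, hy]
  | smul c x _ hx => simp only [map_smul, LinearMap.smul_apply, hx, smul_comm c]

/-- The inclusion of the generators in the cobar complex. -/
def Cobar.gen {m n G : ℕ} : Module.Dual k (P.X m n G) →ₗ[k] Cobar P m n G where
  toFun φ := mk (.gen φ)
  map_add' φ ψ := mk_eq (Rel.gen_add φ ψ)
  map_smul' c φ := mk_eq (Rel.gen_smul c φ)

/-- The differential of a generator: the dual of the composition of `P`, written in bases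
`b` of the components of `P` and their dual bases, followed by the composition of generators. -/
def dGen {m n G : ℕ} (φ : Module.Dual k (P.X m n G)) : Cobar P m n G :=
  splitSum k m n G fun m₁ m₂ n₁ n₂ G₁ G₂ j ρ σ h =>
    let b₁ := Module.finBasis k (P.X m₁ (n₁ + (j + 1)) G₁)
    let b₂ := Module.finBasis k (P.X ((j + 1) + m₂) n₂ G₂)
    ∑ p, ∑ q, φ (P.act ρ σ h (P.comp j (b₁ p) (b₂ q))) •
      Cobar.act ρ σ h (Cobar.comp j (Cobar.gen (b₁.coord p)) (Cobar.gen (b₂.coord q)))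

/-- The differential of a formal composite, by the graded Leibniz rule. -/
def dTerm : {m n G : ℕ} → Term P m n G → Cobar P m n G
  | _, _, _, .gen φ => dGen φ
  | _, _, _, .act ρ σ h t => Cobar.act ρ σ h (dTerm t)
  | _, _, _, .comp j t s => Cobar.comp j (dTerm t) (mk s) +
      (-1 : k) ^ t.deg • Cobar.comp j (mk t) (dTerm s)

theorem dGen_add {m n G : ℕ} (φ ψ : Module.Dual k (P.X m n G)) :
    dGen (φ + ψ) = dGen φ + dGen ψ := by
  unfold dGen
  rw [← splitSum_add]
  simp only [LinearMap.add_apply, add_smul, Finset.sum_add_distrib]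

theorem dGen_smul {m n G : ℕ} (c : k) (φ : Module.Dual k (P.X m n G)) :
    dGen (c • φ) = c • dGen φ := by
  unfold dGen
  refine Eq.trans ?_ (map_splitSum (LinearMap.lsmul k (Cobar P m n G) c) _).symm
  simp only [LinearMap.smul_apply, smul_eq_mul, mul_smul, LinearMap.lsmul_apply, Finset.smul_sum]

theorem dGen_act {m n G m' n' G' : ℕ} (ρ : Fin m ≃ Fin m') (σ : Fin n ≃ Fin n') (h : G = G')
    (φ : Module.Dual k (P.X m n G)) :
    dGen (φ.comp (P.act ρ.symm σ.symm h.symm)) = Cobar.act ρ σ h (dGen φ) := by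
  unfold dGen
  rw [map_splitSum, ← splitSum_reindex ρ σ h]
  congr! 10
  simp only [map_sum, map_smul, Cobar.act_act, LinearMap.comp_apply, P.act_act, Equiv.trans_assoc,
    Equiv.self_trans_symm, Equiv.trans_refl]

theorem gen_mem_degree {m n G : ℕ} (φ : Module.Dual k (P.X m n G)) :
    Cobar.gen φ ∈ Cobar.degree P m n G 1 :=
  mk_mem_degree (.gen φ)

theorem dGen_mem {m n G : ℕ} (φ : Module.Dual k (P.X m n G)) :
    dGen φ ∈ Cobar.degree P m n G 2 := by
  change dGen φ ∈ Cobar.degree P m n G (1 + 1)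
  refine splitSum_mem _ _ fun _ _ _ _ _ _ _ _ _ _ => ?_
  exact Submodule.sum_mem _ fun _ _ => Submodule.sum_mem _ fun _ _ => Submodule.smul_mem _ _
    (act_mem_degree _ _ _ (comp_mem_degree (gen_mem_degree _) (gen_mem_degree _)))

theorem dTerm_mem {m n G : ℕ} (t : Term P m n G) :
    dTerm t ∈ Cobar.degree P m n G (t.deg + 1) := by
  induction t with
  | gen φ => exact dGen_mem φ
  | act ρ σ h t ih => exact act_mem_degree ρ σ h ih
  | comp j t s iht ihs =>
    refine add_mem ?_ (Submodule.smul_mem _ _ ?_)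
    · have := comp_mem_degree iht (mk_mem_degree s)
      rwa [show t.deg + 1 + s.deg = (Term.comp j t s).deg + 1 by
        simp only [Term.deg]; omega] at this
    · have := comp_mem_degree (mk_mem_degree t) ihs
      rwa [show t.deg + (s.deg + 1) = (Term.comp j t s).deg + 1 by
        simp only [Term.deg]; omega] at this

/-- The differential on linear combinations of formal composites. -/
def preD {m n G : ℕ} : Pre P m n G →ₗ[k] Cobar P m n G :=
  Finsupp.lift _ k _ dTerm

theorem preD_single {m n G : ℕ} (t : Term P m n G) : preD (single t) = dTerm t := by
  simp [preD, single]

theorem preD_act {m n G m' n' G' : ℕ} (ρ : Fin m ≃ Fin m') (σ : Fin n ≃ Fin n') (h : G = G')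
    (x : Pre P m n G) : preD (preAct ρ σ h x) = Cobar.act ρ σ h (preD x) := by
  induction x using Finsupp.induction_linear with
  | zero => simp only [map_zero]
  | add f g hf hg => simp only [map_add, hf, hg]
  | single t c =>
    rw [show Finsupp.single t c = c • single t by simp [single]]
    simp only [map_smul, preAct_single, preD_single]
    rfl

/-- The parity involution on linear combinations of formal composites. -/
def preParity {m n G : ℕ} : Pre P m n G →ₗ[k] Pre P m n G :=
  Finsupp.lift _ k _ fun t => (-1 : k) ^ t.deg • single t

theorem preParity_single {m n G : ℕ} (t : Term P m n G) :
    preParity (single t) = (-1 : k) ^ t.deg • single t := by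
  rw [preParity, single, Finsupp.lift_apply, Finsupp.sum_single_index (by simp), one_smul]
  rfl

theorem preParity_act {m n G m' n' G' : ℕ} (ρ : Fin m ≃ Fin m') (σ : Fin n ≃ Fin n') (h : G = G')
    (x : Pre P m n G) : preParity (preAct ρ σ h x) = preAct ρ σ h (preParity x) := by
  induction x using Finsupp.induction_linear with
  | zero => simp only [map_zero]
  | add f g hf hg => simp only [map_add, hf, hg]
  | single t c =>
    rw [show Finsupp.single t c = c • single t by simp [single]]
    simp only [map_smul, preAct_single, preParity_single]
    rfl

theorem preParity_comp {m₁ n₁ G₁ m₂ n₂ G₂ j : ℕ} (x : Pre P m₁ (n₁ + (j + 1)) G₁)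
    (y : Pre P ((j + 1) + m₂) n₂ G₂) :
    preParity (preComp j x y) = preComp j (preParity x) (preParity y) := by
  induction x using Finsupp.induction_linear with
  | zero => simp only [map_zero, LinearMap.zero_apply]
  | add f g hf hg => simp only [map_add, LinearMap.add_apply, hf, hg]
  | single t c =>
    induction y using Finsupp.induction_linear with
    | zero => simp only [map_zero]
    | add f g hf hg => simp only [map_add, hf, hg]
    | single s a =>
      rw [show Finsupp.single t c = c • single t by simp [single],
        show Finsupp.single s a = a • single s by simp [single]]
      simp only [map_smul, LinearMap.smul_apply, preComp_single, preParity_single, Term.deg,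
        pow_add, mul_smul]
      rw [smul_comm ((-1 : k) ^ s.deg)]
      rw [smul_comm ((-1 : k) ^ t.deg) ((-1 : k) ^ s.deg)]

theorem preD_comp {m₁ n₁ G₁ m₂ n₂ G₂ j : ℕ} (x : Pre P m₁ (n₁ + (j + 1)) G₁)
    (y : Pre P ((j + 1) + m₂) n₂ G₂) :
    preD (preComp j x y) = Cobar.comp j (preD x) (Submodule.Quotient.mk y) +
      Cobar.comp j (Submodule.Quotient.mk (preParity x)) (preD y) := by
  induction x using Finsupp.induction_linear with
  | zero =>
    simp only [map_zero, LinearMap.zero_apply, Submodule.Quotient.mk_zero, add_zero]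
  | add f g hf hg =>
    simp only [map_add, LinearMap.add_apply, hf, hg, Submodule.Quotient.mk_add]
    abel
  | single t c =>
    induction y using Finsupp.induction_linear with
    | zero => simp only [map_zero, Submodule.Quotient.mk_zero, add_zero]
    | add f g hf hg =>
      simp only [map_add, hf, hg, Submodule.Quotient.mk_add]
      abel
    | single s a =>
      rw [show Finsupp.single t c = c • single t by simp [single],
        show Finsupp.single s a = a • single s by simp [single]]
      simp only [map_smul, LinearMap.smul_apply, preComp_single, preParity_single, preD_single,
        Submodule.Quotient.mk_smul, ← smul_add]
      rfl

/-- The relations are homogeneous. -/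
theorem Rel.parity {m n G : ℕ} {x : Pre P m n G} (hx : Rel x) :
    ∃ e : ℕ, preParity x = (-1 : k) ^ e • x := by
  induction hx with
  | gen_add φ ψ =>
    exact ⟨1, by simp only [map_sub, map_add, preParity_single, Term.deg, smul_sub, smul_add]⟩
  | gen_smul c φ =>
    exact ⟨1, by
      simp only [map_sub, map_smul, preParity_single, Term.deg, smul_sub]
      rw [smul_comm c]⟩
  | gen_act ρ σ h φ => exact ⟨1, by simp only [map_sub, preParity_single, Term.deg, smul_sub]⟩
  | act_id t => exact ⟨t.deg, by simp only [map_sub, preParity_single, Term.deg, smul_sub]⟩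
  | act_act ρ σ h ρ' σ' h' t =>
    exact ⟨t.deg, by simp only [map_sub, preParity_single, Term.deg, smul_sub]⟩
  | comp_act ρ₁ σ₁ ρ₂ σ₂ τ h₁ h₂ t s =>
    exact ⟨t.deg + s.deg, by simp only [map_sub, preParity_single, Term.deg, smul_sub]⟩
  | assoc x y z =>
    exact ⟨x.deg + y.deg + z.deg, by
      simp only [map_sub, preParity_single, Term.deg, smul_sub, add_assoc]⟩
  | assoc_out x y z =>
    exact ⟨x.deg + (y.deg + z.deg), by
      simp only [map_sub, map_smul, preParity_single, Term.deg, smul_sub,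
        add_left_comm y.deg x.deg]
      rw [smul_comm ((-1 : k) ^ (x.deg * y.deg))]⟩
  | assoc_in x y z =>
    exact ⟨x.deg + y.deg + z.deg, by
      simp only [map_sub, map_smul, preParity_single, Term.deg, smul_sub,
        add_right_comm x.deg z.deg]
      rw [smul_comm ((-1 : k) ^ (y.deg * z.deg))]⟩
  | act ρ σ h _ ih =>
    obtain ⟨e, he⟩ := ih
    exact ⟨e, by rw [preParity_act, he, map_smul]⟩
  | comp_left s _ ih =>
    obtain ⟨e, he⟩ := ih
    exact ⟨e + s.deg, by
      rw [preParity_comp, he, preParity_single, map_smul, map_smul, LinearMap.smul_apply, pow_add,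
        mul_smul, smul_comm]⟩
  | comp_right t _ ih =>
    obtain ⟨e, he⟩ := ih
    exact ⟨e + t.deg, by
      rw [preParity_comp, he, preParity_single, map_smul, map_smul, LinearMap.smul_apply, pow_add,
        mul_smul]⟩

theorem sign_out {M : Type v} [AddCommGroup M] [Module k M] (a b : ℕ) (X Y Z : M) :
    (-1 : k) ^ ((a + 1) * b) • X + (-1 : k) ^ a • ((-1 : k) ^ (a * (b + 1)) • Y +
      (-1 : k) ^ b • (-1 : k) ^ (a * b) • Z) -
      (-1 : k) ^ (a * b) • (Y + (-1 : k) ^ b • (X + (-1 : k) ^ a • Z)) = 0 := by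
  have h : (-1 : k) ^ a * (-1) ^ a = 1 := by rw [← mul_pow]; simp
  rw [show (a + 1) * b = a * b + b by ring, show a * (b + 1) = a * b + a by ring, pow_add, pow_add]
  linear_combination (norm := module) ((-1 : k) ^ (a * b) * h) • Y

theorem sign_in {M : Type v} [AddCommGroup M] [Module k M] (a b c : ℕ) (X Y Z : M) :
    (-1 : k) ^ (b * c) • X + (-1 : k) ^ a • (-1 : k) ^ ((b + 1) * c) • Y +
      (-1 : k) ^ (a + b) • (-1 : k) ^ (b * (c + 1)) • Z -
      (-1 : k) ^ (b * c) • (X + (-1 : k) ^ a • Z + (-1 : k) ^ (a + c) • Y) = 0 := by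
  have h : (-1 : k) ^ b * (-1) ^ b = 1 := by rw [← mul_pow]; simp
  rw [show (b + 1) * c = b * c + c by ring, show b * (c + 1) = b * c + b by ring, pow_add, pow_add,
    pow_add, pow_add]
  linear_combination (norm := module) ((-1 : k) ^ (b * c) * (-1 : k) ^ a * h) • Z

theorem preD_rel {m n G : ℕ} {x : Pre P m n G} (hx : Rel x) : preD x = 0 := by
  induction hx with
  | gen_add φ ψ => simp only [map_sub, map_add, preD_single, dTerm, dGen_add, sub_self]
  | gen_smul c φ => simp only [map_sub, map_smul, preD_single, dTerm, dGen_smul, sub_self]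
  | gen_act ρ σ h φ =>
    simp only [map_sub, preD_single, dTerm]
    rw [dGen_act ρ σ h, sub_self]
  | act_id t => simp only [map_sub, preD_single, dTerm, Cobar.act_id, sub_self]
  | act_act ρ σ h ρ' σ' h' t => simp only [map_sub, preD_single, dTerm, Cobar.act_act, sub_self]
  | comp_act ρ₁ σ₁ ρ₂ σ₂ τ h₁ h₂ t s =>
    simp only [map_sub, preD_single, dTerm, ← act_mk, Cobar.comp_act, Term.deg, map_add, map_smul,
      sub_self]
  | assoc x y z =>
    simp only [map_sub, preD_single, dTerm, ← act_mk, ← comp_mk, Term.deg, map_add, map_smul,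
      LinearMap.add_apply, LinearMap.smul_apply, Cobar.assoc, smul_add, pow_add, mul_smul]
    abel
  | assoc_out x y z =>
    have h₁ := Cobar.assoc_out (dTerm_mem x) (mk_mem_degree y) (mk z)
    have h₂ := Cobar.assoc_out (mk_mem_degree x) (dTerm_mem y) (mk z)
    have h₃ := Cobar.assoc_out (mk_mem_degree x) (mk_mem_degree y) (dTerm z)
    simp only [map_sub, preD_single, dTerm, ← act_mk, ← comp_mk, map_add, map_smul,
      h₁, h₂, h₃]
    exact sign_out _ _ _ _ _
  | assoc_in x y z =>
    have h₁ := Cobar.assoc_in (dTerm x) (mk_mem_degree y) (mk_mem_degree z)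
    have h₂ := Cobar.assoc_in (mk x) (dTerm_mem y) (mk_mem_degree z)
    have h₃ := Cobar.assoc_in (mk x) (mk_mem_degree y) (dTerm_mem z)
    simp only [map_sub, preD_single, dTerm, ← act_mk, ← comp_mk, map_add, map_smul,
      LinearMap.add_apply, LinearMap.smul_apply, h₁, h₂, h₃]
    exact sign_in _ _ _ _ _ _
  | act ρ σ h _ ih => rw [preD_act, ih, map_zero]
  | comp_left s hx ih =>
    obtain ⟨e, he⟩ := hx.parity
    rw [preD_comp, ih, he, Submodule.Quotient.mk_smul,
      (Submodule.Quotient.mk_eq_zero _).2 (Submodule.subset_span hx)]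
    simp only [map_zero, smul_zero, LinearMap.zero_apply, add_zero]
  | comp_right t hy ih =>
    rw [preD_comp, ih, (Submodule.Quotient.mk_eq_zero _).2 (Submodule.subset_span hy)]
    simp only [map_zero, add_zero]

/-- The differential of the cobar complex. -/
def Cobar.d {m n G : ℕ} : Cobar P m n G →ₗ[k] Cobar P m n G :=
  Submodule.liftQ _ preD (Submodule.span_le.2 fun _ hx => preD_rel hx)

end Free

/-! ### The endomorphism properad of a dg vector space

`(V, d)` is a dg vector space: `V` is graded by `𝒱 : ℤ → Submodule k V`, `d` has degree `1`. -/

section End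

variable {k : Type u} [Field k] {V : Type v} [AddCommGroup V] [Module k V]
  (𝒱 : ℤ → Submodule k V) [DirectSum.Decomposition 𝒱] (d : V →ₗ[k] V)

/-- The parity involution `v ↦ (-1) ^ |v| v`. -/
def parity : V →ₗ[k] V :=
  (DirectSum.toModule k ℤ V fun i => ((-1 : k) ^ i) • (𝒱 i).subtype) ∘ₗ
    (DirectSum.decomposeLinearEquiv 𝒱).toLinearMap

/-- The projection of `V` onto its odd part (`true`) or its even part (`false`). -/
def parityProj (ε : Bool) : V →ₗ[k] V :=
  (2 : k)⁻¹ • (LinearMap.id + (if ε then (-1 : k) else 1) • parity 𝒱)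

/-- The Koszul sign of a permutation of homogeneous factors, `ε i` telling whether the `i`-th
factor is odd: one sign `-1` for each pair of odd factors whose order is reversed. -/
def koszulSign {m m' : ℕ} (ρ : Fin m ≃ Fin m') (ε : Fin m → Bool) : ℤ :=
  ∏ i, ∏ j, if i < j ∧ ρ j < ρ i ∧ ε i = true ∧ ε j = true then -1 else 1

/-- The permutation of tensor factors with Koszul signs: the `i`-th factor is moved to
position `ρ i`. -/
def permMap {m m' : ℕ} (ρ : Fin m ≃ Fin m') : (⨂[k]^m V) →ₗ[k] ⨂[k]^m' V :=
  ∑ ε : Fin m → Bool, koszulSign ρ ε •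
    ((PiTensorProduct.reindex k (fun _ => V) ρ).toLinearMap ∘ₗ
      PiTensorProduct.map fun i => parityProj 𝒱 (ε i))

/-- The parity involution of `V^{⊗ m}`. -/
def tensorParity (m : ℕ) : (⨂[k]^m V) →ₗ[k] ⨂[k]^m V :=
  PiTensorProduct.map fun _ => parity 𝒱

/-- The differential of `V^{⊗ m}`: the sum of `1 ⊗ ⋯ ⊗ d ⊗ ⋯ ⊗ 1`, with the Koszul signs. -/
def tensorD (m : ℕ) : (⨂[k]^m V) →ₗ[k] ⨂[k]^m V :=
  ∑ i : Fin m, PiTensorProduct.map fun a =>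
    if a < i then parity 𝒱 else if a = i then d else LinearMap.id

/-- The elements of degree `r` of `V^{⊗ m}`. -/
def tensorDegree (m : ℕ) (r : ℤ) : Submodule k (⨂[k]^m V) :=
  Submodule.span k {x | ∃ (e : Fin m → ℤ) (v : Fin m → V), (∀ i, v i ∈ 𝒱 (e i)) ∧
    ∑ i, e i = r ∧ PiTensorProduct.tprod k v = x}

variable (k V) in
/-- The `(m, n)` component of the endomorphism properad (for every genus). -/
abbrev EndV (m n : ℕ) : Type (max u v) := (⨂[k]^n V) →ₗ[k] ⨂[k]^m V

/-- `f` is homogeneous of degree `r`. -/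
def HasDeg {m n : ℕ} (f : EndV k V m n) (r : ℤ) : Prop :=
  ∀ (s : ℤ) (x : ⨂[k]^n V), x ∈ tensorDegree 𝒱 n s → f x ∈ tensorDegree 𝒱 m (s + r)

/-- `(-1) ^ |f| f` -/
def endParity {m n : ℕ} (f : EndV k V m n) : EndV k V m n :=
  tensorParity 𝒱 m ∘ₗ f ∘ₗ tensorParity 𝒱 n

/-- The differential of the endomorphism properad, `d f - (-1) ^ |f| f d`. -/
def endD {m n : ℕ} (f : EndV k V m n) : EndV k V m n :=
  tensorD 𝒱 d m ∘ₗ f - endParity 𝒱 f ∘ₗ tensorD 𝒱 d n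

/-- Relabelling of outputs and inputs in the endomorphism properad. -/
def endAct {m n m' n' : ℕ} (ρ : Fin m ≃ Fin m') (σ : Fin n ≃ Fin n') (f : EndV k V m n) :
    EndV k V m' n' :=
  permMap 𝒱 ρ ∘ₗ f ∘ₗ permMap 𝒱 σ.symm

/-- `id ⊗ f` on `V^{⊗ l} ⊗ V^{⊗ n}`, with the Koszul sign:
`x ⊗ y ↦ (-1) ^ (|f| |x|) x ⊗ f y`. The two summands are the contributions of the even and of the
odd part of `f`. -/
def idTensor (l : ℕ) {m n : ℕ} (f : EndV k V m n) :
    ((⨂[k]^l V) ⊗[k] ⨂[k]^n V) →ₗ[k] (⨂[k]^l V) ⊗[k] ⨂[k]^m V :=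
  TensorProduct.map LinearMap.id ((2 : k)⁻¹ • (f + endParity 𝒱 f)) +
    TensorProduct.map (tensorParity 𝒱 l) ((2 : k)⁻¹ • (f - endParity 𝒱 f))

/-- The composition of the endomorphism properad, gluing the last `j + 1` inputs of `g` to the
first `j + 1` outputs of `f`:
`V^{n₁} ⊗ V^{n₂} → V^{n₁} ⊗ V^{j + 1} ⊗ V^{m₂} → V^{m₁} ⊗ V^{m₂}`, `(g ⊗ id) (id ⊗ f)`. -/
def endComp {m₁ n₁ m₂ n₂ : ℕ} (j : ℕ) (g : EndV k V m₁ (n₁ + (j + 1)))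
    (f : EndV k V ((j + 1) + m₂) n₂) : EndV k V (m₁ + m₂) (n₁ + n₂) :=
  TensorPower.mulEquiv.toLinearMap ∘ₗ
    TensorProduct.map (g ∘ₗ TensorPower.mulEquiv.toLinearMap) LinearMap.id ∘ₗ
    (TensorProduct.assoc k (⨂[k]^n₁ V) (⨂[k]^(j + 1) V) (⨂[k]^m₂ V)).symm.toLinearMap ∘ₗ
    TensorProduct.map LinearMap.id TensorPower.mulEquiv.symm.toLinearMap ∘ₗ
    idTensor 𝒱 n₁ f ∘ₗ
    TensorPower.mulEquiv.symm.toLinearMap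

/-- An algebra over the cobar complex of `P` on the dg vector space `(V, d)`: a morphism of dg
properads from the cobar complex to the endomorphism properad. -/
@[ext]
structure CobarAlgebra (P : Properad k) where
  toFun : ∀ m n G : ℕ, Cobar P m n G →ₗ[k] EndV k V m n
  map_degree : ∀ (m n G e : ℕ) (x : Cobar P m n G), x ∈ Cobar.degree P m n G e →
    HasDeg 𝒱 (toFun m n G x) e
  map_d : ∀ (m n G : ℕ) (x : Cobar P m n G),
    toFun m n G (Cobar.d x) = endD 𝒱 d (toFun m n G x)
  map_act : ∀ (m n G m' n' G' : ℕ) (ρ : Fin m ≃ Fin m') (σ : Fin n ≃ Fin n') (h : G = G')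
    (x : Cobar P m n G), toFun m' n' G' (Cobar.act ρ σ h x) = endAct 𝒱 ρ σ (toFun m n G x)
  map_comp : ∀ (m₁ n₁ G₁ m₂ n₂ G₂ j : ℕ) (x : Cobar P m₁ (n₁ + (j + 1)) G₁)
    (y : Cobar P ((j + 1) + m₂) n₂ G₂),
    toFun (m₁ + m₂) (n₁ + n₂) (G₁ + G₂ + j) (Cobar.comp j x y) =
      endComp 𝒱 j (toFun m₁ (n₁ + (j + 1)) G₁ x) (toFun ((j + 1) + m₂) n₂ G₂ y)

/-- The operations `V^{⊗ n} → V^{⊗ m}`, of genus `G`, of an algebra over the cobar complex of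
the Frobenius properad: the values on the generators dual to `p_{m,n,G}`. -/
def operations {ne : Bool} (α : CobarAlgebra 𝒱 d (frob k ne)) (m n G : ℕ) : EndV k V m n :=
  α.toFun m n G (Cobar.gen (frobDual k ne m n G))

/-! ### `IBL_∞`-algebras -/

/-- Families of graded symmetric operations of degree `1` with `n` inputs, `m` outputs and
genus `G`, for all allowed `(m, n, G)`. -/
structure IsOperations (ne : Bool) (f : ∀ m n _G : ℕ, EndV k V m n) : Prop where
  degree : ∀ m n G, HasDeg 𝒱 (f m n G) 1
  support : ∀ m n G, ¬ Adm ne m n G → f m n G = 0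
  symm : ∀ (m n G : ℕ) (ρ : Fin m ≃ Fin m) (σ : Fin n ≃ Fin n),
    endAct 𝒱 ρ σ (f m n G) = f m n G

/-- (Generalized) `IBL_∞`-structures on the dg vector space `(V, d)`: graded symmetric operations of
degree `1` that satisfy the quadratic relations; the operations with at least one output and at least
one input for `ne = true`, all stable ones for `ne = false`. -/
structure IsIBL (ne : Bool) (f : ∀ m n _G : ℕ, EndV k V m n) : Prop
    extends IsOperations 𝒱 ne f where
  relation : ∀ m n G, endD 𝒱 d (f m n G) =
    splitSum k m n G fun m₁ m₂ n₁ n₂ G₁ G₂ j ρ σ _ =>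
      endAct 𝒱 ρ σ (endComp 𝒱 j (f m₁ (n₁ + (j + 1)) G₁) (f ((j + 1) + m₂) n₂ G₂))

end End

/-! ### Graded symmetric algebras -/

section Sym

variable (k : Type u) [Field k] {ι : Type w} (deg : ι → ℤ)

/-- The relations `x_i x_j = (-1) ^ (|x_i| |x_j|) x_j x_i`. -/
inductive SymRel : FreeAlgebra k ι → FreeAlgebra k ι → Prop
  | comm (i j : ι) : SymRel (FreeAlgebra.ι k i * FreeAlgebra.ι k j)
      ((-1 : k) ^ (deg i * deg j) • (FreeAlgebra.ι k j * FreeAlgebra.ι k i))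

/-- The graded symmetric algebra of the graded vector space with basis `x_i`, `i : ι`, of
degrees `deg i`. -/
abbrev Sym : Type (max u w) := RingQuot (SymRel k deg)

variable {k}

/-- The generator `x_i`. -/
def Sym.x (i : ι) : Sym k deg := RingQuot.mkAlgHom k (SymRel k deg) (FreeAlgebra.ι k i)

theorem Sym.x_mul_x (i j : ι) :
    x (k := k) deg i * x deg j = (-1 : k) ^ (deg i * deg j) • (x deg j * x deg i) := by
  have := RingQuot.mkAlgHom_rel k (SymRel.comm (k := k) (deg := deg) i j)
  simpa [Sym.x] using this

/-- The monomial `x_{J 1} ⋯ x_{J m}`. -/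
def Sym.monomial {m : ℕ} (J : Fin m → ι) : Sym k deg := (List.ofFn fun r => x deg (J r)).prod

/-- The elements of degree `r`. -/
def Sym.degree (r : ℤ) : Submodule k (Sym k deg) :=
  Submodule.span k {y | ∃ (m : ℕ) (J : Fin m → ι), ∑ i, deg (J i) = r ∧ monomial deg J = y}

/-- The linear map `D` with `D (x_j) = δ j` and `D (y z) = S y * D z + D y * T z` for the algebra
endomorphisms `S`, `T` with `S x_j = s j x_j`, `T x_j = t j x_j`; it is the upper right entry of an
algebra homomorphism to triangular matrices. -/
def Sym.skew (s t : ι → k) (δ : ι → Sym k deg)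
    (h : ∀ i j, s i • x deg i * δ j + δ i * t j • x deg j =
      (-1 : k) ^ (deg i * deg j) • (s j • x deg j * δ i + δ j * t i • x deg i)) :
    Sym k deg →ₗ[k] Sym k deg :=
  Matrix.entryLinearMap k (Sym k deg) (0 : Fin 2) (1 : Fin 2) ∘ₗ
    (RingQuot.liftAlgHom k (s := SymRel k deg)
      ⟨FreeAlgebra.lift k fun j => (!![s j • x deg j, δ j; 0, t j • x deg j] :
          Matrix (Fin 2) (Fin 2) (Sym k deg)), by
        rintro _ _ ⟨i, j⟩
        simp only [map_mul, map_smul, FreeAlgebra.lift_ι_apply, Matrix.mul_fin_two,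
          Matrix.smul_of, Matrix.smul_cons, Matrix.smul_empty, zero_mul, mul_zero, add_zero,
          zero_add, h i j, smul_zero, smul_mul_smul_comm]
        congr! 3
        · rw [x_mul_x deg i j, smul_comm, mul_comm (s i)]
        · rw [x_mul_x deg i j, smul_comm, mul_comm (t i)]⟩).toLinearMap

theorem Sym.sign_mul_self (a b : ℤ) : (-1 : k) ^ (a * b) * (-1) ^ (a * b) = 1 := by
  rw [← mul_zpow]
  simp

/-- The left derivative `∂ / ∂ x_l`, with
`∂_l (x_j z) = δ_{lj} z + (-1) ^ (|x_l| |x_j|) x_j ∂_l z`. -/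
def Sym.leftDer [DecidableEq ι] (l : ι) : Sym k deg →ₗ[k] Sym k deg :=
  skew deg (fun j => (-1) ^ (deg l * deg j)) (fun _ => 1) (fun j => if j = l then 1 else 0) (by
    intro i j
    by_cases hi : i = l <;> by_cases hj : j = l
    · subst hi hj
      simp [add_comm, smul_smul, sign_mul_self]
    · subst hi
      simp [hj, smul_smul, sign_mul_self]
    · subst hj
      simp [hi, mul_comm]
    · simp [hi, hj])

/-- The right derivative, with `(z x_j) ∂_l = z δ_{lj} + (-1) ^ (|x_l| |x_j|) (z ∂_l) x_j`. -/
def Sym.rightDer [DecidableEq ι] (l : ι) : Sym k deg →ₗ[k] Sym k deg :=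
  skew deg (fun _ => 1) (fun j => (-1) ^ (deg l * deg j)) (fun j => if j = l then 1 else 0) (by
    intro i j
    by_cases hi : i = l <;> by_cases hj : j = l
    · subst hi hj
      simp [add_comm, smul_smul, sign_mul_self]
    · subst hi
      simp [hj]
    · subst hj
      simp [hi, smul_smul, mul_comm, sign_mul_self]
    · simp [hi, hj])

/-- The derivation of degree `1` with `x_j ↦ ∑ i, c i j x_i` (only the coefficients
`c i j` with `|x_i| = |x_j| + 1` are used):
`D (y z) = D y z + (-1) ^ |y| y D z`. -/
def Sym.der [Fintype ι] (c : ι → ι → k) : Sym k deg →ₗ[k] Sym k deg :=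
  skew deg (fun j => (-1) ^ deg j) (fun _ => 1)
    (fun j => ∑ i, if deg i = deg j + 1 then c i j • x deg i else 0) (by
    have key : ∀ i j, x (k := k) deg i * (∑ a, if deg a = deg j + 1 then c a j • x deg a else 0) =
        ((-1 : k) ^ (deg i * deg j) * (-1) ^ deg i) •
          ((∑ a, if deg a = deg j + 1 then c a j • x deg a else 0) * x deg i) := by
      intro i j
      rw [Finset.mul_sum, Finset.sum_mul, Finset.smul_sum]
      refine Finset.sum_congr rfl fun a _ => ?_
      split_ifs with h
      · rw [mul_smul_comm, x_mul_x, h, mul_add, mul_one, zpow_add₀ (by simp), smul_mul_assoc,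
          smul_comm]
      · simp
    have one : ∀ a : ℤ, (-1 : k) ^ a * (-1) ^ a = 1 := fun a => by simpa using sign_mul_self a 1
    intro i j
    rw [smul_mul_assoc, smul_mul_assoc, key i j, key j i, mul_comm (deg j) (deg i)]
    simp only [one_smul, smul_add, smul_smul]
    have e₁ : (-1 : k) ^ deg i * ((-1) ^ (deg i * deg j) * (-1) ^ deg i) =
        (-1) ^ (deg i * deg j) := by
      rw [mul_left_comm, one, mul_one]
    have e₂ : (-1 : k) ^ (deg i * deg j) * ((-1) ^ deg j * ((-1) ^ (deg i * deg j) *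
        (-1) ^ deg j)) = 1 := by
      rw [mul_left_comm ((-1 : k) ^ deg j), one, mul_one, sign_mul_self]
    rw [e₁, e₂, one_smul, add_comm])

end Sym

/-! ### Generating functions and the master equation -/

section Master

variable {k : Type u} [Field k] {V : Type v} [AddCommGroup V] [Module k V]
  {ι : Type w} [Fintype ι] [DecidableEq ι] (b : Module.Basis ι k V) (deg : ι → ℤ) (d : V →ₗ[k] V)

/-- The degrees of the generators `a_i` (`Sum.inl i`) and `φ^i` (`Sum.inr i`) of
`S(V) ⊗ S(V^#)`. -/
def phaseDeg : ι ⊕ ι → ℤ := Sum.elim deg fun i => -deg i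

variable (k) in
/-- `S(V) ⊗ S(V^#)` as the graded symmetric algebra `S(V ⊕ V^#)` on the basis `a_i` of `V` and the dual
basis `φ^i` of `V^#`. -/
abbrev Phase : Type (max u w) := Sym k (phaseDeg deg)

variable (k) in
/-- The monomial `a_J ⊗ φ^I`. -/
def aphi {m n : ℕ} (J : Fin m → ι) (I : Fin n → ι) : Phase k deg :=
  Sym.monomial (phaseDeg deg) (fun r => Sum.inl (J r)) *
    Sym.monomial (phaseDeg deg) fun r => Sum.inr (I r)

/-- The coordinates `f_I^J` of `f`: the coefficient of `a_{j_1} ⊗ ⋯ ⊗ a_{j_m}` in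
`f (a_{i_n} ⊗ ⋯ ⊗ a_{i_1})`. -/
def coord {m n : ℕ} (f : EndV k V m n) (J : Fin m → ι) (I : Fin n → ι) : k :=
  (Basis.piTensorProduct fun _ : Fin m => b).repr
    (f (PiTensorProduct.tprod k fun r => b (I (Fin.rev r)))) J

/-- The generating function `L = ∑ (1 / (m! n!)) f_I^J a_J ⊗ φ^I`, by components. -/
def generating (f : ∀ m n _G : ℕ, EndV k V m n) (m n G : ℕ) : Phase k deg :=
  ((m.factorial * n.factorial : ℕ) : k)⁻¹ •
    ∑ J : Fin m → ι, ∑ I : Fin n → ι, coord b (f m n G) J I • aphi k deg J I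

/-- Elements of degree `1` of the product of the `S^m(V) ⊗ S^n(V^#)` over all allowed
`(m, n, G)`. -/
def IsSymbol (ne : Bool) (L : ∀ _m _n _G : ℕ, Phase k deg) : Prop :=
  ∀ m n G, (¬ Adm ne m n G → L m n G = 0) ∧
    L m n G ∈ Submodule.span k {y | ∃ (J : Fin m → ι) (I : Fin n → ι),
      ∑ r, deg (J r) - ∑ r, deg (I r) = 1 ∧ aphi k deg J I = y}

/-- The differential of `S(V) ⊗ S(V^#)` induced by `d`: the derivation with
`d a_j = ∑ i, d_j^i a_i` and `d φ^j = -(-1) ^ |φ^j| φ^j ∘ d`. -/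
def phaseD : Phase k deg →ₗ[k] Phase k deg :=
  Sym.der (phaseDeg deg) fun p q =>
    match p, q with
    | .inl i, .inl j => b.repr (d (b j)) i
    | .inr i, .inr j => -(-1) ^ deg j * b.repr (d (b i)) j
    | _, _ => 0

/-- Contraction of `l` (ordered) pairs consisting of a `φ^i` in `K` and an `a_i` in `L`. -/
def contract : ℕ → Phase k deg → Phase k deg → Phase k deg
  | 0, K, L => K * L
  | l + 1, K, L => ∑ i : ι, contract l (Sym.rightDer (phaseDeg deg) (Sum.inr i) K)
      (Sym.leftDer (phaseDeg deg) (Sum.inl i) L)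

/-- The composition `K ∘ L` of the master equation: the sum over all contractions of a nonempty set
of `φ`'s in `K` with a set of `a`'s in `L` along a bijection (the division by `(j + 1)!`
forgets the order of the contracted pairs); `χ` is additive. -/
def circ (K L : ∀ _m _n _G : ℕ, Phase k deg) (m n G : ℕ) : Phase k deg :=
  ∑ p ∈ Finset.HasAntidiagonal.antidiagonal m, ∑ q ∈ Finset.HasAntidiagonal.antidiagonal n,
    ∑ r ∈ Finset.HasAntidiagonal.antidiagonal G, ∑ s ∈ Finset.HasAntidiagonal.antidiagonal r.1,
      ((r.2 + 1).factorial : k)⁻¹ • contract deg (r.2 + 1)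
        (K p.1 (q.1 + (r.2 + 1)) s.1) (L ((r.2 + 1) + p.2) q.2 s.2)

/-- The master equation `d L + L ∘ L = 0`, where the differential of
`∏ S^m(V) ⊗ S^n(V^#)` is minus the one induced by `d`. -/
def MasterEq (L : ∀ _m _n _G : ℕ, Phase k deg) : Prop :=
  ∀ m n G, -phaseD b deg d (L m n G) + circ deg L L m n G = 0

/-! ### Differential operators on `S(V)[[τ]]` -/

/-- The differential operator `∑ (1 / (m! n!)) f_I^J a_J ∂_{i_1} ⋯ ∂_{i_n}` on `S(V)`, the sum
over the finitely many `(m, n, G)` with `2 G + m + n - 2 = χ`. -/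
def diffOp (f : ∀ m n _G : ℕ, EndV k V m n) (χ : ℕ) : Sym k deg →ₗ[k] Sym k deg :=
  ∑ m ∈ Finset.range (χ + 3), ∑ n ∈ Finset.range (χ + 3), ∑ G ∈ Finset.range (χ + 3),
    if 2 * G + m + n = χ + 2 then
      ((m.factorial * n.factorial : ℕ) : k)⁻¹ • ∑ J : Fin m → ι, ∑ I : Fin n → ι,
        coord b (f m n G) J I • (LinearMap.mulLeft k (Sym.monomial deg J) ∘ₗ
          (List.ofFn fun r => (Sym.leftDer deg (I r) : Module.End k (Sym k deg))).prod)
    else 0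

/-- The derivation `-d` of `S(V)`, i.e. the first order differential operator
`-∑ d_j^i a_i ∂_j`. -/
def baseOp : Sym k deg →ₗ[k] Sym k deg :=
  -Sym.der deg fun i j => b.repr (d (b j)) i

/-- The operator `D + L` on `S(V)[[τ]]`: `L` is `∑ τ ^ χ L_χ`, and `D` is the derivation `-d`.
A formal power series is given by its coefficients. -/
def masterOp (f : ∀ m n _G : ℕ, EndV k V m n) (F : ℕ → Sym k deg) : ℕ → Sym k deg := fun c =>
  baseOp b deg d (F c) + ∑ p ∈ Finset.HasAntidiagonal.antidiagonal c, diffOp b deg f p.1 (F p.2)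

end Master

end IBL

end

/-! The proof has three layers: a universal property, a symbol map, and a quantization.

Algebras and operations. The cobar complex is presented by formal composites of generators modulo
the graded properad axioms. A properad morphism out of it is therefore determined by its values on
generators, and any assignment respecting linearity and relabelling extends, once the endomorphism
properad is known to satisfy the same axioms with the same Koszul signs. These are `endComp_act`,
`endComp_assoc`, `endComp_assoc_out` and `endComp_assoc_in`, which enter in `evalPre_rel`. Each
component of the Frobenius properad is `k` or zero, so its dual is spanned by `frobDual`
(`dual_frob_eq`), and a graded morphism is the same as a family of graded symmetric operations of
degree 1. Compatibility with the differentials has to be tested only on generators, because both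
differentials obey the Leibniz rule (`endD_endComp`). There it is the quadratic relation, since the
sum over dual bases in the cobar differential collapses to a single term (`dGen_frobDual`).

Operations and symbols. In a homogeneous basis an operation has matrix coefficients indexed by two
words, and `symbolOf` turns them into an element of the graded symmetric algebra on the `a_i` and
`φ^i`. The word in the `φ`'s is reversed, so contractions of the last `φ` with the first `a` are
nested and cost no sign. With the factor `1/(m! n!)`, differentiating a symbol just deletes an index
(`leftDer_symbol`, `rightDer_symbol`). Iterated derivatives followed by the augmentation thus
recover every coefficient (`coeffAt_symbol`). This gives injectivity on symmetric operations without
a monomial basis of the graded symmetric algebra. Surjectivity comes from elementary operators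
summed over all permutations. Composition becomes contraction (`symbolOf_endComp`) and the
differential becomes `phaseD` (`symbolOf_endD`). The symbol of the defect of the quadratic relation
is then the left side of the master equation (`symbolOf_relation`), and since the defect is
symmetric, one vanishes if and only if the other does.

Symbols and operators. The normally ordered map `quant`, with `a_i` acting as multiplication and
`φ^i` as a derivative, sends the generating function to `diffOp`. A Wick formula computes the
product of two such operators as the quantization of the sum of `1/l!` times the `l`-fold
contractions (`quant_mul_quant_mon`). In the square of `L` the terms without contraction cancel
because odd symbols anticommute, the others form `circ`, and the anticommutator with `-d` gives
`-phaseD`. Each coefficient of `(D + L)^2` is thus the quantization of the left sides of the master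
equation, summed over all indices with a given `χ` (`squareCoeff_eq`). The kernel of `quant` is
stable under the derivatives that extract coefficients (`coeffAt_eq_zero_of_quant`), and for fixed
`χ` the pair `(m, n)` determines the genus, so the individual equations can be read off. -/

noncomputable section

namespace IBL

set_option linter.unusedSectionVars false

/-! ### Koszul signs of permutations -/

section Signs

variable (k : Type u) [Field k]

/-- The sign `(-1) ^ a` in the field `k`. -/
def sg (a : ℤ) : k := (-1) ^ a

variable {k}

@[simp] theorem sg_zero : sg k 0 = 1 := by simp [sg]

theorem sg_add (a b : ℤ) : sg k (a + b) = sg k a * sg k b := zpow_add₀ (by simp) a b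

theorem sg_even {a : ℤ} (h : Even a) : sg k a = 1 := h.neg_one_zpow

theorem sg_congr {a b : ℤ} (h : Even (a - b)) : sg k a = sg k b := by
  rw [← sub_add_cancel a b, sg_add, sg_even h, one_mul]

theorem sg_mul_self (a : ℤ) : sg k a * sg k a = 1 := by
  rw [← sg_add]; exact sg_even ⟨a, rfl⟩

@[simp] theorem sg_neg (a : ℤ) : sg k (-a) = sg k a := sg_congr ⟨-a, by ring⟩

theorem sg_one : sg k 1 = -1 := by simp [sg]

theorem sg_sum {α : Type*} (s : Finset α) (f : α → ℤ) : sg k (∑ i ∈ s, f i) = ∏ i ∈ s, sg k (f i) := by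
  classical
  induction s using Finset.induction_on with
  | empty => simp
  | insert a s ha ih => rw [Finset.sum_insert ha, Finset.prod_insert ha, sg_add, ih]

theorem sg_natCast (n : ℕ) : sg k (n : ℤ) = (-1) ^ n := by simp [sg]

theorem sg_odd {a : ℤ} (h : Odd a) : sg k a = -1 := h.neg_one_zpow

theorem sg_smul_sg_smul {M : Type*} [AddCommGroup M] [Module k M] (a b : ℤ) (x : M) :
    sg k a • sg k b • x = sg k (a + b) • x := by rw [sg_add, mul_smul]

/-- The Koszul sign of a permutation of homogeneous factors of degrees `e i`. -/
def kz (k : Type u) [Field k] {m m' : ℕ} (ρ : Fin m ≃ Fin m') (e : Fin m → ℤ) : k :=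
  ∏ i, ∏ j, if i < j ∧ ρ j < ρ i then sg k (e i * e j) else 1

/-- Only parities matter: `(-1)^(ab)` is `-1` exactly when `a` and `b` are both odd. -/
theorem koszulSign_eq {m m' : ℕ} (ρ : Fin m ≃ Fin m') (e : Fin m → ℤ) :
    ((koszulSign ρ fun i => decide (Odd (e i)) : ℤ) : k) = kz k ρ e := by
  simp only [koszulSign, kz, Int.cast_prod]
  refine Finset.prod_congr rfl fun i _ => Finset.prod_congr rfl fun j _ => ?_
  by_cases h : i < j ∧ ρ j < ρ i
  · by_cases h' : Odd (e i) ∧ Odd (e j)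
    · rw [if_pos ⟨h.1, h.2, by simpa using h'.1, by simpa using h'.2⟩, if_pos h,
        sg_odd (h'.1.mul h'.2)]
      simp
    · rw [if_neg fun hh => h' ⟨by simpa using hh.2.2.1, by simpa using hh.2.2.2⟩, if_pos h, sg_even]
      · simp
      · rw [Int.even_mul]
        simpa [imp_iff_not_or, -not_and, not_and_or] using h'
  · rw [if_neg (by tauto), if_neg h]
    simp

/-- Collects the factors of `(i, j)` and `(j, i)` in one. Products over inversions can then be
compared after a permutation, which does not preserve the condition `i < j`. -/
theorem prod_prod_fold {M : Type*} [CommMonoid M] {m : ℕ} (h : Fin m → Fin m → M)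
    (hd : ∀ i, h i i = 1) :
    ∏ i, ∏ j, h i j = ∏ i, ∏ j, if i < j then h i j * h j i else 1 := by
  have : ∀ i j, (if i < j then h i j * h j i else 1) =
      (if i < j then h i j else 1) * (if i < j then h j i else 1) := fun i j => by
    split_ifs <;> simp
  simp only [this, Finset.prod_mul_distrib]
  rw [Finset.prod_comm (f := fun i j => if i < j then h j i else 1)]
  simp only [← Finset.prod_mul_distrib]
  refine Finset.prod_congr rfl fun i _ => Finset.prod_congr rfl fun j _ => ?_
  rcases lt_trichotomy i j with hij | rfl | hij
  · simp [hij, hij.not_gt]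
  · simp [hd]
  · simp [hij, hij.not_gt]

/-- A pair is inverted by a composite exactly when one of the two permutations inverts it and the
other does not. A pair inverted twice contributes the square of a sign. -/
theorem kz_trans {m m' m'' : ℕ} (ρ : Fin m ≃ Fin m') (σ : Fin m' ≃ Fin m'') (e : Fin m → ℤ) :
    kz k (ρ.trans σ) e = kz k ρ e * kz k σ (e ∘ ρ.symm) := by
  have h : kz k σ (e ∘ ρ.symm) =
      ∏ i, ∏ j, if ρ i < ρ j ∧ σ (ρ j) < σ (ρ i) then sg k (e i * e j) else 1 := by
    rw [kz, ← ρ.prod_comp]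
    refine Finset.prod_congr rfl fun i _ => ?_
    rw [← ρ.prod_comp]
    simp
  rw [h, prod_prod_fold (h := fun i j => if ρ i < ρ j ∧ σ (ρ j) < σ (ρ i) then sg k (e i * e j) else 1)
    (by simp), kz, kz, ← Finset.prod_mul_distrib]
  refine Finset.prod_congr rfl fun i _ => ?_
  rw [← Finset.prod_mul_distrib]
  refine Finset.prod_congr rfl fun j _ => ?_
  by_cases hij : i < j
  · have h1 : ρ i ≠ ρ j := fun h => hij.ne (ρ.injective h)
    have h2 : σ (ρ i) ≠ σ (ρ j) := fun h => h1 (σ.injective h)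
    simp only [hij, true_and, if_true, Equiv.trans_apply, mul_comm (e j) (e i)]
    rcases lt_or_gt_of_ne h1 with h1 | h1 <;> rcases lt_or_gt_of_ne h2 with h2 | h2 <;>
      simp [h1, h1.not_gt, h2, h2.not_gt, sg_mul_self]
  · simp [hij]

theorem kz_eq_one {m m' : ℕ} (ρ : Fin m ≃ Fin m') (e : Fin m → ℤ) (h : Monotone ρ) :
    kz k ρ e = 1 := by
  refine Finset.prod_eq_one fun i _ => Finset.prod_eq_one fun j _ => ?_
  rw [if_neg]
  rintro ⟨h1, h2⟩
  exact absurd (h h1.le) h2.not_ge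

@[simp] theorem kz_refl {m : ℕ} (e : Fin m → ℤ) : kz k (Equiv.refl _) e = 1 :=
  kz_eq_one _ _ fun _ _ h => h

theorem kz_mul_symm {m m' : ℕ} (ρ : Fin m ≃ Fin m') (e : Fin m → ℤ) :
    kz k ρ e * kz k ρ.symm (e ∘ ρ.symm) = 1 := by
  rw [← kz_trans, Equiv.self_trans_symm, kz_refl]

theorem kz_assocMap (a b c : ℕ) (e : Fin (a + b + c) → ℤ) : kz k (assocMap a b c) e = 1 :=
  kz_eq_one _ _ fun _ _ h => h

theorem sumMap_castAdd {a a' b b' : ℕ} (ρ : Fin a ≃ Fin a') (σ : Fin b ≃ Fin b') (i : Fin a) :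
    sumMap ρ σ (Fin.castAdd b i) = Fin.castAdd b' (ρ i) := by
  simp [sumMap]

theorem sumMap_natAdd {a a' b b' : ℕ} (ρ : Fin a ≃ Fin a') (σ : Fin b ≃ Fin b') (i : Fin b) :
    sumMap ρ σ (Fin.natAdd a i) = Fin.natAdd a' (σ i) := by
  simp [sumMap]

theorem castAdd_lt_natAdd {a b : ℕ} (i : Fin a) (j : Fin b) : Fin.castAdd b i < Fin.natAdd a j := by
  simp only [Fin.lt_def, Fin.val_castAdd, Fin.val_natAdd]; omega

theorem castAdd_lt_castAdd {a b : ℕ} (i j : Fin a) : Fin.castAdd b i < Fin.castAdd b j ↔ i < j :=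
  Iff.rfl

theorem natAdd_lt_natAdd {a b : ℕ} (i j : Fin b) : Fin.natAdd a i < Fin.natAdd a j ↔ i < j := by
  simp only [Fin.lt_def, Fin.val_natAdd]; omega

theorem kz_sumMap {a a' b b' : ℕ} (ρ : Fin a ≃ Fin a') (σ : Fin b ≃ Fin b') (e : Fin (a + b) → ℤ) :
    kz k (sumMap ρ σ) e = kz k ρ (e ∘ Fin.castAdd b) * kz k σ (e ∘ Fin.natAdd a) := by
  simp only [kz, Fin.prod_univ_add, sumMap_castAdd, sumMap_natAdd, castAdd_lt_natAdd,
    (castAdd_lt_natAdd _ _).not_gt, true_and, false_and, if_false, Finset.prod_const_one, one_mul,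
    mul_one, Function.comp_apply, castAdd_lt_castAdd, natAdd_lt_natAdd]

/-- The inversions of a block exchange are precisely the pairs with one index in each block, so the
exponents add up to the product of the total degrees. -/
theorem kz_flip {a b : ℕ} (e : Fin (a + b) → ℤ) :
    kz k (finAddFlip : Fin (a + b) ≃ Fin (b + a)) e =
      sg k ((∑ i, e (Fin.castAdd b i)) * ∑ j, e (Fin.natAdd a j)) := by
  rw [Finset.sum_mul_sum]
  simp only [kz, Fin.prod_univ_add, castAdd_lt_natAdd, finAddFlip_apply_castAdd,
    finAddFlip_apply_natAdd, (castAdd_lt_natAdd _ _).not_gt, and_true, false_and,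
    if_false, Finset.prod_const_one, one_mul, if_true, castAdd_lt_castAdd, natAdd_lt_natAdd,
    sg_sum]
  have h : ∀ {n : ℕ} (i j : Fin n), ¬ (i < j ∧ j < i) := fun i j h => h.1.not_gt h.2
  simp only [h, if_false, Finset.prod_const_one, one_mul, mul_one]

/-- This is the sign identity that makes a differential commute with permutations of factors.
Raising the degree of factor `i` multiplies the Koszul sign by the signs of the factors that cross
it, and these are the factors that lie before `i` on one side of the permutation only. -/
theorem kz_update {m m' : ℕ} (ρ : Fin m ≃ Fin m') (e : Fin m → ℤ) (i : Fin m) :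
    kz k ρ (Function.update e i (e i + 1)) * (∏ a, if a < i then sg k (e a) else 1) =
      kz k ρ e * ∏ a, if ρ a < ρ i then sg k (e a) else 1 := by
  -- Only pairs containing `i` change; the last two factors record the pairs with `i` in first and
  -- in second place.
  have h : ∀ x y, (if x < y ∧ ρ y < ρ x then
      sg k (Function.update e i (e i + 1) x * Function.update e i (e i + 1) y) else 1) =
      (if x < y ∧ ρ y < ρ x then sg k (e x * e y) else 1) *
      ((if x = i then (if i < y ∧ ρ y < ρ i then sg k (e y) else 1) else 1) *
      (if y = i then (if x < i ∧ ρ i < ρ x then sg k (e x) else 1) else 1)) := by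
    intro x y
    by_cases hxy : x < y ∧ ρ y < ρ x
    · rw [if_pos hxy, if_pos hxy]
      by_cases hx : x = i
      · subst hx
        have hy : y ≠ x := hxy.1.ne'
        simp only [if_true, Function.update_self, Function.update_of_ne hy, hxy, hy, if_false,
          mul_one, and_true]
        rw [← sg_add]; congr 1; ring
      · by_cases hy : y = i
        · subst hy
          simp only [if_true, Function.update_self, Function.update_of_ne hx, hxy, hx, if_false,
            one_mul, and_true]
          rw [← sg_add]; congr 1; ring
        · simp [hx, hy]
    · rw [if_neg hxy, if_neg hxy]
      by_cases hx : x = i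
      · subst hx
        rw [if_pos rfl, if_neg hxy]
        by_cases hy : y = x
        · subst hy; simp
        · simp [hy]
      · by_cases hy : y = i
        · subst hy
          rw [if_pos rfl, if_neg hxy]
          simp [hx]
        · simp [hx, hy]
  simp only [kz, h, Finset.prod_mul_distrib]
  rw [mul_assoc]
  congr 1
  have h1 : ∏ x, ∏ y, (if x = i then (if i < y ∧ ρ y < ρ i then sg k (e y) else 1) else 1) =
      ∏ y, (if i < y ∧ ρ y < ρ i then sg k (e y) else 1) := by
    rw [Finset.prod_eq_single i] <;> simp +contextual
  rw [h1]
  simp only [Finset.prod_ite_eq', Finset.mem_univ, if_true, ← Finset.prod_mul_distrib]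
  refine Finset.prod_congr rfl fun a _ => ?_
  rcases lt_trichotomy a i with hai | rfl | hai
  · have : ρ a ≠ ρ i := fun h => hai.ne (ρ.injective h)
    rcases lt_or_gt_of_ne this with h2 | h2 <;> simp [hai, hai.not_gt, h2, h2.not_gt, sg_mul_self]
  · simp
  · have : ρ a ≠ ρ i := fun h => hai.ne' (ρ.injective h)
    rcases lt_or_gt_of_ne this with h2 | h2 <;> simp [hai, hai.not_gt, h2, h2.not_gt]

end Signs

/-! ### Tensor powers of a graded vector space -/

section Tensors

variable {k : Type u} [Field k] {V : Type v} [AddCommGroup V] [Module k V]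
  (𝒱 : ℤ → Submodule k V) [DirectSum.Decomposition 𝒱] (d : V →ₗ[k] V)

theorem parity_of_mem {i : ℤ} {x : V} (hx : x ∈ 𝒱 i) : parity 𝒱 x = sg k i • x := by
  simp only [parity, LinearMap.comp_apply, LinearEquiv.coe_coe, DirectSum.decomposeLinearEquiv_apply]
  rw [DirectSum.decompose_of_mem 𝒱 hx]
  change DirectSum.toModule k ℤ V _ (DirectSum.lof k ℤ (fun i => 𝒱 i) i _) = _
  rw [DirectSum.toModule_lof]
  rfl

theorem parityProj_of_mem [CharZero k] {i : ℤ} {x : V} (hx : x ∈ 𝒱 i) (ε : Bool) :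
    parityProj 𝒱 ε x = if ε = decide (Odd i) then x else 0 := by
  simp only [parityProj, LinearMap.smul_apply, LinearMap.add_apply, LinearMap.id_apply,
    parity_of_mem 𝒱 hx]
  rcases Int.even_or_odd i with h | h
  · rw [sg_even h, decide_eq_false (by simpa using h)]
    cases ε
    · simp [← two_smul k x, smul_smul]
    · simp
  · rw [sg_odd h, decide_eq_true h]
    cases ε
    · simp
    · simp [← two_smul k x, smul_smul]

variable {𝒱} in
/-- Linear maps on a tensor power agree if they agree on products of homogeneous vectors. -/
theorem hom_ext {n : ℕ} {M : Type*} [AddCommGroup M] [Module k M] {f g : (⨂[k]^n V) →ₗ[k] M}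
    (h : ∀ (e : Fin n → ℤ) (v : Fin n → V), (∀ i, v i ∈ 𝒱 (e i)) →
      f (PiTensorProduct.tprod k v) = g (PiTensorProduct.tprod k v)) : f = g := by
  -- Bases of the graded pieces assemble to a homogeneous basis of `V`, on which a multilinear map
  -- is determined.
  have hI := DirectSum.Decomposition.isInternal 𝒱
  refine PiTensorProduct.ext (Module.Basis.ext_multilinear
    (fun _ => hI.collectedBasis fun i => Module.Basis.ofVectorSpace k (𝒱 i)) fun v => ?_)
  exact h (fun i => (v i).1) _ fun i => hI.collectedBasis_mem _ _

theorem tprod_mem_degree {n : ℕ} {e : Fin n → ℤ} {v : Fin n → V} (h : ∀ i, v i ∈ 𝒱 (e i)) :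
    PiTensorProduct.tprod k v ∈ tensorDegree 𝒱 n (∑ i, e i) :=
  Submodule.subset_span ⟨e, v, h, rfl, rfl⟩

variable {𝒱} in
/-- Linear maps agree on elements of degree `s` if they agree on products of homogeneous vectors of
total degree `s`. -/
theorem eq_of_mem_degree {n : ℕ} {M : Type*} [AddCommGroup M] [Module k M]
    {f g : (⨂[k]^n V) →ₗ[k] M} {s : ℤ} {x : ⨂[k]^n V} (hx : x ∈ tensorDegree 𝒱 n s)
    (h : ∀ (e : Fin n → ℤ) (v : Fin n → V), (∀ i, v i ∈ 𝒱 (e i)) → ∑ i, e i = s →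
      f (PiTensorProduct.tprod k v) = g (PiTensorProduct.tprod k v)) : f x = g x := by
  induction hx using Submodule.span_induction with
  | mem x hx =>
    obtain ⟨e, v, hv, hs, rfl⟩ := hx
    exact h e v hv hs
  | zero => simp only [map_zero]
  | add x y _ _ hx hy => simp only [map_add, hx, hy]
  | smul c x _ hx => simp only [map_smul, hx]

/-- The product of tensors. -/
def mulT {a b : ℕ} : (⨂[k]^a V) →ₗ[k] (⨂[k]^b V) →ₗ[k] ⨂[k]^(a + b) V :=
  (TensorProduct.mk k _ _).compr₂ (TensorPower.mulEquiv (R := k) (M := V)).toLinearMap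

local notation:70 x:70 " ⊙ " y:71 => mulT x y

theorem mulT_def {a b : ℕ} (x : ⨂[k]^a V) (y : ⨂[k]^b V) :
    x ⊙ y = TensorPower.mulEquiv (x ⊗ₜ[k] y) := rfl

theorem tprod_mulT_tprod {a b : ℕ} (v : Fin a → V) (w : Fin b → V) :
    PiTensorProduct.tprod k v ⊙ PiTensorProduct.tprod k w =
      PiTensorProduct.tprod k (Fin.append v w) :=
  TensorPower.tprod_mul_tprod k v w

theorem tprod_eq_mulT {a b : ℕ} (v : Fin (a + b) → V) : PiTensorProduct.tprod k v =
    PiTensorProduct.tprod k (v ∘ Fin.castAdd b) ⊙ PiTensorProduct.tprod k (v ∘ Fin.natAdd a) := by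
  rw [tprod_mulT_tprod]
  congr 1
  funext i
  refine Fin.addCases (fun i => ?_) (fun i => ?_) i <;> simp

theorem mulT_mem_degree {a b : ℕ} {p q : ℤ} {x : ⨂[k]^a V} {y : ⨂[k]^b V}
    (hx : x ∈ tensorDegree 𝒱 a p) (hy : y ∈ tensorDegree 𝒱 b q) :
    x ⊙ y ∈ tensorDegree 𝒱 (a + b) (p + q) := by
  induction hx using Submodule.span_induction with
  | mem x hx =>
    obtain ⟨e, v, hv, hs, rfl⟩ := hx
    induction hy using Submodule.span_induction with
    | mem y hy =>
      obtain ⟨e', v', hv', hs', rfl⟩ := hy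
      rw [tprod_mulT_tprod]
      refine Submodule.subset_span ⟨Fin.append e e', _, fun i => ?_, ?_, rfl⟩
      · refine Fin.addCases (fun i => ?_) (fun i => ?_) i
        · simpa using hv i
        · simpa using hv' i
      · rw [Fin.sum_univ_add]; simp [hs, hs']
    | zero => rw [map_zero]; exact zero_mem _
    | add x y _ _ hx hy => rw [map_add]; exact add_mem hx hy
    | smul c x _ hx => rw [map_smul]; exact Submodule.smul_mem _ c hx
  | zero => rw [map_zero, LinearMap.zero_apply]; exact zero_mem _
  | add x y _ _ hx hy => rw [map_add, LinearMap.add_apply]; exact add_mem hx hy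
  | smul c x _ hx => rw [map_smul, LinearMap.smul_apply]; exact Submodule.smul_mem _ c hx

variable {𝒱} in
theorem mulT_ext {a b : ℕ} {M : Type*} [AddCommGroup M] [Module k M]
    {f g : (⨂[k]^(a + b) V) →ₗ[k] M}
    (h : ∀ (p q : ℤ) (x : ⨂[k]^a V) (y : ⨂[k]^b V), x ∈ tensorDegree 𝒱 a p →
      y ∈ tensorDegree 𝒱 b q → f (x ⊙ y) = g (x ⊙ y)) : f = g := by
  refine hom_ext (𝒱 := 𝒱) fun e v hv => ?_
  rw [tprod_eq_mulT]
  exact h _ _ _ _ (tprod_mem_degree 𝒱 fun i => hv _) (tprod_mem_degree 𝒱 fun i => hv _)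

/-! ### Permutations of tensor factors -/

section Perm

variable [CharZero k]

theorem permMap_apply {m m' : ℕ} (ρ : Fin m ≃ Fin m') (x : ⨂[k]^m V) : permMap 𝒱 ρ x =
    ∑ ε : Fin m → Bool, (koszulSign ρ ε : k) • (PiTensorProduct.reindex k (fun _ => V) ρ)
      (PiTensorProduct.map (fun i => parityProj 𝒱 (ε i)) x) := by
  rw [permMap, LinearMap.sum_apply]
  refine Finset.sum_congr rfl fun ε _ => ?_
  rw [Int.cast_smul_eq_zsmul]
  rfl

/-- For homogeneous factors only one parity pattern survives the projections, namely the actual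
parities, so the sum in `permMap` reduces to a single term. -/
theorem permMap_tprod {m m' : ℕ} (ρ : Fin m ≃ Fin m') {e : Fin m → ℤ} {v : Fin m → V}
    (hv : ∀ i, v i ∈ 𝒱 (e i)) : permMap 𝒱 ρ (PiTensorProduct.tprod k v) =
      kz k ρ e • PiTensorProduct.tprod k (v ∘ ρ.symm) := by
  rw [permMap_apply, Finset.sum_eq_single fun i => decide (Odd (e i))]
  · rw [koszulSign_eq, PiTensorProduct.map_tprod]
    simp only [parityProj_of_mem 𝒱 (hv _), if_true]
    rw [PiTensorProduct.reindex_tprod]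
    rfl
  · intro ε _ hε
    obtain ⟨i, hi⟩ := Function.ne_iff.1 hε
    rw [PiTensorProduct.map_tprod, (PiTensorProduct.tprod k).map_coord_zero i, map_zero, smul_zero]
    rw [parityProj_of_mem 𝒱 (hv i), if_neg hi]
  · exact fun h => absurd (Finset.mem_univ _) h

theorem permMap_refl (m : ℕ) (x : ⨂[k]^m V) : permMap 𝒱 (Equiv.refl (Fin m)) x = x := by
  have : permMap 𝒱 (Equiv.refl (Fin m)) = LinearMap.id := hom_ext (𝒱 := 𝒱) fun e v hv => by
    rw [permMap_tprod 𝒱 _ hv, kz_refl, one_smul]; rfl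
  rw [this]; rfl

theorem permMap_permMap {m m' m'' : ℕ} (ρ : Fin m ≃ Fin m') (σ : Fin m' ≃ Fin m'')
    (x : ⨂[k]^m V) : permMap 𝒱 σ (permMap 𝒱 ρ x) = permMap 𝒱 (ρ.trans σ) x := by
  have : permMap 𝒱 σ ∘ₗ permMap 𝒱 ρ = permMap 𝒱 (ρ.trans σ) := hom_ext (𝒱 := 𝒱) fun e v hv => by
    rw [LinearMap.comp_apply, permMap_tprod 𝒱 _ hv, permMap_tprod 𝒱 _ hv, map_smul,
      permMap_tprod 𝒱 σ (e := e ∘ ρ.symm) (v := v ∘ ρ.symm) fun i => hv _, kz_trans, mul_smul]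
    rfl
  rw [← this]; rfl

theorem permMap_mem {m m' : ℕ} (ρ : Fin m ≃ Fin m') {r : ℤ} {x : ⨂[k]^m V}
    (hx : x ∈ tensorDegree 𝒱 m r) : permMap 𝒱 ρ x ∈ tensorDegree 𝒱 m' r := by
  induction hx using Submodule.span_induction with
  | mem x hx =>
    obtain ⟨e, v, hv, hs, rfl⟩ := hx
    rw [permMap_tprod 𝒱 _ hv]
    refine Submodule.smul_mem _ _ (Submodule.subset_span ⟨e ∘ ρ.symm, _, fun i => hv _, ?_, rfl⟩)
    rw [← hs]
    exact ρ.symm.sum_comp e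
  | zero => rw [map_zero]; exact zero_mem _
  | add x y _ _ hx hy => rw [map_add]; exact add_mem hx hy
  | smul c x _ hx => rw [map_smul]; exact Submodule.smul_mem _ c hx

theorem sumMap_symm {a a' b b' : ℕ} (ρ : Fin a ≃ Fin a') (σ : Fin b ≃ Fin b') :
    (sumMap ρ σ).symm = sumMap ρ.symm σ.symm := rfl

variable {𝒱} in
/-- Linear maps of two tensor variables agree if they agree on homogeneous products. -/
theorem bilin_ext {a b : ℕ} {M : Type*} [AddCommGroup M] [Module k M]
    {f g : (⨂[k]^a V) →ₗ[k] (⨂[k]^b V) →ₗ[k] M}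
    (h : ∀ (e : Fin a → ℤ) (v : Fin a → V) (e' : Fin b → ℤ) (v' : Fin b → V),
      (∀ i, v i ∈ 𝒱 (e i)) → (∀ i, v' i ∈ 𝒱 (e' i)) →
      f (PiTensorProduct.tprod k v) (PiTensorProduct.tprod k v') =
        g (PiTensorProduct.tprod k v) (PiTensorProduct.tprod k v')) : f = g :=
  hom_ext (𝒱 := 𝒱) fun e v hv => hom_ext (𝒱 := 𝒱) fun e' v' hv' => h e v e' v' hv hv'

theorem append_mem {a b : ℕ} {e : Fin a → ℤ} {v : Fin a → V} {e' : Fin b → ℤ} {v' : Fin b → V}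
    (hv : ∀ i, v i ∈ 𝒱 (e i)) (hv' : ∀ i, v' i ∈ 𝒱 (e' i)) (i : Fin (a + b)) :
    Fin.append v v' i ∈ 𝒱 (Fin.append e e' i) := by
  refine Fin.addCases (fun i => ?_) (fun i => ?_) i
  · simpa using hv i
  · simpa using hv' i

theorem append_comp_castAdd {a b : ℕ} {α : Type*} (f : Fin a → α) (g : Fin b → α) :
    Fin.append f g ∘ Fin.castAdd b = f := by
  funext i; simp

theorem append_comp_natAdd {a b : ℕ} {α : Type*} (f : Fin a → α) (g : Fin b → α) :
    Fin.append f g ∘ Fin.natAdd a = g := by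
  funext i; simp

theorem permMap_sumMap {a a' b b' : ℕ} (ρ : Fin a ≃ Fin a') (σ : Fin b ≃ Fin b')
    (x : ⨂[k]^a V) (y : ⨂[k]^b V) :
    permMap 𝒱 (sumMap ρ σ) (x ⊙ y) = permMap 𝒱 ρ x ⊙ permMap 𝒱 σ y := by
  have : mulT.compr₂ (permMap 𝒱 (sumMap ρ σ)) =
      (mulT (k := k) (V := V)).compl₁₂ (permMap 𝒱 ρ) (permMap 𝒱 σ) := by
    refine bilin_ext (𝒱 := 𝒱) fun e v e' v' hv hv' => ?_
    simp only [LinearMap.compr₂_apply, LinearMap.compl₁₂_apply]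
    rw [tprod_mulT_tprod, permMap_tprod 𝒱 _ (append_mem 𝒱 hv hv'), permMap_tprod 𝒱 _ hv,
      permMap_tprod 𝒱 _ hv', kz_sumMap, append_comp_castAdd, append_comp_natAdd, map_smul, map_smul,
      LinearMap.smul_apply, tprod_mulT_tprod, smul_smul, mul_comm, sumMap_symm]
    congr 2
    funext i
    refine Fin.addCases (fun i => ?_) (fun i => ?_) i <;> simp [sumMap_castAdd, sumMap_natAdd]
  exact LinearMap.congr_fun₂ this x y

/-- Homogeneity is required in both variables, so products of vectors are reached one variable at a
time, with the other one held fixed. -/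
theorem permMap_flip {a b : ℕ} {p q : ℤ} {x : ⨂[k]^a V} {y : ⨂[k]^b V}
    (hx : x ∈ tensorDegree 𝒱 a p) (hy : y ∈ tensorDegree 𝒱 b q) :
    permMap 𝒱 (finAddFlip : Fin (a + b) ≃ Fin (b + a)) (x ⊙ y) = sg k (p * q) • (y ⊙ x) := by
  have h1 : ((mulT (k := k) (V := V)).compr₂ (permMap 𝒱 finAddFlip)).flip y x =
      (sg k (p * q) • (mulT (k := k) (V := V) (a := b) (b := a)) y) x := by
    refine eq_of_mem_degree hx fun e v hv hs => ?_
    change ((mulT (k := k) (V := V)).compr₂ (permMap 𝒱 finAddFlip)) (PiTensorProduct.tprod k v) y =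
      (sg k (p * q) • (mulT (k := k) (V := V)).flip (PiTensorProduct.tprod k v)) y
    refine eq_of_mem_degree hy fun e' v' hv' hs' => ?_
    simp only [LinearMap.compr₂_apply, LinearMap.smul_apply, LinearMap.flip_apply]
    rw [tprod_mulT_tprod, permMap_tprod 𝒱 _ (append_mem 𝒱 hv hv'), kz_flip, tprod_mulT_tprod]
    simp only [Fin.append_left, Fin.append_right, hs, hs']
    congr 2
    funext i
    refine Fin.addCases (fun i => ?_) (fun i => ?_) i
    · have : finAddFlip.symm (Fin.castAdd a i) = Fin.natAdd a i := by
        rw [Equiv.symm_apply_eq, finAddFlip_apply_natAdd]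
      simp [this]
    · have : finAddFlip.symm (Fin.natAdd b i) = Fin.castAdd b i := by
        rw [Equiv.symm_apply_eq, finAddFlip_apply_castAdd]
      simp [this]
  exact h1

theorem permMap_assoc {a b c : ℕ} (x : ⨂[k]^a V) (y : ⨂[k]^b V) (z : ⨂[k]^c V) :
    permMap 𝒱 (assocMap a b c) (x ⊙ y ⊙ z) = x ⊙ (y ⊙ z) := by
  have h : (permMap 𝒱 (assocMap a b c)) =
      (TensorPower.cast k V (Nat.add_assoc a b c)).toLinearMap := by
    refine hom_ext (𝒱 := 𝒱) fun e v hv => ?_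
    rw [permMap_tprod 𝒱 _ hv, kz_assocMap, one_smul, LinearEquiv.coe_coe, TensorPower.cast_tprod]
    rfl
  rw [h]
  exact TensorPower.mul_assoc x y z

theorem permMap_assoc_symm {a b c : ℕ} (x : ⨂[k]^a V) (y : ⨂[k]^b V) (z : ⨂[k]^c V) :
    permMap 𝒱 (assocMap a b c).symm (x ⊙ (y ⊙ z)) = x ⊙ y ⊙ z := by
  rw [← permMap_assoc 𝒱, permMap_permMap, Equiv.self_trans_symm, permMap_refl]

theorem permMap_swapFirst {a b c : ℕ} {p q : ℤ} {x : ⨂[k]^a V} {y : ⨂[k]^b V}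
    (hx : x ∈ tensorDegree 𝒱 a p) (hy : y ∈ tensorDegree 𝒱 b q) (z : ⨂[k]^c V) :
    permMap 𝒱 (swapFirst a b c) (x ⊙ (y ⊙ z)) = sg k (p * q) • (y ⊙ (x ⊙ z)) := by
  rw [swapFirst, ← permMap_permMap, ← permMap_permMap, permMap_assoc_symm, permMap_sumMap,
    permMap_flip 𝒱 hx hy, map_smul, LinearMap.smul_apply, map_smul, permMap_refl, permMap_assoc]

theorem permMap_swapLast {a b c : ℕ} {p q : ℤ} (x : ⨂[k]^a V) {y : ⨂[k]^b V} {z : ⨂[k]^c V}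
    (hy : y ∈ tensorDegree 𝒱 b p) (hz : z ∈ tensorDegree 𝒱 c q) :
    permMap 𝒱 (swapLast a b c) (x ⊙ y ⊙ z) = sg k (p * q) • (x ⊙ z ⊙ y) := by
  rw [swapLast, ← permMap_permMap, ← permMap_permMap, permMap_assoc, permMap_sumMap,
    permMap_flip 𝒱 hy hz, map_smul, map_smul, permMap_refl, permMap_assoc_symm]

theorem permMap_midSwap {a b c d : ℕ} {p q : ℤ} (x : ⨂[k]^a V) {y : ⨂[k]^b V} {z : ⨂[k]^c V}
    (hy : y ∈ tensorDegree 𝒱 b p) (hz : z ∈ tensorDegree 𝒱 c q) (w : ⨂[k]^d V) :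
    permMap 𝒱 (midSwap a b c d) (x ⊙ y ⊙ (z ⊙ w)) = sg k (p * q) • (x ⊙ z ⊙ (y ⊙ w)) := by
  rw [midSwap, ← permMap_permMap, ← permMap_permMap, permMap_assoc, permMap_sumMap,
    permMap_swapFirst 𝒱 hy hz, map_smul, map_smul, permMap_refl, permMap_assoc_symm]

end Perm

/-! ### The differential and the parity of tensors -/

theorem tensorParity_of_mem {m : ℕ} {r : ℤ} {x : ⨂[k]^m V} (hx : x ∈ tensorDegree 𝒱 m r) :
    tensorParity 𝒱 m x = sg k r • x := by
  change _ = (sg k r • LinearMap.id : _ →ₗ[k] _) x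
  refine eq_of_mem_degree hx fun e v hv hs => ?_
  simp only [tensorParity, PiTensorProduct.map_tprod, parity_of_mem 𝒱 (hv _)]
  rw [MultilinearMap.map_smul_univ, ← sg_sum, hs]
  rfl

variable {d} in
theorem tensorD_tprod {m : ℕ} {e : Fin m → ℤ} {v : Fin m → V} (hv : ∀ i, v i ∈ 𝒱 (e i)) :
    tensorD 𝒱 d m (PiTensorProduct.tprod k v) = ∑ i, (∏ a, if a < i then sg k (e a) else 1) •
      PiTensorProduct.tprod k (Function.update v i (d (v i))) := by
  simp only [tensorD, LinearMap.sum_apply, PiTensorProduct.map_tprod]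
  refine Finset.sum_congr rfl fun i _ => ?_
  rw [← MultilinearMap.map_smul_univ]
  congr 1
  funext a
  rcases lt_trichotomy a i with h | rfl | h
  · simp [h, h.ne, parity_of_mem 𝒱 (hv a)]
  · simp
  · simp [h.not_gt, h.ne']

variable {d} (hd : ∀ i : ℤ, ∀ x ∈ 𝒱 i, d x ∈ 𝒱 (i + 1))

include hd in
theorem update_mem {m : ℕ} {e : Fin m → ℤ} {v : Fin m → V} (hv : ∀ i, v i ∈ 𝒱 (e i)) (i j : Fin m) :
    Function.update v i (d (v i)) j ∈ 𝒱 (Function.update e i (e i + 1) j) := by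
  by_cases h : j = i
  · subst h; simpa using hd _ _ (hv j)
  · simpa [h] using hv j

include hd in
theorem tensorD_mem {m : ℕ} {r : ℤ} {x : ⨂[k]^m V} (hx : x ∈ tensorDegree 𝒱 m r) :
    tensorD 𝒱 d m x ∈ tensorDegree 𝒱 m (r + 1) := by
  induction hx using Submodule.span_induction with
  | mem x hx =>
    obtain ⟨e, v, hv, hs, rfl⟩ := hx
    rw [tensorD_tprod 𝒱 hv]
    refine Submodule.sum_mem _ fun i _ => Submodule.smul_mem _ _ ?_
    have := tprod_mem_degree 𝒱 (update_mem 𝒱 hd hv i)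
    rwa [Finset.sum_update_of_mem (Finset.mem_univ i), add_right_comm,
      ← Finset.sum_eq_add_sum_sdiff_singleton_of_mem (Finset.mem_univ i) e, hs] at this
  | zero => rw [map_zero]; exact zero_mem _
  | add x y _ _ hx hy => rw [map_add]; exact add_mem hx hy
  | smul c x _ hx => rw [map_smul]; exact Submodule.smul_mem _ c hx

include hd in
-- After reindexing the positions by `ρ` the two sums agree term by term, and the comparison of
-- signs is `kz_update`.
theorem tensorD_permMap [CharZero k] {m m' : ℕ} (ρ : Fin m ≃ Fin m') (x : ⨂[k]^m V) :
    tensorD 𝒱 d m' (permMap 𝒱 ρ x) = permMap 𝒱 ρ (tensorD 𝒱 d m x) := by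
  have : tensorD 𝒱 d m' ∘ₗ permMap 𝒱 ρ = permMap 𝒱 ρ ∘ₗ tensorD 𝒱 d m := by
    refine hom_ext (𝒱 := 𝒱) fun e v hv => ?_
    rw [LinearMap.comp_apply, LinearMap.comp_apply, permMap_tprod 𝒱 _ hv, map_smul,
      tensorD_tprod 𝒱 (e := e ∘ ρ.symm) (v := v ∘ ρ.symm) fun i => hv _, tensorD_tprod 𝒱 hv, map_sum,
      Finset.smul_sum, ← ρ.sum_comp]
    refine Finset.sum_congr rfl fun i _ => ?_
    rw [map_smul, permMap_tprod 𝒱 _ (update_mem 𝒱 hd hv i), smul_smul, smul_smul,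
      mul_comm (∏ a, _) (kz k ρ _), kz_update, ← ρ.prod_comp]
    simp only [Function.comp_apply, Equiv.symm_apply_apply]
    congr 2
    funext j
    obtain ⟨j, rfl⟩ := ρ.surjective j
    by_cases h : j = i
    · subst h; simp
    · simp [h]
  exact LinearMap.congr_fun this x

/-- The graded Leibniz rule: a differential acting in the second block has passed all factors of
`x`, whose signs multiply to `sg k p`. -/
theorem tensorD_mulT [CharZero k] {a b : ℕ} {p : ℤ} {x : ⨂[k]^a V} (hx : x ∈ tensorDegree 𝒱 a p)
    (y : ⨂[k]^b V) : tensorD 𝒱 d (a + b) (x ⊙ y) =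
      tensorD 𝒱 d a x ⊙ y + sg k p • (x ⊙ tensorD 𝒱 d b y) := by
  have h : ((mulT (k := k) (V := V)).compr₂ (tensorD 𝒱 d (a + b))) x =
      ((mulT (k := k) (V := V)).compl₁₂ (tensorD 𝒱 d a) LinearMap.id +
        sg k p • (mulT (k := k) (V := V)).compl₁₂ LinearMap.id (tensorD 𝒱 d b) :
          (⨂[k]^a V) →ₗ[k] (⨂[k]^b V) →ₗ[k] _) x := by
    refine eq_of_mem_degree hx fun e v hv hs => hom_ext (𝒱 := 𝒱) fun e' v' hv' => ?_
    simp only [LinearMap.compr₂_apply, LinearMap.add_apply, LinearMap.smul_apply,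
      LinearMap.compl₁₂_apply, LinearMap.id_apply]
    rw [tprod_mulT_tprod, tensorD_tprod 𝒱 (append_mem 𝒱 hv hv'), tensorD_tprod 𝒱 hv,
      tensorD_tprod 𝒱 hv', Fin.sum_univ_add, map_sum, map_sum, LinearMap.sum_apply,
      Finset.smul_sum]
    simp only [map_smul, LinearMap.smul_apply, tprod_mulT_tprod, Fin.prod_univ_add,
      Fin.append_left, Fin.append_right, castAdd_lt_natAdd, (castAdd_lt_natAdd _ _).not_gt,
      castAdd_lt_castAdd, natAdd_lt_natAdd, if_true, if_false, Finset.prod_const_one, mul_one]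
    congr 1
    · refine Finset.sum_congr rfl fun i _ => ?_
      congr 2
      funext j
      refine Fin.addCases (fun j => ?_) (fun j => ?_) j
      · by_cases h : j = i
        · subst h; simp
        · simp [h, Function.update_of_ne, (Fin.castAdd_injective a b).ne h]
      · simp [Function.update_of_ne, (castAdd_lt_natAdd i j).ne']
    · refine Finset.sum_congr rfl fun i _ => ?_
      rw [← sg_sum, hs, smul_smul]
      congr 2
      funext j
      refine Fin.addCases (fun j => ?_) (fun j => ?_) j
      · simp [Function.update_of_ne, (castAdd_lt_natAdd j i).ne]
      · by_cases h : j = i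
        · subst h; simp
        · have : Fin.natAdd a j ≠ Fin.natAdd a i := by simpa using h
          simp [h, this]
  exact LinearMap.congr_fun h y

end Tensors

local notation:70 x:70 " ⊙ " y:71 => mulT x y

/-! ### The endomorphism properad satisfies the graded properad axioms -/

section EndProperad

variable {k : Type u} [Field k] [CharZero k] {V : Type v} [AddCommGroup V] [Module k V]
  {𝒱 : ℤ → Submodule k V} [DirectSum.Decomposition 𝒱] {d : V →ₗ[k] V}

theorem mem_degree_congr {m : ℕ} {r s : ℤ} (h : r = s) {x : ⨂[k]^m V}
    (hx : x ∈ tensorDegree 𝒱 m r) : x ∈ tensorDegree 𝒱 m s := h ▸ hx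

theorem HasDeg.zero {m n : ℕ} (r : ℤ) : HasDeg 𝒱 (0 : EndV k V m n) r :=
  fun _ _ _ => zero_mem _

theorem HasDeg.add {m n : ℕ} {f g : EndV k V m n} {r : ℤ} (hf : HasDeg 𝒱 f r) (hg : HasDeg 𝒱 g r) :
    HasDeg 𝒱 (f + g) r := fun s x hx => add_mem (hf s x hx) (hg s x hx)

theorem HasDeg.smul {m n : ℕ} {f : EndV k V m n} {r : ℤ} (c : k) (hf : HasDeg 𝒱 f r) :
    HasDeg 𝒱 (c • f) r := fun s x hx => Submodule.smul_mem _ c (hf s x hx)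

theorem HasDeg.sum {m n : ℕ} {α : Type*} (t : Finset α) {f : α → EndV k V m n} {r : ℤ}
    (hf : ∀ a ∈ t, HasDeg 𝒱 (f a) r) : HasDeg 𝒱 (∑ a ∈ t, f a) r := fun s x hx => by
  rw [LinearMap.sum_apply]
  exact Submodule.sum_mem _ fun a ha => hf a ha s x hx

theorem hasDeg_of_tprod {m n : ℕ} {f : EndV k V m n} {r : ℤ}
    (h : ∀ (e : Fin n → ℤ) (v : Fin n → V), (∀ i, v i ∈ 𝒱 (e i)) →
      f (PiTensorProduct.tprod k v) ∈ tensorDegree 𝒱 m (∑ i, e i + r)) : HasDeg 𝒱 f r := by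
  intro s x hx
  induction hx using Submodule.span_induction with
  | mem x hx =>
    obtain ⟨e, v, hv, rfl, rfl⟩ := hx
    exact h e v hv
  | zero => rw [map_zero]; exact zero_mem _
  | add x y _ _ hx hy => rw [map_add]; exact add_mem hx hy
  | smul c x _ hx => rw [map_smul]; exact Submodule.smul_mem _ c hx

theorem endParity_of_hasDeg {m n : ℕ} {f : EndV k V m n} {r : ℤ} (hf : HasDeg 𝒱 f r) :
    endParity 𝒱 f = sg k r • f := by
  refine hom_ext (𝒱 := 𝒱) fun e v hv => ?_
  have h := tprod_mem_degree 𝒱 hv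
  simp only [endParity, LinearMap.comp_apply, LinearMap.smul_apply]
  rw [tensorParity_of_mem 𝒱 h, map_smul, map_smul, tensorParity_of_mem 𝒱 (hf _ _ h),
    sg_smul_sg_smul]
  congr 1
  exact sg_congr ⟨∑ i, e i, by ring⟩

/-- For homogeneous `f` one of the even and odd halves vanishes and the other is `f`, so the two
summands of `idTensor` reproduce the Koszul rule. -/
theorem idTensor_tmul {l m n : ℕ} {f : EndV k V m n} {p r : ℤ} (hf : HasDeg 𝒱 f r)
    {x : ⨂[k]^l V} (hx : x ∈ tensorDegree 𝒱 l p) (y : ⨂[k]^n V) :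
    idTensor 𝒱 l f (x ⊗ₜ[k] y) = sg k (r * p) • (x ⊗ₜ[k] f y) := by
  have h2 : (2 : k)⁻¹ * 2 = 1 := inv_mul_cancel₀ two_ne_zero
  simp only [idTensor, endParity_of_hasDeg hf, LinearMap.add_apply, TensorProduct.map_tmul,
    tensorParity_of_mem 𝒱 hx, LinearMap.id_apply, LinearMap.smul_apply, LinearMap.sub_apply]
  rcases Int.even_or_odd r with h | h
  · rw [sg_even h, sg_even (h.mul_right p), one_smul, one_smul, sub_self, smul_zero,
      TensorProduct.tmul_zero, add_zero, ← two_smul k (f y), smul_smul, h2, one_smul]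
  · have hp : sg k (r * p) = sg k p := sg_congr (by
      obtain ⟨a, rfl⟩ := h
      exact ⟨a * p, by ring⟩)
    rw [sg_odd h, hp, neg_smul, one_smul, add_neg_cancel, smul_zero, TensorProduct.tmul_zero,
      zero_add, sub_neg_eq_add, ← two_smul k (f y), smul_smul, h2, one_smul,
      TensorProduct.smul_tmul']

/-- Gluing `x ⊗ u` into the inputs of `g`: the map `u ⊗ w ↦ g (x ⊗ u) ⊗ w`. -/
def glue {m₁ n₁ l m₂ : ℕ} (g : EndV k V m₁ (n₁ + l)) (x : ⨂[k]^n₁ V) :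
    (⨂[k]^(l + m₂) V) →ₗ[k] ⨂[k]^(m₁ + m₂) V :=
  TensorPower.mulEquiv.toLinearMap ∘ₗ
    TensorProduct.map (g ∘ₗ mulT x) LinearMap.id ∘ₗ TensorPower.mulEquiv.symm.toLinearMap

@[simp] theorem glue_mulT {m₁ n₁ l m₂ : ℕ} (g : EndV k V m₁ (n₁ + l)) (x : ⨂[k]^n₁ V)
    (u : ⨂[k]^l V) (w : ⨂[k]^m₂ V) : glue g x (u ⊙ w) = g (x ⊙ u) ⊙ w := by
  simp [glue, mulT_def]

/-- Separates the only sign of a composition, from moving `f` past the uncontracted inputs `x`, from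
the sign-free operation `glue`. The axioms below are checked through this formula. -/
theorem endComp_mulT {m₁ n₁ m₂ n₂ j : ℕ} (g : EndV k V m₁ (n₁ + (j + 1)))
    {f : EndV k V ((j + 1) + m₂) n₂} {r p : ℤ} (hf : HasDeg 𝒱 f r) {x : ⨂[k]^n₁ V}
    (hx : x ∈ tensorDegree 𝒱 n₁ p) (y : ⨂[k]^n₂ V) :
    endComp 𝒱 j g f (x ⊙ y) = sg k (r * p) • glue g x (f y) := by
  simp only [endComp, LinearMap.comp_apply, LinearEquiv.coe_coe, mulT_def,
    LinearEquiv.symm_apply_apply, idTensor_tmul hf hx, map_smul, TensorProduct.map_tmul,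
    LinearMap.id_apply]
  congr 1
  have : (TensorPower.mulEquiv.toLinearMap ∘ₗ
      TensorProduct.map (g ∘ₗ TensorPower.mulEquiv.toLinearMap) LinearMap.id ∘ₗ
      (TensorProduct.assoc k (⨂[k]^n₁ V) (⨂[k]^(j + 1) V) (⨂[k]^m₂ V)).symm.toLinearMap ∘ₗ
      (TensorProduct.mk k _ _ x) ∘ₗ TensorPower.mulEquiv.symm.toLinearMap) =
      (glue g x : (⨂[k]^((j + 1) + m₂) V) →ₗ[k] _) := by
    refine mulT_ext (𝒱 := 𝒱) fun p q u w hu hw => ?_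
    rw [glue_mulT]
    simp [mulT_def]
  exact LinearMap.congr_fun this (f y)

theorem glue_mem {m₁ n₁ l m₂ : ℕ} {g : EndV k V m₁ (n₁ + l)} {r p s : ℤ} (hg : HasDeg 𝒱 g r)
    {x : ⨂[k]^n₁ V} (hx : x ∈ tensorDegree 𝒱 n₁ p) {y : ⨂[k]^(l + m₂) V}
    (hy : y ∈ tensorDegree 𝒱 (l + m₂) s) :
    glue g x y ∈ tensorDegree 𝒱 (m₁ + m₂) (p + s + r) := by
  induction hy using Submodule.span_induction with
  | mem y hy =>
    obtain ⟨e, v, hv, rfl, rfl⟩ := hy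
    rw [tprod_eq_mulT, glue_mulT]
    have := mulT_mem_degree 𝒱
      (hg _ _ (mulT_mem_degree 𝒱 hx (tprod_mem_degree 𝒱 fun i => hv (Fin.castAdd m₂ i))))
      (tprod_mem_degree 𝒱 fun i => hv (Fin.natAdd l i))
    rw [Fin.sum_univ_add]
    refine mem_degree_congr ?_ this
    ring
  | zero => rw [map_zero]; exact zero_mem _
  | add x y _ _ hx hy => rw [map_add]; exact add_mem hx hy
  | smul c x _ hx => rw [map_smul]; exact Submodule.smul_mem _ c hx

theorem HasDeg.endComp {m₁ n₁ m₂ n₂ j : ℕ} {g : EndV k V m₁ (n₁ + (j + 1))}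
    {f : EndV k V ((j + 1) + m₂) n₂} {r s : ℤ} (hg : HasDeg 𝒱 g r) (hf : HasDeg 𝒱 f s) :
    HasDeg 𝒱 (endComp 𝒱 j g f) (r + s) := by
  refine hasDeg_of_tprod fun e v hv => ?_
  have h1 := tprod_mem_degree 𝒱 fun i => hv (Fin.castAdd n₂ i)
  have h2 := tprod_mem_degree 𝒱 fun i => hv (Fin.natAdd n₁ i)
  rw [tprod_eq_mulT, Fin.sum_univ_add]
  have := glue_mem hg h1 (hf _ _ h2)
  erw [endComp_mulT g hf h1]
  refine Submodule.smul_mem _ _ ?_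
  refine mem_degree_congr ?_ this
  ring

theorem HasDeg.endAct {m n m' n' : ℕ} (ρ : Fin m ≃ Fin m') (σ : Fin n ≃ Fin n')
    {f : EndV k V m n} {r : ℤ} (hf : HasDeg 𝒱 f r) : HasDeg 𝒱 (endAct 𝒱 ρ σ f) r :=
  fun s _ hx => permMap_mem 𝒱 ρ (hf s _ (permMap_mem 𝒱 σ.symm hx))

theorem endAct_apply {m n m' n' : ℕ} (ρ : Fin m ≃ Fin m') (σ : Fin n ≃ Fin n')
    (f : EndV k V m n) (x : ⨂[k]^n' V) :
    endAct 𝒱 ρ σ f x = permMap 𝒱 ρ (f (permMap 𝒱 σ.symm x)) := rfl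

theorem endAct_refl {m n : ℕ} (f : EndV k V m n) :
    endAct 𝒱 (Equiv.refl _) (Equiv.refl _) f = f := by
  refine LinearMap.ext fun x => ?_
  rw [endAct_apply, Equiv.refl_symm, permMap_refl, permMap_refl]

theorem endAct_endAct {m n m' n' m'' n'' : ℕ} (ρ : Fin m ≃ Fin m') (σ : Fin n ≃ Fin n')
    (ρ' : Fin m' ≃ Fin m'') (σ' : Fin n' ≃ Fin n'') (f : EndV k V m n) :
    endAct 𝒱 ρ' σ' (endAct 𝒱 ρ σ f) = endAct 𝒱 (ρ.trans ρ') (σ.trans σ') f := by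
  refine LinearMap.ext fun x => ?_
  simp only [endAct_apply, permMap_permMap]
  rfl

theorem endAct_add {m n m' n' : ℕ} (ρ : Fin m ≃ Fin m') (σ : Fin n ≃ Fin n')
    (f g : EndV k V m n) : endAct 𝒱 ρ σ (f + g) = endAct 𝒱 ρ σ f + endAct 𝒱 ρ σ g := by
  simp only [endAct, LinearMap.add_comp, LinearMap.comp_add]

theorem endAct_smul {m n m' n' : ℕ} (ρ : Fin m ≃ Fin m') (σ : Fin n ≃ Fin n')
    (c : k) (f : EndV k V m n) : endAct 𝒱 ρ σ (c • f) = c • endAct 𝒱 ρ σ f := by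
  simp only [endAct, LinearMap.smul_comp, LinearMap.comp_smul]

variable (𝒱) in
/-- `endAct` as a linear map. -/
def endActL {m n m' n' : ℕ} (ρ : Fin m ≃ Fin m') (σ : Fin n ≃ Fin n') :
    EndV k V m n →ₗ[k] EndV k V m' n' where
  toFun := endAct 𝒱 ρ σ
  map_add' := endAct_add ρ σ
  map_smul' := endAct_smul ρ σ

variable (𝒱) in
/-- `idTensor` as a linear map. -/
def idTensorL (l m n : ℕ) :
    EndV k V m n →ₗ[k] ((⨂[k]^l V) ⊗[k] ⨂[k]^n V) →ₗ[k] (⨂[k]^l V) ⊗[k] ⨂[k]^m V :=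
  let P : EndV k V m n →ₗ[k] EndV k V m n :=
    { toFun := endParity 𝒱
      map_add' := fun f g => by simp only [endParity, LinearMap.add_comp, LinearMap.comp_add]
      map_smul' := fun c f => by
        simp only [endParity, LinearMap.smul_comp, LinearMap.comp_smul, RingHom.id_apply] }
  TensorProduct.mapBilinear (.id k) _ _ _ _ LinearMap.id ∘ₗ ((2 : k)⁻¹ • (LinearMap.id + P)) +
    TensorProduct.mapBilinear (.id k) _ _ _ _ (tensorParity 𝒱 l) ∘ₗ
      ((2 : k)⁻¹ • (LinearMap.id - P))

theorem idTensor_add (l : ℕ) {m n : ℕ} (f g : EndV k V m n) :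
    idTensor 𝒱 l (f + g) = idTensor 𝒱 l f + idTensor 𝒱 l g :=
  map_add (idTensorL 𝒱 l m n) f g

theorem idTensor_smul (l : ℕ) {m n : ℕ} (c : k) (f : EndV k V m n) :
    idTensor 𝒱 l (c • f) = c • idTensor 𝒱 l f :=
  map_smul (idTensorL 𝒱 l m n) c f

variable (𝒱) in
/-- `endComp` as a bilinear map. -/
def endCompL {m₁ n₁ m₂ n₂ : ℕ} (j : ℕ) : EndV k V m₁ (n₁ + (j + 1)) →ₗ[k]
    EndV k V ((j + 1) + m₂) n₂ →ₗ[k] EndV k V (m₁ + m₂) (n₁ + n₂) :=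
  LinearMap.mk₂ k (endComp 𝒱 j)
    (fun g g' f => by
      simp only [endComp, LinearMap.add_comp, LinearMap.comp_add, TensorProduct.map_add_left])
    (fun c g f => by
      simp only [endComp, LinearMap.smul_comp, LinearMap.comp_smul, TensorProduct.map_smul_left])
    (fun g f f' => by
      simp only [endComp, idTensor_add, LinearMap.add_comp, LinearMap.comp_add])
    (fun c g f => by
      simp only [endComp, idTensor_smul, LinearMap.smul_comp, LinearMap.comp_smul])

/-- Permutations have degree zero and produce no extra sign. The permutation `τ` of the glued edges
meets its inverse at the inputs of `g` and disappears. -/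
theorem endComp_act {m₁ n₁ m₂ n₂ m₁' n₁' m₂' n₂' j : ℕ}
    (ρ₁ : Fin m₁ ≃ Fin m₁') (σ₁ : Fin n₁ ≃ Fin n₁') (ρ₂ : Fin m₂ ≃ Fin m₂')
    (σ₂ : Fin n₂ ≃ Fin n₂') (τ : Fin (j + 1) ≃ Fin (j + 1))
    (g : EndV k V m₁ (n₁ + (j + 1))) {f : EndV k V ((j + 1) + m₂) n₂} {r : ℤ}
    (hf : HasDeg 𝒱 f r) :
    endComp 𝒱 j (endAct 𝒱 ρ₁ (sumMap σ₁ τ) g) (endAct 𝒱 (sumMap τ ρ₂) σ₂ f) =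
      endAct 𝒱 (sumMap ρ₁ ρ₂) (sumMap σ₁ σ₂) (endComp 𝒱 j g f) := by
  refine mulT_ext (𝒱 := 𝒱) fun p q x y hx hy => ?_
  rw [endComp_mulT _ (hf.endAct _ _) hx, endAct_apply, endAct_apply, sumMap_symm, permMap_sumMap,
    endComp_mulT _ hf (permMap_mem 𝒱 _ hx), map_smul]
  congr 1
  generalize f (permMap 𝒱 σ₂.symm y) = z
  change (glue (endAct 𝒱 ρ₁ (sumMap σ₁ τ) g) x ∘ₗ permMap 𝒱 (sumMap τ ρ₂)) z =
    (permMap 𝒱 (sumMap ρ₁ ρ₂) ∘ₗ glue g (permMap 𝒱 σ₁.symm x)) z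
  congr 1
  refine mulT_ext (𝒱 := 𝒱) fun p q u w hu hw => ?_
  simp only [LinearMap.comp_apply, permMap_sumMap, glue_mulT, endAct_apply, sumMap_symm,
    permMap_permMap, Equiv.self_trans_symm, permMap_refl]

theorem permMap_symm_eq {m m' : ℕ} {ρ : Fin m ≃ Fin m'} {x : ⨂[k]^m V} {y : ⨂[k]^m' V} {a : ℤ}
    (h : permMap 𝒱 ρ x = sg k a • y) : permMap 𝒱 ρ.symm y = sg k a • x := by
  have := congrArg (permMap 𝒱 ρ.symm) h
  rw [permMap_permMap, Equiv.self_trans_symm, permMap_refl, map_smul] at this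
  rw [this, smul_smul, sg_mul_self, one_smul]

-- Allows a homogeneous tensor to be treated as a product of homogeneous tensors. Scalars are
-- absorbed in the first factor, so only sums remain to be handled.
@[elab_as_elim]
theorem mulT_induction {a b : ℕ} {s : ℤ} {P : (⨂[k]^(a + b) V) → Prop} {z : ⨂[k]^(a + b) V}
    (hz : z ∈ tensorDegree 𝒱 (a + b) s)
    (mul : ∀ (p q : ℤ) (x : ⨂[k]^a V) (y : ⨂[k]^b V), x ∈ tensorDegree 𝒱 a p →
      y ∈ tensorDegree 𝒱 b q → p + q = s → P (x ⊙ y))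
    (zero : P 0) (add : ∀ x y, P x → P y → P (x + y)) : P z := by
  -- Asking for all scalar multiples at once replaces a closure hypothesis on `P` under scalars.
  suffices h : ∀ c : k, P (c • z) by simpa using h 1
  induction hz using Submodule.span_induction with
  | mem x hx =>
    intro c
    obtain ⟨e, v, hv, hs, rfl⟩ := hx
    rw [tprod_eq_mulT, ← LinearMap.smul_apply, ← map_smul]
    exact mul _ _ _ _ (Submodule.smul_mem _ c (tprod_mem_degree 𝒱 fun i => hv _))
      (tprod_mem_degree 𝒱 fun i => hv _) (by rw [← hs, Fin.sum_univ_add])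
  | zero => intro c; rwa [smul_zero]
  | add x y _ _ hx hy => intro c; rw [smul_add]; exact add _ _ (hx c) (hy c)
  | smul a x _ hx => intro c; rw [smul_smul]; exact hx _

/-- Both sides are evaluated on `v₁ v₂ v₃`, with `z v₃` expanded as `w₁ w₂ w₃` and `y (v₂ w₂)` as
`u₁ u₂`. Each becomes a sign times the same tensor, in which `x` receives `v₁ w₁ u₁`, so only the
parity of the exponents has to be compared. -/
theorem endComp_assoc {m₁ n₁ m₂ n₂ m₃ n₃ e i j : ℕ}
    (x : EndV k V m₁ ((n₁ + e) + (i + 1))) {y : EndV k V ((i + 1) + m₂) (n₂ + (j + 1))}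
    {z : EndV k V (e + ((j + 1) + m₃)) n₃} {r s : ℤ} (hy : HasDeg 𝒱 y r) (hz : HasDeg 𝒱 z s) :
    endAct 𝒱 (assocMap _ _ _) (assocMap _ _ _)
      (endComp 𝒱 (e + j) (endAct 𝒱 (Equiv.refl _) (midSwap n₁ e n₂ (j + 1)) (endComp 𝒱 i x y))
        (endAct 𝒱 (assocMap e (j + 1) m₃).symm (Equiv.refl _) z)) =
    endComp 𝒱 (e + i) (endAct 𝒱 (Equiv.refl _) (assocMap n₁ e (i + 1)) x)
      (endAct 𝒱 ((midSwap (i + 1) m₂ e m₃).trans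
          (sumMap (finAddFlip : Fin ((i + 1) + e) ≃ Fin (e + (i + 1))) (Equiv.refl _)))
        (Equiv.refl _)
        (endComp 𝒱 j y (endAct 𝒱 (swapFirst _ _ _) (Equiv.refl _) z))) := by
  refine mulT_ext (𝒱 := 𝒱) fun p₁ p₂₃ v₁ v₂₃ h₁ h₂₃ => ?_
  refine mulT_induction h₂₃ (fun p₂ p₃ v₂ v₃ h₂ h₃ _ => ?_) (by simp only [map_zero])
    fun x y hx hy => by simp only [map_add, hx, hy]
  rw [endAct_apply, permMap_assoc_symm]
  refine (congrArg (permMap 𝒱 (assocMap m₁ m₂ m₃)) (endComp_mulT (n₁ := n₁ + n₂) (j := e + j) _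
    (hz.endAct _ _) (mulT_mem_degree 𝒱 h₁ h₂) _)).trans (Eq.trans ?_ (endComp_mulT (j := e + i) _
      ((hy.endComp (hz.endAct _ _)).endAct _ _) h₁ _).symm)
  rw [endAct_apply _ _ (endComp 𝒱 j _ _), Equiv.refl_symm, permMap_refl,
    endComp_mulT _ (hz.endAct _ _) h₂, endAct_apply, endAct_apply, Equiv.refl_symm, permMap_refl,
    map_smul, map_smul, map_smul, smul_smul, ← sg_add]
  have hw := hz _ _ h₃
  generalize z v₃ = w at hw
  refine mulT_induction hw (fun q₁ q₂₃ w₁ w₂₃ k₁ k₂₃ _ => ?_) (by simp only [map_zero, smul_zero])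
    fun x y hx hy => by simp only [map_add, smul_add, hx, hy]
  refine mulT_induction k₂₃ (fun q₂ q₃ w₂ w₃ k₂ k₃ _ => ?_) (by simp only [map_zero, smul_zero])
    fun x y hx hy => by simp only [map_add, smul_add, hx, hy]
  rw [permMap_assoc_symm]
  erw [glue_mulT]
  rw [endAct_apply, permMap_symm_eq (permMap_midSwap 𝒱 v₁ k₁ h₂ w₂), permMap_refl, map_smul,
    endComp_mulT _ hy (mulT_mem_degree 𝒱 h₁ k₁), permMap_swapFirst 𝒱 k₁ k₂, map_smul (glue y v₂),
    glue_mulT]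
  have hu := hy _ _ (mulT_mem_degree 𝒱 h₂ k₂)
  generalize y (v₂ ⊙ w₂) = u at hu
  simp only [map_smul, LinearMap.smul_apply, smul_smul, ← sg_add]
  refine mulT_induction hu (fun t₁ t₂ u₁ u₂ l₁ l₂ ht => ?_) (by simp only [map_zero, smul_zero, LinearMap.zero_apply])
    fun x y hx hy => by simp only [map_add, smul_add, LinearMap.add_apply, hx, hy]
  rw [glue_mulT, permMap_assoc, ← permMap_permMap, permMap_midSwap 𝒱 u₁ l₂ k₁, map_smul,
    permMap_sumMap, permMap_refl, permMap_flip 𝒱 l₁ k₁]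
  simp only [map_smul, LinearMap.smul_apply, smul_smul, ← sg_add]
  erw [glue_mulT]
  rw [endAct_apply, permMap_refl, permMap_assoc_symm]
  congr 1
  -- The relation `ht`, which says that `u₁ u₂` has the degree of `y (v₂ w₂)`, makes the exponents
  -- differ by `-2 q₁ q₂`.
  exact sg_congr ⟨-(q₁ * q₂), by linear_combination (-q₁) * ht⟩

/-- Here `x` and `y` consume different outputs of `z`. Both orders give the same tensor, and what
remains of the permutation signs is the sign of exchanging `x` with `y`. -/
theorem endComp_assoc_out {m₁ n₁ m₂ n₂ m₃ n₃ i j : ℕ}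
    {x : EndV k V m₁ (n₁ + (i + 1))} {y : EndV k V m₂ (n₂ + (j + 1))}
    {z : EndV k V ((i + 1) + ((j + 1) + m₃)) n₃} {r t s : ℤ} (hx : HasDeg 𝒱 x r)
    (hy : HasDeg 𝒱 y t) (hz : HasDeg 𝒱 z s) :
    endComp 𝒱 i x (endAct 𝒱 (swapFirst _ _ _) (Equiv.refl _)
        (endComp 𝒱 j y (endAct 𝒱 (swapFirst _ _ _) (Equiv.refl _) z))) =
    sg k (r * t) • endAct 𝒱 (swapFirst _ _ _) (swapFirst _ _ _)
      (endComp 𝒱 j y (endAct 𝒱 (swapFirst _ _ _) (Equiv.refl _) (endComp 𝒱 i x z))) := by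
  refine mulT_ext (𝒱 := 𝒱) fun p₁ p₂₃ v₁ v₂₃ h₁ h₂₃ => ?_
  refine mulT_induction h₂₃ (fun p₂ p₃ v₂ v₃ h₂ h₃ _ => ?_) (by simp only [map_zero])
    fun x y hx hy => by simp only [map_add, hx, hy]
  rw [endComp_mulT _ ((hy.endComp (hz.endAct _ _)).endAct _ _) h₁, LinearMap.smul_apply,
    endAct_apply _ _ (endComp 𝒱 j y (endAct 𝒱 _ _ z)), Equiv.refl_symm, permMap_refl,
    endComp_mulT _ (hz.endAct _ _) h₂, endAct_apply, Equiv.refl_symm, permMap_refl,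
    endAct_apply, permMap_symm_eq (permMap_swapFirst 𝒱 h₂ h₁ v₃), map_smul (endComp 𝒱 j y _),
    endComp_mulT _ ((hx.endComp hz).endAct _ _) h₂, endAct_apply, Equiv.refl_symm, permMap_refl,
    endComp_mulT _ hz h₁]
  simp only [map_smul, smul_smul, ← sg_add]
  have hw := hz _ _ h₃
  generalize z v₃ = w at hw
  refine mulT_induction hw (fun q₁ q₂₃ w₁ w₂₃ k₁ k₂₃ _ => ?_) (by simp only [map_zero, smul_zero])
    fun x y hx hy => by simp only [map_add, smul_add, hx, hy]
  refine mulT_induction k₂₃ (fun q₂ q₃ w₂ w₃ k₂ k₃ _ => ?_) (by simp only [map_zero, smul_zero])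
    fun x y hx hy => by simp only [map_add, smul_add, hx, hy]
  have hu := hy _ _ (mulT_mem_degree 𝒱 h₂ k₂)
  have ha := hx _ _ (mulT_mem_degree 𝒱 h₁ k₁)
  rw [permMap_swapFirst 𝒱 k₁ k₂, map_smul, glue_mulT, map_smul, permMap_swapFirst 𝒱 hu k₁,
    map_smul, map_smul, glue_mulT, glue_mulT, permMap_swapFirst 𝒱 ha k₂, map_smul, glue_mulT,
    map_smul, permMap_swapFirst 𝒱 hu ha]
  simp only [smul_smul, ← sg_add]
  congr 1
  exact sg_congr ⟨-r * t - p₁ * p₂ - p₂ * r - q₂ * r - p₁ * q₂, by ring⟩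

/-- An explicit finite decomposition, for use where two tensors have to be expanded independently
and the two summations exchanged. -/
theorem exists_sum_mulT {a b : ℕ} {s : ℤ} {z : ⨂[k]^(a + b) V}
    (hz : z ∈ tensorDegree 𝒱 (a + b) s) :
    ∃ (α : Type) (_ : Fintype α) (p q : α → ℤ) (x : α → ⨂[k]^a V) (y : α → ⨂[k]^b V),
      (∀ i, x i ∈ tensorDegree 𝒱 a (p i)) ∧ (∀ i, y i ∈ tensorDegree 𝒱 b (q i)) ∧
      (∀ i, p i + q i = s) ∧ z = ∑ i, x i ⊙ y i := by
  refine mulT_induction hz (fun p q x y hx hy h => ?_) ?_ ?_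
  · exact ⟨Unit, inferInstance, fun _ => p, fun _ => q, fun _ => x, fun _ => y, fun _ => hx,
      fun _ => hy, fun _ => h, by simp⟩
  · exact ⟨Empty, inferInstance, Empty.elim, Empty.elim, Empty.elim, Empty.elim, by simp, by simp,
      by simp, by simp⟩
  · rintro _ _ ⟨α, _, p, q, x, y, hx, hy, h, rfl⟩ ⟨α', _, p', q', x', y', hx', hy', h', rfl⟩
    refine ⟨α ⊕ α', inferInstance, Sum.elim p p', Sum.elim q q', Sum.elim x x', Sum.elim y y',
      ?_, ?_, ?_, by simp [Fintype.sum_sum_type]⟩ <;> rintro (i | i) <;> simp [*]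

/-- Here `y` and `z` feed different inputs of `x`. Both `y v₂` and `z v₃` are expanded; the two
sides are the same double sum in opposite orders, up to the sign of exchanging `y` with `z`. -/
theorem endComp_assoc_in {m₁ n₁ m₂ n₂ m₃ n₃ i j : ℕ}
    (x : EndV k V m₁ ((n₁ + (i + 1)) + (j + 1))) {y : EndV k V ((i + 1) + m₂) n₂}
    {z : EndV k V ((j + 1) + m₃) n₃} {r s : ℤ} (hy : HasDeg 𝒱 y r) (hz : HasDeg 𝒱 z s) :
    endComp 𝒱 j (endAct 𝒱 (Equiv.refl _) (swapLast _ _ _)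
        (endComp 𝒱 i (endAct 𝒱 (Equiv.refl _) (swapLast _ _ _) x) y)) z =
    sg k (r * s) • endAct 𝒱 (swapLast _ _ _) (swapLast _ _ _)
      (endComp 𝒱 i (endAct 𝒱 (Equiv.refl _) (swapLast _ _ _) (endComp 𝒱 j x z)) y) := by
  refine mulT_ext (𝒱 := 𝒱) fun p₁₂ p₃ v₁₂ v₃ h₁₂ h₃ => ?_
  refine mulT_induction h₁₂ (fun p₁ p₂ v₁ v₂ h₁ h₂ _ => ?_)
    (by simp only [map_zero, LinearMap.zero_apply])
    fun x y hx hy => by simp only [map_add, LinearMap.add_apply, hx, hy]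
  rw [endComp_mulT _ hz (mulT_mem_degree 𝒱 h₁ h₂), LinearMap.smul_apply,
    endAct_apply _ _ (endComp 𝒱 i _ _), permMap_symm_eq (permMap_swapLast 𝒱 v₁ h₃ h₂),
    map_smul (endComp 𝒱 i _ _), endComp_mulT _ hy (mulT_mem_degree 𝒱 h₁ h₃)]
  simp only [map_smul, smul_smul, ← sg_add]
  obtain ⟨α, _, q, q', w, w', hw, hw', hq, hzw⟩ := exists_sum_mulT (hz _ _ h₃)
  obtain ⟨β, _, t, t', u, u', hu, hu', ht, hyu⟩ := exists_sum_mulT (hy _ _ h₂)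
  have hL : ∀ a, endAct 𝒱 (Equiv.refl _) (swapLast n₁ (j + 1) n₂)
      (endComp 𝒱 i (endAct 𝒱 (Equiv.refl _) (swapLast n₁ (i + 1) (j + 1)) x) y) (v₁ ⊙ v₂ ⊙ w a) =
      ∑ b, sg k (q a * p₂ + r * (p₁ + q a) + t b * q a) • (x (v₁ ⊙ u b ⊙ w a) ⊙ u' b) := by
    intro a
    rw [endAct_apply, permMap_symm_eq (permMap_swapLast 𝒱 v₁ (hw a) h₂), permMap_refl, map_smul,
      endComp_mulT _ hy (mulT_mem_degree 𝒱 h₁ (hw a)), hyu, map_sum, smul_smul, ← sg_add,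
      Finset.smul_sum]
    refine Finset.sum_congr rfl fun b _ => ?_
    rw [glue_mulT, endAct_apply, permMap_symm_eq (permMap_swapLast 𝒱 v₁ (hu b) (hw a)),
      permMap_refl, map_smul, map_smul, LinearMap.smul_apply, smul_smul, ← sg_add]
  have hR : ∀ b, endAct 𝒱 (Equiv.refl _) (swapLast n₁ (i + 1) n₃)
      (endComp 𝒱 j x z) (v₁ ⊙ v₃ ⊙ u b) =
      ∑ a, sg k (t b * p₃ + s * (p₁ + t b)) • (x (v₁ ⊙ u b ⊙ w a) ⊙ w' a) := by
    intro b
    rw [endAct_apply, permMap_symm_eq (permMap_swapLast 𝒱 v₁ (hu b) h₃), permMap_refl, map_smul,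
      endComp_mulT _ hz (mulT_mem_degree 𝒱 h₁ (hu b)), hzw, map_sum, smul_smul, ← sg_add,
      Finset.smul_sum]
    simp only [glue_mulT]
  rw [hzw, hyu]
  simp only [map_sum, glue_mulT, hL, hR, Finset.smul_sum, LinearMap.sum_apply, map_smul,
    LinearMap.smul_apply, smul_smul, ← sg_add]
  rw [Finset.sum_comm]
  refine Finset.sum_congr rfl fun b _ => Finset.sum_congr rfl fun a _ => ?_
  rw [permMap_swapLast 𝒱 _ (hw' a) (hu' b), smul_smul, ← sg_add]
  congr 1
  -- The degrees of the uncontracted outputs are eliminated through the total degrees of `z v₃` and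
  -- `y v₂`.
  rw [show q' a = p₃ + s - q a by linarith [hq a], show t' b = p₂ + r - t b by linarith [ht b]]
  exact sg_congr ⟨q a * p₂ + q a * r - r * s - p₂ * p₃ - r * p₃, by ring⟩

variable (hd : ∀ i : ℤ, ∀ x ∈ 𝒱 i, d x ∈ 𝒱 (i + 1))

include hd in
theorem HasDeg.endD {m n : ℕ} {f : EndV k V m n} {r : ℤ} (hf : HasDeg 𝒱 f r) :
    HasDeg 𝒱 (endD 𝒱 d f) (r + 1) := by
  intro s x hx
  rw [IBL.endD, endParity_of_hasDeg hf]
  refine sub_mem (mem_degree_congr (by ring) (tensorD_mem 𝒱 hd (hf s x hx)))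
    (Submodule.smul_mem _ _ (mem_degree_congr (by ring) (hf _ _ (tensorD_mem 𝒱 hd hx))))

theorem endD_apply {m n : ℕ} {f : EndV k V m n} {r : ℤ} (hf : HasDeg 𝒱 f r) (x : ⨂[k]^n V) :
    endD 𝒱 d f x = tensorD 𝒱 d m (f x) - sg k r • f (tensorD 𝒱 d n x) := by
  rw [IBL.endD, endParity_of_hasDeg hf]
  rfl

theorem tensorParity_permMap {m m' : ℕ} (ρ : Fin m ≃ Fin m') (x : ⨂[k]^m V) :
    tensorParity 𝒱 m' (permMap 𝒱 ρ x) = permMap 𝒱 ρ (tensorParity 𝒱 m x) := by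
  have : tensorParity 𝒱 m' ∘ₗ permMap 𝒱 ρ = permMap 𝒱 ρ ∘ₗ tensorParity 𝒱 m := by
    refine hom_ext (𝒱 := 𝒱) fun e v hv => ?_
    have := tprod_mem_degree 𝒱 hv
    rw [LinearMap.comp_apply, LinearMap.comp_apply, tensorParity_of_mem 𝒱 this,
      tensorParity_of_mem 𝒱 (permMap_mem 𝒱 ρ this), map_smul]
  exact LinearMap.congr_fun this x

include hd in
theorem endD_endAct {m n m' n' : ℕ} (ρ : Fin m ≃ Fin m') (σ : Fin n ≃ Fin n')
    (f : EndV k V m n) : endD 𝒱 d (endAct 𝒱 ρ σ f) = endAct 𝒱 ρ σ (endD 𝒱 d f) := by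
  refine LinearMap.ext fun x => ?_
  simp only [endD, endParity, endAct, LinearMap.sub_apply, LinearMap.comp_apply, map_sub,
    tensorD_permMap 𝒱 hd, tensorParity_permMap]

/-- The differential can hit the operation, the free inputs `x` or the tensor `w`. The term with `x`
is added back because `endD` also differentiates the inputs of `g`. -/
theorem tensorD_glue {m₁ n₁ l m₂ : ℕ} {g : EndV k V m₁ (n₁ + l)} {r p : ℤ} (hg : HasDeg 𝒱 g r)
    {x : ⨂[k]^n₁ V} (hx : x ∈ tensorDegree 𝒱 n₁ p) (w : ⨂[k]^(l + m₂) V) :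
    tensorD 𝒱 d _ (glue g x w) = glue (endD 𝒱 d g) x w + sg k r • glue g (tensorD 𝒱 d n₁ x) w +
      sg k (r + p) • glue g x (tensorD 𝒱 d _ w) := by
  have h : tensorD 𝒱 d _ ∘ₗ glue g x = glue (endD 𝒱 d g) x + sg k r • glue g (tensorD 𝒱 d n₁ x) +
      sg k (r + p) • glue g x ∘ₗ tensorD 𝒱 d (l + m₂) := by
    refine mulT_ext (𝒱 := 𝒱) fun q q' u w hu hw => ?_
    simp only [LinearMap.comp_apply, LinearMap.add_apply, LinearMap.smul_apply, glue_mulT,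
      tensorD_mulT 𝒱 (hg _ _ (mulT_mem_degree 𝒱 hx hu)), endD_apply hg, tensorD_mulT 𝒱 hx,
      tensorD_mulT 𝒱 hu, map_add, map_smul, map_sub, LinearMap.sub_apply, sg_add, smul_add,
      mul_smul]
    rw [smul_comm (sg k q)]
    rw [smul_comm (sg k p) (sg k r)]
    abel
  exact LinearMap.congr_fun h w

include hd in
-- The Leibniz rule reduces compatibility with differentials to generators.
theorem endD_endComp {m₁ n₁ m₂ n₂ j : ℕ} {g : EndV k V m₁ (n₁ + (j + 1))}
    {f : EndV k V ((j + 1) + m₂) n₂} {r s : ℤ} (hg : HasDeg 𝒱 g r) (hf : HasDeg 𝒱 f s) :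
    endD 𝒱 d (endComp 𝒱 j g f) =
      endComp 𝒱 j (endD 𝒱 d g) f + sg k r • endComp 𝒱 j g (endD 𝒱 d f) := by
  refine mulT_ext (𝒱 := 𝒱) fun p q x y hx hy => ?_
  rw [endD_apply (hg.endComp hf), endComp_mulT g hf hx, map_smul, tensorD_glue hg hx,
    tensorD_mulT 𝒱 hx, map_add, map_smul, endComp_mulT g hf (tensorD_mem 𝒱 hd hx),
    endComp_mulT g hf hx, LinearMap.add_apply, LinearMap.smul_apply, endComp_mulT _ hf hx,
    endComp_mulT g (hf.endD hd) hx, endD_apply hf]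
  have h1 := sg_mul_self (k := k) s
  simp only [map_sub, map_smul, mul_add, add_mul, sg_add, mul_one, one_mul]
  -- The two terms with the differential on `x` carry signs that differ by the square of `sg k s`,
  -- so they cancel.
  linear_combination (norm := module) -(sg k r * sg k (s * p) * h1) • glue g (tensorD 𝒱 d n₁ x) (f y)

end EndProperad

/-! ### Algebras over the cobar complex and `IBL_∞`-structures -/

section Algebras

variable {k : Type u} [Field k] [CharZero k] {V : Type v} [AddCommGroup V] [Module k V]
  {𝒱 : ℤ → Submodule k V} [DirectSum.Decomposition 𝒱] {d : V →ₗ[k] V} {ne : Bool}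

theorem frobAct_one {m n G m' n' G' : ℕ} (ρ : Fin m ≃ Fin m') (σ : Fin n ≃ Fin n') (h : G = G') :
    frobAct k ne ρ σ h 1 = 1 := by
  have hm : m = m' := by simpa using Fintype.card_congr ρ
  have hn : n = n' := by simpa using Fintype.card_congr σ
  subst hm hn h
  funext a
  change frobDual k ne m n G 1 = 1
  rw [frobDual_apply _ a]
  rfl

/-- A component of the Frobenius properad is spanned by its element `1`, which is zero for an index
that is not allowed, so a functional is known from its value there. -/
theorem dual_frob_eq {m n G : ℕ} (φ : Module.Dual k (FrobX k ne m n G)) :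
    φ = φ 1 • frobDual k ne m n G := by
  refine LinearMap.ext fun x => ?_
  have hx : x = frobDual k ne m n G x • (1 : FrobX k ne m n G) := by
    funext a
    rw [frobDual_apply _ a]
    simp
  conv_lhs => rw [hx]
  rw [map_smul, LinearMap.smul_apply, smul_eq_mul, smul_eq_mul, mul_comm]

theorem frobDual_one_smul {M : Type*} [AddCommGroup M] [Module k M] {m n G : ℕ} {x : M}
    (h : ¬ Adm ne m n G → x = 0) : frobDual k ne m n G 1 • x = x := by
  by_cases ha : Adm ne m n G
  · rw [frobDual_apply _ ⟨ha⟩]; simp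
  · rw [h ha, smul_zero]

variable (k ne) in
/-- The generator of the Frobenius properad. -/
def frobGen (m n G : ℕ) : (frob k ne).X m n G := fun _ => 1

variable (𝒱) in
/-- The evaluation of formal composites of generators on a family of operations. -/
def valueTerm (f : ∀ m n _G : ℕ, EndV k V m n) :
    {m n G : ℕ} → Term (frob k ne) m n G → EndV k V m n
  | m, n, G, .gen φ => φ (frobGen k ne m n G) • f m n G
  | _, _, _, .act ρ σ _ t => endAct 𝒱 ρ σ (valueTerm f t)
  | _, _, _, .comp j t s => endComp 𝒱 j (valueTerm f t) (valueTerm f s)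

variable (𝒱) in
/-- The linear extension of `valueTerm`. -/
def evalPre (f : ∀ m n _G : ℕ, EndV k V m n) {m n G : ℕ} :
    Pre (frob k ne) m n G →ₗ[k] EndV k V m n :=
  Finsupp.lift _ k _ (valueTerm 𝒱 f)

theorem evalPre_single (f : ∀ m n _G : ℕ, EndV k V m n) {m n G : ℕ} (t : Term (frob k ne) m n G) :
    evalPre 𝒱 f (single t) = valueTerm 𝒱 f t := by
  simp [evalPre, single]

theorem pre_ext {M : Type*} [AddCommGroup M] [Module k M] {P : Properad k} {m n G : ℕ}
    {F F' : Pre P m n G →ₗ[k] M} (h : ∀ t, F (single t) = F' (single t)) : F = F' :=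
  Finsupp.lhom_ext' fun t => LinearMap.ext_ring (h t)

theorem evalPre_act (f : ∀ m n _G : ℕ, EndV k V m n) {m n G m' n' G' : ℕ} (ρ : Fin m ≃ Fin m')
    (σ : Fin n ≃ Fin n') (h : G = G') (x : Pre (frob k ne) m n G) :
    evalPre 𝒱 f (preAct ρ σ h x) = endAct 𝒱 ρ σ (evalPre 𝒱 f x) := by
  have : evalPre 𝒱 f ∘ₗ preAct (P := frob k ne) ρ σ h = endActL 𝒱 ρ σ ∘ₗ evalPre 𝒱 f :=
    pre_ext fun t => by
      rw [LinearMap.comp_apply, LinearMap.comp_apply, preAct_single, evalPre_single,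
        evalPre_single]
      rfl
  exact LinearMap.congr_fun this x

theorem evalPre_comp (f : ∀ m n _G : ℕ, EndV k V m n) {m₁ n₁ G₁ m₂ n₂ G₂ j : ℕ}
    (x : Pre (frob k ne) m₁ (n₁ + (j + 1)) G₁) (y : Pre (frob k ne) ((j + 1) + m₂) n₂ G₂) :
    evalPre 𝒱 f (preComp j x y) = endComp 𝒱 j (evalPre 𝒱 f x) (evalPre 𝒱 f y) := by
  have : (preComp (P := frob k ne) (G₁ := G₁) (G₂ := G₂) (m₁ := m₁) (n₁ := n₁) (m₂ := m₂)
      (n₂ := n₂) j).compr₂ (evalPre 𝒱 f) =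
      (endCompL 𝒱 j).compl₁₂ (evalPre 𝒱 f) (evalPre 𝒱 f) :=
    pre_ext fun t => pre_ext fun s => by
      rw [LinearMap.compr₂_apply, LinearMap.compl₁₂_apply, preComp_single, evalPre_single,
        evalPre_single, evalPre_single]
      rfl
  exact LinearMap.congr_fun₂ this x y

variable {f : ∀ m n _G : ℕ, EndV k V m n}

theorem valueTerm_hasDeg (hf : IsOperations 𝒱 ne f) {m n G : ℕ} (t : Term (frob k ne) m n G) :
    HasDeg 𝒱 (valueTerm 𝒱 f t) t.deg := by
  induction t with
  | gen φ => exact (hf.degree _ _ _).smul _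
  | act ρ σ h t ih => exact ih.endAct ρ σ
  | comp j t s iht ihs =>
    simp only [valueTerm, Term.deg, Nat.cast_add]
    exact iht.endComp ihs

/-- The existence half of the universal property. Each relation of the free properad is an axiom
just verified in the endomorphism properad. The relation for relabelled generators uses the symmetry
of the operations and the trivial action on the Frobenius properad. -/
theorem evalPre_rel (hf : IsOperations 𝒱 ne f) {m n G : ℕ} {x : Pre (frob k ne) m n G}
    (hx : Rel x) : evalPre 𝒱 f x = 0 := by
  induction hx with
  | gen_add φ ψ =>
    simp only [map_sub, map_add, evalPre_single, valueTerm, LinearMap.add_apply, add_smul, sub_self]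
  | gen_smul c φ =>
    simp only [map_sub, map_smul, evalPre_single, valueTerm, LinearMap.smul_apply, smul_eq_mul,
      mul_smul, sub_self]
  | gen_act ρ σ h φ =>
    rename_i m n G m' n' G'
    have hm : m = m' := by simpa using Fintype.card_congr ρ
    have hn : n = n' := by simpa using Fintype.card_congr σ
    subst hm hn h
    rw [map_sub, evalPre_single, evalPre_single, sub_eq_zero]
    simp only [valueTerm]
    rw [endAct_smul, hf.symm]
    exact congrArg (fun a => φ a • f m n G) (frobAct_one ρ.symm σ.symm rfl).symm
  | act_id t => simp only [map_sub, evalPre_single, valueTerm, endAct_refl, sub_self]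
  | act_act ρ σ h ρ' σ' h' t =>
    simp only [map_sub, evalPre_single, valueTerm, endAct_endAct, sub_self]
  | comp_act ρ₁ σ₁ ρ₂ σ₂ τ h₁ h₂ t s =>
    simp only [map_sub, evalPre_single, valueTerm]
    rw [endComp_act _ _ _ _ _ _ (valueTerm_hasDeg hf s), sub_self]
  | assoc x y z =>
    rw [map_sub, evalPre_single, evalPre_single, sub_eq_zero]
    exact endComp_assoc _ (valueTerm_hasDeg hf y) (valueTerm_hasDeg hf z)
  | assoc_out x y z =>
    rw [map_sub, map_smul, evalPre_single, evalPre_single, sub_eq_zero]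
    refine (endComp_assoc_out (valueTerm_hasDeg hf x) (valueTerm_hasDeg hf y)
      (valueTerm_hasDeg hf z)).trans ?_
    rw [← Nat.cast_mul, sg_natCast]
    rfl
  | assoc_in x y z =>
    rw [map_sub, map_smul, evalPre_single, evalPre_single, sub_eq_zero]
    refine (endComp_assoc_in _ (valueTerm_hasDeg hf y) (valueTerm_hasDeg hf z)).trans ?_
    rw [← Nat.cast_mul, sg_natCast]
    rfl
  | act ρ σ h _ ih => rw [evalPre_act, ih]; exact map_zero (endActL 𝒱 ρ σ)
  | comp_left s _ ih =>
    rw [evalPre_comp, ih]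
    exact LinearMap.map_zero₂ (endCompL 𝒱 _) _
  | comp_right t _ ih =>
    rw [evalPre_comp, ih]
    exact map_zero (endCompL 𝒱 _ _)

/-- The map from the cobar complex defined by a family of operations. -/
def evalCobar (hf : IsOperations 𝒱 ne f) (m n G : ℕ) : Cobar (frob k ne) m n G →ₗ[k] EndV k V m n :=
  Submodule.liftQ _ (evalPre 𝒱 f) (Submodule.span_le.2 fun _ hx => evalPre_rel hf hx)

theorem evalCobar_mk (hf : IsOperations 𝒱 ne f) {m n G : ℕ} (t : Term (frob k ne) m n G) :
    evalCobar hf m n G (mk t) = valueTerm 𝒱 f t :=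
  evalPre_single f t

theorem cobar_ext {M : Type*} [AddCommGroup M] [Module k M] {P : Properad k} {m n G : ℕ}
    {F F' : Cobar P m n G →ₗ[k] M} (h : ∀ t, F (mk t) = F' (mk t)) : F = F' :=
  Submodule.linearMap_qext _ (pre_ext h)

theorem sum_smul_coord {X : Type*} [AddCommGroup X] [Module k X] {α : Type*} [Fintype α]
    (b : Module.Basis α k X) (φ : Module.Dual k X) : ∑ p, φ (b p) • b.coord p = φ := by
  classical
  refine b.ext fun i => ?_
  rw [LinearMap.sum_apply, Finset.sum_eq_single i]
  · simp
  · intro j _ hj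
    simp [hj.symm]
  · simp

/-- The sum over dual bases is the canonical tensor and does not depend on the bases. This removes
the arbitrary bases from the cobar differential. -/
theorem sum_dual_basis {X Y M : Type*} [AddCommGroup X] [Module k X] [AddCommGroup Y] [Module k Y]
    [AddCommGroup M] [Module k M] {α β : Type*} [Fintype α] [Fintype β] (b : Module.Basis α k X)
    (b' : Module.Basis β k Y) (B : Module.Dual k X →ₗ[k] Module.Dual k Y →ₗ[k] M)
    (φ : Module.Dual k X) (ψ : Module.Dual k Y) :
    ∑ p, ∑ q, (φ (b p) * ψ (b' q)) • B (b.coord p) (b'.coord q) = B φ ψ := by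
  conv_rhs => rw [← sum_smul_coord b φ, map_sum, LinearMap.sum_apply]
  refine Finset.sum_congr rfl fun p _ => ?_
  conv_rhs => rw [← sum_smul_coord b' ψ, map_sum]
  refine Finset.sum_congr rfl fun q _ => ?_
  simp only [map_smul, LinearMap.smul_apply, smul_smul, mul_comm]

/-- The differential of the generator dual to `p`. -/
theorem dGen_frobDual (m n G : ℕ) : dGen (P := frob k ne) (frobDual k ne m n G) =
    splitSum k m n G fun m₁ m₂ n₁ n₂ G₁ G₂ j ρ σ h =>
      Cobar.act ρ σ h (Cobar.comp j (Cobar.gen (P := frob k ne) (frobDual k ne m₁ (n₁ + (j + 1)) G₁))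
        (Cobar.gen (P := frob k ne) (frobDual k ne ((j + 1) + m₂) n₂ G₂))) := by
  unfold dGen
  congr! 10 with m₁ m₂ n₁ n₂ G₁ G₂ j ρ σ
  funext h
  refine Eq.trans ?_ (sum_dual_basis (Module.finBasis k ((frob k ne).X m₁ (n₁ + (j + 1)) G₁))
    (Module.finBasis k ((frob k ne).X ((j + 1) + m₂) n₂ G₂))
    (((Cobar.comp j).compl₁₂ Cobar.gen Cobar.gen).compr₂ (Cobar.act ρ σ h))
    (frobDual k ne m₁ (n₁ + (j + 1)) G₁) (frobDual k ne ((j + 1) + m₂) n₂ G₂))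
  refine Finset.sum_congr rfl fun p _ => Finset.sum_congr rfl fun q _ => ?_
  refine congrArg₂ (· • ·) ?_ rfl
  -- The coefficient factors as a product of two values of `frobDual`, because composition in the
  -- Frobenius properad multiplies coefficients.
  exact (frobDual_act ρ σ h _).trans (frobDual_comp _ _)

theorem splitSum_congr {M : Type*} [AddCommGroup M] [Module k M] {m n G : ℕ}
    {F F' : ∀ m₁ m₂ n₁ n₂ G₁ G₂ j : ℕ, (Fin (m₁ + m₂) ≃ Fin m) → (Fin (n₁ + n₂) ≃ Fin n) →
      G₁ + G₂ + j = G → M} (h : ∀ m₁ m₂ n₁ n₂ G₁ G₂ j ρ σ h,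
        F m₁ m₂ n₁ n₂ G₁ G₂ j ρ σ h = F' m₁ m₂ n₁ n₂ G₁ G₂ j ρ σ h) :
    splitSum k m n G F = splitSum k m n G F' := by
  congr! 10
  funext
  exact h _ _ _ _ _ _ _ _ _ _

variable (𝒱) in
/-- The right hand side of the quadratic relations. -/
def quadratic (f : ∀ m n _G : ℕ, EndV k V m n) (m n G : ℕ) : EndV k V m n :=
  splitSum k m n G fun m₁ m₂ n₁ n₂ G₁ G₂ j ρ σ _ =>
    endAct 𝒱 ρ σ (endComp 𝒱 j (f m₁ (n₁ + (j + 1)) G₁) (f ((j + 1) + m₂) n₂ G₂))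

theorem valueTerm_frobDual (hf : IsOperations 𝒱 ne f) (m n G : ℕ) :
    valueTerm 𝒱 f (.gen (P := frob k ne) (frobDual k ne m n G)) = f m n G :=
  frobDual_one_smul (hf.support m n G)

theorem evalCobar_dGen (hf : IsOperations 𝒱 ne f) (m n G : ℕ) :
    evalCobar hf m n G (dGen (P := frob k ne) (frobDual k ne m n G)) = quadratic 𝒱 f m n G := by
  rw [dGen_frobDual, map_splitSum]
  refine splitSum_congr fun m₁ m₂ n₁ n₂ G₁ G₂ j ρ σ h => ?_
  refine Eq.trans (congrArg (evalCobar hf m n G) ((congrArg (Cobar.act ρ σ h)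
    (comp_mk _ _)).trans (act_mk _ _ _ _))) ((evalCobar_mk hf _).trans ?_)
  change endAct 𝒱 ρ σ (endComp 𝒱 j (valueTerm 𝒱 f _) (valueTerm 𝒱 f _)) = _
  rw [valueTerm_frobDual hf, valueTerm_frobDual hf]

theorem evalCobar_act (hf : IsOperations 𝒱 ne f) {m n G m' n' G' : ℕ} (ρ : Fin m ≃ Fin m')
    (σ : Fin n ≃ Fin n') (h : G = G') (x : Cobar (frob k ne) m n G) :
    evalCobar hf m' n' G' (Cobar.act ρ σ h x) = endAct 𝒱 ρ σ (evalCobar hf m n G x) := by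
  obtain ⟨x, rfl⟩ := Submodule.Quotient.mk_surjective _ x
  exact evalPre_act f ρ σ h x

theorem evalCobar_comp (hf : IsOperations 𝒱 ne f) {m₁ n₁ G₁ m₂ n₂ G₂ j : ℕ}
    (x : Cobar (frob k ne) m₁ (n₁ + (j + 1)) G₁) (y : Cobar (frob k ne) ((j + 1) + m₂) n₂ G₂) :
    evalCobar hf _ _ _ (Cobar.comp j x y) =
      endComp 𝒱 j (evalCobar hf _ _ _ x) (evalCobar hf _ _ _ y) := by
  obtain ⟨x, rfl⟩ := Submodule.Quotient.mk_surjective _ x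
  obtain ⟨y, rfl⟩ := Submodule.Quotient.mk_surjective _ y
  exact evalPre_comp f x y

/-- Both sides are equivariant and obey the Leibniz rule, so an induction over composites reduces to
a generator, where the claim is the quadratic relation. -/
theorem evalCobar_dTerm (hd : ∀ i : ℤ, ∀ x ∈ 𝒱 i, d x ∈ 𝒱 (i + 1)) (hf : IsIBL 𝒱 d ne f)
    {m n G : ℕ} (t : Term (frob k ne) m n G) :
    evalCobar hf.toIsOperations m n G (dTerm t) = endD 𝒱 d (valueTerm 𝒱 f t) := by
  induction t with
  | gen φ =>
    rename_i m n G
    have h : dTerm (.gen φ) = φ (frobGen k ne m n G) • dGen (P := frob k ne) (frobDual k ne m n G) :=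
      (congrArg dGen (dual_frob_eq φ)).trans (dGen_smul _ _)
    rw [h, map_smul, evalCobar_dGen]
    change _ = endD 𝒱 d (φ (frobGen k ne m n G) • f m n G)
    have hr : quadratic 𝒱 f m n G = endD 𝒱 d (f m n G) := (hf.relation m n G).symm
    rw [hr]
    simp only [endD, endParity, LinearMap.smul_comp, LinearMap.comp_smul, smul_sub]
  | act ρ σ h t ih =>
    simp only [dTerm, valueTerm]
    rw [evalCobar_act, ih, endD_endAct hd]
  | comp j t s iht ihs =>
    simp only [dTerm, valueTerm]
    rw [map_add, map_smul, evalCobar_comp, evalCobar_comp, iht, ihs, evalCobar_mk, evalCobar_mk,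
      endD_endComp hd (valueTerm_hasDeg hf.toIsOperations t) (valueTerm_hasDeg hf.toIsOperations s),
      sg_natCast]

/-- The algebra over the cobar complex defined by an `IBL_∞`-structure. -/
def algebraOfIBL (hd : ∀ i : ℤ, ∀ x ∈ 𝒱 i, d x ∈ 𝒱 (i + 1)) (hf : IsIBL 𝒱 d ne f) :
    CobarAlgebra 𝒱 d (frob k ne) where
  toFun := evalCobar hf.toIsOperations
  map_degree m n G e x hx := by
    induction hx using Submodule.span_induction with
    | mem x hx =>
      obtain ⟨t, rfl, rfl⟩ := hx
      rw [evalCobar_mk]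
      exact valueTerm_hasDeg hf.toIsOperations t
    | zero => rw [map_zero]; exact HasDeg.zero _
    | add x y _ _ hx hy => rw [map_add]; exact hx.add hy
    | smul c x _ hx => rw [map_smul]; exact hx.smul c
  map_d m n G x := by
    induction x using Cobar.ind with
    | hmk t =>
      rw [evalCobar_mk, ← evalCobar_dTerm hd hf]
      exact congrArg _ (preD_single t)
    | h0 => simp [endD, endParity]
    | hadd x y hx hy =>
      rw [map_add, map_add, map_add, hx, hy]
      simp only [endD, endParity, LinearMap.add_comp, LinearMap.comp_add]
      abel
    | hsmul c x hx =>
      rw [map_smul, map_smul, map_smul, hx]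
      simp only [endD, endParity, LinearMap.smul_comp, LinearMap.comp_smul, smul_sub]
  map_act _ _ _ _ _ _ ρ σ h x := evalCobar_act hf.toIsOperations ρ σ h x
  map_comp _ _ _ _ _ _ _ x y := evalCobar_comp hf.toIsOperations x y

theorem isOperations_operations (α : CobarAlgebra 𝒱 d (frob k ne)) :
    IsOperations 𝒱 ne (operations 𝒱 d α) where
  degree m n G := α.map_degree m n G 1 _ (gen_mem_degree _)
  support m n G h := by
    have : frobDual k ne m n G = 0 := by simp [frobDual, h]
    rw [operations, this]
    exact (congrArg _ (map_zero (Cobar.gen (P := frob k ne)))).trans (map_zero _)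
  symm m n G ρ σ := by
    refine (α.map_act m n G m n G ρ σ rfl _).symm.trans (congrArg (α.toFun m n G) ?_)
    refine (act_mk _ _ _ _).trans ((mk_eq (Rel.gen_act ρ σ rfl _)).trans ?_)
    refine congrArg (Cobar.gen (P := frob k ne)) (LinearMap.ext fun x => ?_)
    exact frobDual_act ρ.symm σ.symm rfl x

theorem isIBL_operations (α : CobarAlgebra 𝒱 d (frob k ne)) :
    IsIBL 𝒱 d ne (operations 𝒱 d α) where
  toIsOperations := isOperations_operations α
  relation m n G := by
    rw [operations, ← α.map_d]
    have h : Cobar.d (Cobar.gen (P := frob k ne) (frobDual k ne m n G)) = dGen (frobDual k ne m n G) :=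
      preD_single _
    rw [h, dGen_frobDual, map_splitSum]
    refine splitSum_congr fun m₁ m₂ n₁ n₂ G₁ G₂ j ρ σ h => ?_
    exact (α.map_act _ _ _ _ _ _ _ _ _ _).trans
      (congrArg (endAct 𝒱 ρ σ) (α.map_comp _ _ _ _ _ _ _ _ _))

/-- Injectivity holds because composites of generators span the cobar complex, and surjectivity is
the universal property `algebraOfIBL`. -/
theorem bijOn_operations (hd : ∀ i : ℤ, ∀ x ∈ 𝒱 i, d x ∈ 𝒱 (i + 1)) :
    Set.BijOn (fun α : CobarAlgebra 𝒱 d (frob k ne) => operations 𝒱 d α)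
      Set.univ {f | IsIBL 𝒱 d ne f} := by
  refine ⟨fun α _ => isIBL_operations α, fun α _ β _ h => ?_, fun f hf => ?_⟩
  · have key : ∀ {m n G : ℕ} (t : Term (frob k ne) m n G),
        α.toFun m n G (mk t) = β.toFun m n G (mk t) := by
      intro m n G t
      induction t with
      | gen φ =>
        rename_i m n G
        have h1 : (mk (.gen φ) : Cobar (frob k ne) m n G) =
            φ (frobGen k ne m n G) • Cobar.gen (P := frob k ne) (frobDual k ne m n G) :=
          (congrArg Cobar.gen (dual_frob_eq φ)).trans (map_smul _ _ _)
        rw [h1, map_smul, map_smul]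
        exact congrArg _ (congrFun (congrFun (congrFun h m) n) G)
      | act ρ σ h t ih => rw [← act_mk, α.map_act, β.map_act, ih]
      | comp j t s iht ihs => rw [← comp_mk, α.map_comp, β.map_comp, iht, ihs]
    exact CobarAlgebra.ext (funext fun m => funext fun n => funext fun G => cobar_ext key)
  · refine ⟨algebraOfIBL hd hf, trivial, ?_⟩
    funext m n G
    exact (evalCobar_mk hf.toIsOperations _).trans (valueTerm_frobDual hf.toIsOperations m n G)

end Algebras

/-! ### Graded symmetric algebras -/

section SymAlgebra

variable {k : Type u} [Field k] {ι : Type w} (deg : ι → ℤ)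

variable (k) in
/-- The monomial of a list of generators. -/
def mon (l : List ι) : Sym k deg := (l.map (Sym.x deg)).prod

@[simp] theorem mon_nil : mon k deg [] = 1 := rfl

@[simp] theorem mon_cons (j : ι) (l : List ι) : mon k deg (j :: l) = Sym.x deg j * mon k deg l := by
  simp [mon]

@[simp] theorem mon_append (l l' : List ι) :
    mon k deg (l ++ l') = mon k deg l * mon k deg l' := by
  simp [mon]

theorem monomial_eq_mon {m : ℕ} (J : Fin m → ι) :
    Sym.monomial (k := k) deg J = mon k deg (List.ofFn J) := by
  simp [mon, Sym.monomial, List.map_ofFn, Function.comp_def]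

theorem span_mon : Submodule.span k (Set.range (mon k deg)) = ⊤ := by
  rw [eq_top_iff]
  rintro y -
  obtain ⟨y, rfl⟩ := RingQuot.mkAlgHom_surjective k (SymRel k deg) y
  -- Stability of the span under left multiplication is the form that survives products in the free
  -- algebra; it is then applied to `1`.
  suffices h : ∀ z ∈ Submodule.span k (Set.range (mon k deg)),
      RingQuot.mkAlgHom k (SymRel k deg) y * z ∈ Submodule.span k (Set.range (mon k deg)) by
    simpa using h 1 (Submodule.subset_span ⟨[], rfl⟩)
  induction y using FreeAlgebra.induction with
  | grade0 r =>
    intro z hz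
    rw [AlgHom.commutes, ← Algebra.smul_def]
    exact Submodule.smul_mem _ _ hz
  | grade1 j =>
    intro z hz
    induction hz using Submodule.span_induction with
    | mem z hz =>
      obtain ⟨l, rfl⟩ := hz
      exact Submodule.subset_span ⟨j :: l, mon_cons deg j l⟩
    | zero => rw [mul_zero]; exact zero_mem _
    | add x y _ _ hx hy => rw [mul_add]; exact add_mem hx hy
    | smul c x _ hx => rw [mul_smul_comm]; exact Submodule.smul_mem _ c hx
  | mul a b ha hb =>
    intro z hz
    rw [map_mul, mul_assoc]
    exact ha _ (hb z hz)
  | add a b ha hb =>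
    intro z hz
    rw [map_add, add_mul]
    exact add_mem (ha z hz) (hb z hz)

variable {deg} in
theorem sym_hom_ext {M : Type*} [AddCommGroup M] [Module k M] {F G : Sym k deg →ₗ[k] M}
    (h : ∀ l, F (mon k deg l) = G (mon k deg l)) : F = G :=
  LinearMap.ext_on_range (span_mon deg) h

variable {deg} in
@[elab_as_elim]
theorem sym_induction {P : Sym k deg → Prop} (y : Sym k deg) (mon : ∀ l, P (mon k deg l))
    (zero : P 0) (add : ∀ x y, P x → P y → P (x + y)) (smul : ∀ (c : k) x, P x → P (c • x)) :
    P y := by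
  have hy : y ∈ Submodule.span k (Set.range (IBL.mon k deg)) := by rw [span_mon]; trivial
  induction hy using Submodule.span_induction with
  | mem x hx => obtain ⟨l, rfl⟩ := hx; exact mon l
  | zero => exact zero
  | add x y _ _ hx hy => exact add x y hx hy
  | smul c x _ hx => exact smul c x hx

/-- Total degree of a list of generators. -/
def ldeg (l : List ι) : ℤ := (l.map deg).sum

@[simp] theorem ldeg_nil : ldeg deg [] = 0 := rfl

@[simp] theorem ldeg_cons (j : ι) (l : List ι) : ldeg deg (j :: l) = deg j + ldeg deg l := by
  simp [ldeg]

@[simp] theorem ldeg_append (l l' : List ι) : ldeg deg (l ++ l') = ldeg deg l + ldeg deg l' := by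
  simp [ldeg]

@[simp] theorem ldeg_reverse (l : List ι) : ldeg deg l.reverse = ldeg deg l := by
  simp [ldeg, List.sum_reverse]

theorem ldeg_ofFn {m : ℕ} (J : Fin m → ι) : ldeg deg (List.ofFn J) = ∑ r, deg (J r) := by
  simp [ldeg, List.map_ofFn, List.sum_ofFn]

theorem x_mul_x (i j : ι) : (Sym.x deg i * Sym.x deg j : Sym k deg) =
    sg k (deg i * deg j) • (Sym.x deg j * Sym.x deg i) := Sym.x_mul_x deg i j

theorem x_mul_mon (j : ι) (l : List ι) : Sym.x deg j * mon k deg l =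
    sg k (deg j * ldeg deg l) • (mon k deg l * Sym.x deg j) := by
  induction l with
  | nil => simp
  | cons i l ih =>
    rw [mon_cons, ← mul_assoc, x_mul_x, smul_mul_assoc, mul_assoc, ih, mul_smul_comm, mul_assoc,
      smul_smul, ← sg_add, ldeg_cons, mul_add]

theorem mon_mul_mon (l l' : List ι) : mon k deg l * mon k deg l' =
    sg k (ldeg deg l * ldeg deg l') • (mon k deg l' * mon k deg l) := by
  induction l with
  | nil => simp
  | cons i l ih =>
    rw [mon_cons, mul_assoc, ih, mul_smul_comm, ← mul_assoc, x_mul_mon, smul_mul_assoc, smul_smul,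
      ← sg_add, mul_assoc, ldeg_cons, add_mul, add_comm]

/-! ### Derivatives -/

/-- Twisted derivations are upper right entries of homomorphisms to triangular matrices, so their
Leibniz rules are instances of matrix multiplication. -/
theorem exists_skew_hom (s t : ι → k) (δ : ι → Sym k deg)
    (h : ∀ i j, s i • Sym.x deg i * δ j + δ i * t j • Sym.x deg j =
      (-1 : k) ^ (deg i * deg j) • (s j • Sym.x deg j * δ i + δ j * t i • Sym.x deg i)) :
    ∃ M : Sym k deg →ₐ[k] Matrix (Fin 2) (Fin 2) (Sym k deg),
      (∀ j, M (Sym.x deg j) = !![s j • Sym.x deg j, δ j; 0, t j • Sym.x deg j]) ∧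
      ∀ y, Sym.skew deg s t δ h y = M y 0 1 :=
  ⟨_, fun j => by
    rw [Sym.x]
    erw [RingQuot.liftAlgHom_mkAlgHom_apply]
    exact FreeAlgebra.lift_ι_apply _ _, fun y => rfl⟩

theorem skew_one (s t : ι → k) (δ : ι → Sym k deg) (h) : Sym.skew deg s t δ h 1 = 0 := by
  obtain ⟨M, -, h2⟩ := exists_skew_hom deg s t δ h
  rw [h2, map_one]
  simp

theorem skew_x_mul (s : ι → k) (δ : ι → Sym k deg) (h) (j : ι) (y : Sym k deg) :
    Sym.skew deg s (fun _ => 1) δ h (Sym.x deg j * y) =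
      s j • (Sym.x deg j * Sym.skew deg s (fun _ => 1) δ h y) + δ j * y := by
  obtain ⟨M, h1, h2⟩ := exists_skew_hom deg s (fun _ => 1) δ h
  -- The trivial right twist makes the lower right entry of `M` the identity homomorphism.
  have h11 : ∀ y, M y 1 1 = y ∧ M y 1 0 = 0 := by
    intro y
    induction y using sym_induction with
    | mon l =>
      induction l with
      | nil => simp
      | cons i l ih =>
        rw [mon_cons, map_mul, h1, Matrix.mul_apply, Matrix.mul_apply]
        simp [Fin.sum_univ_two, ih.1, ih.2]
    | zero => simp
    | add x y hx hy => simp [hx, hy]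
    | smul c x hx => simp [hx]
  rw [h2, h2, map_mul, h1, Matrix.mul_apply]
  simp [Fin.sum_univ_two, (h11 y).1]

theorem skew_mul_x (t : ι → k) (δ : ι → Sym k deg) (h) (j : ι) (y : Sym k deg) :
    Sym.skew deg (fun _ => 1) t δ h (y * Sym.x deg j) =
      y * δ j + t j • (Sym.skew deg (fun _ => 1) t δ h y * Sym.x deg j) := by
  obtain ⟨M, h1, h2⟩ := exists_skew_hom deg (fun _ => 1) t δ h
  have h00 : ∀ y, M y 0 0 = y := by
    have h10 : ∀ y, M y 1 0 = 0 := by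
      intro y
      induction y using sym_induction with
      | mon l =>
        induction l with
        | nil => simp
        | cons i l ih =>
          rw [mon_cons, map_mul, h1, Matrix.mul_apply]
          simp [Fin.sum_univ_two, ih]
      | zero => simp
      | add x y hx hy => simp [hx, hy]
      | smul c x hx => simp [hx]
    intro y
    induction y using sym_induction with
    | mon l =>
      induction l with
      | nil => simp
      | cons i l ih =>
        rw [mon_cons, map_mul, h1, Matrix.mul_apply]
        simp [Fin.sum_univ_two, ih, h10]
    | zero => simp
    | add x y hx hy => simp [hx, hy]
    | smul c x hx => simp [hx]
  rw [h2, h2, map_mul, h1, Matrix.mul_apply]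
  simp [Fin.sum_univ_two, h00 y]

theorem skew_x_mul_of_eq_zero (s t : ι → k) (δ : ι → Sym k deg) (h) {j : ι} (hj : δ j = 0)
    (y : Sym k deg) : Sym.skew deg s t δ h (Sym.x deg j * y) =
      s j • (Sym.x deg j * Sym.skew deg s t δ h y) := by
  obtain ⟨M, h1, h2⟩ := exists_skew_hom deg s t δ h
  rw [h2, h2, map_mul, h1, Matrix.mul_apply]
  simp [Fin.sum_univ_two, hj]

section Der

variable [DecidableEq ι] (l : ι)

@[simp] theorem leftDer_one : Sym.leftDer (k := k) deg l 1 = 0 := skew_one deg _ _ _ _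

@[simp] theorem rightDer_one : Sym.rightDer (k := k) deg l 1 = 0 := skew_one deg _ _ _ _

theorem leftDer_x_mul (j : ι) (y : Sym k deg) : Sym.leftDer deg l (Sym.x deg j * y) =
    (if j = l then y else 0) + sg k (deg l * deg j) • (Sym.x deg j * Sym.leftDer deg l y) := by
  refine (skew_x_mul deg _ _ _ j y).trans ?_
  rw [add_comm]
  congr 1
  split_ifs <;> simp

theorem rightDer_mul_x (j : ι) (y : Sym k deg) : Sym.rightDer deg l (y * Sym.x deg j) =
    (if j = l then y else 0) + sg k (deg l * deg j) • (Sym.rightDer deg l y * Sym.x deg j) := by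
  refine (skew_mul_x deg _ _ _ j y).trans ?_
  congr 1
  split_ifs <;> simp

theorem rightDer_x_mul {j : ι} (hj : j ≠ l) (y : Sym k deg) :
    Sym.rightDer deg l (Sym.x deg j * y) = Sym.x deg j * Sym.rightDer deg l y :=
  (skew_x_mul_of_eq_zero deg _ _ _ _ (by simp [hj]) y).trans (one_smul _ _)

end Der

section Derivation

variable [Fintype ι] (c : ι → ι → k)

@[simp] theorem der_one : Sym.der deg c 1 = 0 := skew_one deg _ _ _ _

theorem der_x_mul_eq (j : ι) (y : Sym k deg) : Sym.der deg c (Sym.x deg j * y) =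
    sg k (deg j) • (Sym.x deg j * Sym.der deg c y) +
      (∑ i, if deg i = deg j + 1 then c i j • Sym.x deg i else 0) * y := skew_x_mul deg _ _ _ j y

theorem der_x (j : ι) : Sym.der deg c (Sym.x deg j) =
    ∑ i, if deg i = deg j + 1 then c i j • Sym.x deg i else 0 := by
  simpa using der_x_mul_eq deg c j 1

theorem der_x_mul (j : ι) (y : Sym k deg) : Sym.der deg c (Sym.x deg j * y) =
    Sym.der deg c (Sym.x deg j) * y + sg k (deg j) • (Sym.x deg j * Sym.der deg c y) := by
  rw [der_x_mul_eq, der_x, add_comm]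

theorem der_mon_mul (l : List ι) (y : Sym k deg) : Sym.der deg c (mon k deg l * y) =
    Sym.der deg c (mon k deg l) * y + sg k (ldeg deg l) • (mon k deg l * Sym.der deg c y) := by
  induction l with
  | nil => simp
  | cons j l ih =>
    rw [mon_cons, mul_assoc, der_x_mul, ih, der_x_mul, ldeg_cons, sg_add]
    simp only [add_mul, mul_add, mul_assoc, smul_mul_assoc, mul_smul_comm, smul_add, smul_smul,
      add_assoc]

end Derivation

variable (k) in
/-- The augmentation of the graded symmetric algebra. -/
def aug : Sym k deg →ₐ[k] k :=
  RingQuot.liftAlgHom k (s := SymRel k deg) ⟨FreeAlgebra.lift k fun _ => 0, by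
    rintro _ _ ⟨i, j⟩
    simp⟩

@[simp] theorem aug_x (j : ι) : aug k deg (Sym.x deg j) = 0 := by
  rw [aug, Sym.x]
  erw [RingQuot.liftAlgHom_mkAlgHom_apply]
  exact FreeAlgebra.lift_ι_apply _ _

theorem aug_mon_cons (j : ι) (l : List ι) : aug k deg (mon k deg (j :: l)) = 0 := by
  simp

/-! ### Graded symmetric functions on lists -/

/-- Graded symmetric functions on lists. -/
def ListSymm {M : Type*} [AddCommGroup M] [Module k M] (w : List ι → M) : Prop :=
  ∀ p j l q, w (p ++ j :: l :: q) = sg k (deg j * deg l) • w (p ++ l :: j :: q)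

variable {deg} {M : Type*} [AddCommGroup M] [Module k M] {w : List ι → M}

theorem ListSymm.cons (hw : ListSymm (k := k) deg w) (i : ι) :
    ListSymm (k := k) deg fun l => w (i :: l) := fun p => hw (i :: p)

theorem ListSymm.append (hw : ListSymm (k := k) deg w) (r : List ι) :
    ListSymm (k := k) deg fun l => w (r ++ l) := fun p j l q => by
  simpa using hw (r ++ p) j l q

theorem listSymm_mon : ListSymm (k := k) deg (mon k deg) := fun p j l q => by
  simp only [mon_append, mon_cons, ← mul_assoc]
  rw [mul_assoc (mon k deg p), x_mul_x]
  simp [mul_assoc]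

theorem ListSymm.reverse (hw : ListSymm (k := k) deg w) :
    ListSymm (k := k) deg fun l => w l.reverse := fun p j l q => by
  have := hw q.reverse l j p.reverse
  simp only [List.reverse_append, List.reverse_cons, List.append_assoc, List.singleton_append]
  simpa [mul_comm] using this

theorem ListSymm.move (hw : ListSymm (k := k) deg w) (j : ι) (l r : List ι) :
    w (j :: (l ++ r)) = sg k (deg j * ldeg deg l) • w (l ++ j :: r) := by
  induction l generalizing w with
  | nil => simp
  | cons i l ih =>
    have := hw [] j i (l ++ r)
    simp only [List.nil_append, List.cons_append] at this ⊢
    rw [this, ih (hw.cons i), smul_smul, ← sg_add, ldeg_cons, mul_add]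

/-- Moving a block past another one multiplies by the sign of the product of their degrees; the tail
`r` makes the induction go through. -/
theorem ListSymm.swap (hw : ListSymm (k := k) deg w) (l l' r : List ι) :
    w (l ++ (l' ++ r)) = sg k (ldeg deg l * ldeg deg l') • w (l' ++ (l ++ r)) := by
  induction l generalizing w with
  | nil => simp
  | cons i l ih =>
    rw [List.cons_append, ih (hw.cons i), hw.move, smul_smul, ← sg_add, ldeg_cons, List.cons_append]
    congr 2
    ring

theorem kz_swap {n : ℕ} (i : Fin n) (e : Fin (n + 1) → ℤ) :
    kz k (Equiv.swap i.castSucc i.succ) e = sg k (e i.castSucc * e i.succ) := by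
  have key : ∀ a b : Fin (n + 1), (a < b ∧ Equiv.swap i.castSucc i.succ b <
      Equiv.swap i.castSucc i.succ a) ↔ (a = i.castSucc ∧ b = i.succ) := by
    intro a b
    simp only [Equiv.swap_apply_def]
    constructor
    · rintro ⟨h1, h2⟩
      split_ifs at h2 <;> simp only [Fin.lt_def, Fin.ext_iff, Fin.val_castSucc, Fin.val_succ] at * <;> omega
    · rintro ⟨rfl, rfl⟩
      have : i.succ ≠ i.castSucc := (Fin.castSucc_lt_succ).ne'
      simp [this]
  simp only [kz, key]
  rw [Finset.prod_eq_single i.castSucc, Finset.prod_eq_single i.succ] <;> simp +contextual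

theorem ListSymm.comp_swap (hw : ListSymm (k := k) deg w) {n : ℕ} (i : Fin n) (J : Fin (n + 1) → ι) :
    w (List.ofFn (J ∘ Equiv.swap i.castSucc i.succ)) =
      sg k (deg (J i.castSucc) * deg (J i.succ)) • w (List.ofFn J) := by
  induction n generalizing w with
  | zero => exact i.elim0
  | succ n ih =>
    rw [List.ofFn_succ, List.ofFn_succ (f := J)]
    refine Fin.cases ?_ (fun i => ?_) i
    · have e : (fun i : Fin (n + 1) => (J ∘ Equiv.swap (Fin.castSucc (0 : Fin (n + 1))) (Fin.succ 0))
          i.succ) = Fin.cons (J 0) fun i => J i.succ.succ := by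
        funext r
        refine Fin.cases ?_ (fun r => ?_) r
        · exact congrArg J (Equiv.swap_apply_right _ _)
        · rw [Fin.cons_succ, Function.comp_apply, Equiv.swap_apply_of_ne_of_ne]
          · simp [Fin.ext_iff]
          · simp [Fin.ext_iff]
      have e' : (J ∘ Equiv.swap (Fin.castSucc (0 : Fin (n + 1))) (Fin.succ 0)) 0 = J 1 :=
        congrArg J (Equiv.swap_apply_left _ _)
      rw [e, e', List.ofFn_cons, List.ofFn_succ (f := fun i => J i.succ)]
      refine (hw [] (J 1) (J 0) (List.ofFn fun i => J i.succ.succ)).trans ?_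
      rw [mul_comm]
      rfl
    · have h := ih (hw.cons (J 0)) i (fun r => J r.succ)
      rw [← Fin.succ_castSucc] at *
      convert h using 4
      · simp only [Function.comp_apply]
        rw [Equiv.swap_apply_of_ne_of_ne]
        · exact (Fin.succ_ne_zero _).symm
        · exact (Fin.succ_ne_zero _).symm
      · funext r
        simp only [Function.comp_apply]
        rw [(Fin.succ_injective _).swap_apply]

/-- Symmetry is assumed for adjacent letters only. Adjacent transpositions generate the symmetric
group, and `kz_trans` multiplies their signs. -/
theorem ListSymm.comp_perm (hw : ListSymm (k := k) deg w) {m : ℕ} (ρ : Equiv.Perm (Fin m))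
    (J : Fin m → ι) : w (List.ofFn (J ∘ ρ.symm)) = kz k ρ (deg ∘ J) • w (List.ofFn J) := by
  cases m with
  | zero =>
    rw [show ρ = Equiv.refl _ from Subsingleton.elim _ _]
    simp
  | succ n =>
    have hρ : ρ ∈ Submonoid.closure (Set.range fun i : Fin n => Equiv.swap i.castSucc i.succ) := by
      rw [Equiv.Perm.mclosure_swap_castSucc_succ]; trivial
    induction hρ using Submonoid.closure_induction generalizing J with
    | mem ρ h =>
      obtain ⟨i, rfl⟩ := h
      rw [kz_swap]
      exact hw.comp_swap i J
    | one =>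
      have : kz k (1 : Equiv.Perm (Fin (n + 1))) (deg ∘ J) = 1 := kz_refl _
      rw [this, one_smul]
      rfl
    | mul ρ σ _ _ hρ hσ =>
      have h : ρ * σ = σ.trans ρ := rfl
      rw [h, kz_trans, mul_comm, mul_smul, ← hσ]
      exact hρ (J ∘ σ.symm)

end SymAlgebra

/-! ### Sums over lists of fixed length -/

section ListSum

variable {ι : Type w} [Fintype ι] {M : Type*} [AddCommMonoid M]

/-- The sum over all lists of length `n`. -/
def listSum (n : ℕ) (F : List ι → M) : M := ∑ J : Fin n → ι, F (List.ofFn J)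

@[simp] theorem listSum_zero (F : List ι → M) : listSum 0 F = F [] := by
  simp [listSum]

theorem listSum_succ (n : ℕ) (F : List ι → M) :
    listSum (n + 1) F = ∑ i, listSum n fun l => F (i :: l) := by
  simp only [listSum]
  rw [← Fintype.sum_prod_type']
  refine (Fintype.sum_equiv (Fin.consEquiv fun _ => ι) _ _ fun p => ?_).symm
  simp [Fin.consEquiv]

theorem listSum_congr {n : ℕ} {F F' : List ι → M} (h : ∀ l, l.length = n → F l = F' l) :
    listSum n F = listSum n F' :=
  Finset.sum_congr rfl fun J _ => h _ (by simp)

theorem listSum_add (a b : ℕ) (F : List ι → M) :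
    listSum (a + b) F = listSum a fun p => listSum b fun q => F (p ++ q) := by
  induction a generalizing F with
  | zero => simp
  | succ a ih =>
    rw [Nat.add_right_comm, listSum_succ, listSum_succ]
    exact Finset.sum_congr rfl fun i _ => ih _

theorem listSum_snoc (n : ℕ) (F : List ι → M) :
    listSum (n + 1) F = listSum n fun l => ∑ i, F (l ++ [i]) := by
  rw [listSum_add]
  simp [listSum_succ]

theorem listSum_sum {α : Type*} (s : Finset α) (n : ℕ) (F : α → List ι → M) :
    ∑ a ∈ s, listSum n (F a) = listSum n fun l => ∑ a ∈ s, F a l := Finset.sum_comm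

theorem listSum_comm (m n : ℕ) (F : List ι → List ι → M) :
    (listSum m fun p => listSum n fun q => F p q) = listSum n fun q => listSum m fun p => F p q :=
  Finset.sum_comm

theorem listSum_reverse (n : ℕ) (F : List ι → M) :
    (listSum n fun l => F l.reverse) = listSum n F := by
  induction n generalizing F with
  | zero => simp
  | succ n ih =>
    rw [listSum_succ, listSum_snoc, ← listSum_sum]
    refine Finset.sum_congr rfl fun i _ => ?_
    simp only [List.reverse_cons]
    exact ih fun l => F (l ++ [i])

theorem listSum_add_distrib (n : ℕ) (F F' : List ι → M) :
    (listSum n fun l => F l + F' l) = listSum n F + listSum n F' := Finset.sum_add_distrib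

@[simp] theorem listSum_const_zero (n : ℕ) : (listSum n fun _ : List ι => (0 : M)) = 0 := by
  simp [listSum]

theorem map_listSum {N : Type*} [AddCommMonoid N] {E : Type*} [FunLike E M N]
    [AddMonoidHomClass E M N] (g : E) (n : ℕ) (F : List ι → M) :
    g (listSum n F) = listSum n fun l => g (F l) := map_sum g _ _

theorem smul_listSum {R : Type*} [Monoid R] [DistribMulAction R M] (c : R) (n : ℕ)
    (F : List ι → M) : c • listSum n F = listSum n fun l => c • F l := Finset.smul_sum

theorem mul_listSum {A : Type*} [NonUnitalNonAssocSemiring A] (c : A) (n : ℕ)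
    (F : List ι → A) : c * listSum n F = listSum n fun l => c * F l := Finset.mul_sum _ _ _

theorem listSum_mul {A : Type*} [NonUnitalNonAssocSemiring A] (c : A) (n : ℕ)
    (F : List ι → A) : listSum n F * c = listSum n fun l => F l * c := Finset.sum_mul _ _ _

end ListSum

/-! ### Symbols -/

section Symbols

variable {k : Type u} [Field k] {ι : Type w} [Fintype ι] [DecidableEq ι] (deg : ι → ℤ)

@[simp] theorem phaseDeg_inl (i : ι) : phaseDeg deg (Sum.inl i) = deg i := rfl

@[simp] theorem phaseDeg_inr (i : ι) : phaseDeg deg (Sum.inr i) = -deg i := rfl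

variable (k) in
/-- The monomial `a_J` of the phase space. -/
def aMon (J : List ι) : Phase k deg := mon k (phaseDeg deg) (J.map Sum.inl)

variable (k) in
/-- The monomial `φ^I` of the phase space. -/
def fMon (I : List ι) : Phase k deg := mon k (phaseDeg deg) (I.map Sum.inr)

@[simp] theorem aMon_nil : aMon k deg [] = 1 := rfl

@[simp] theorem fMon_nil : fMon k deg [] = 1 := rfl

@[simp] theorem aMon_cons (i : ι) (J : List ι) :
    aMon k deg (i :: J) = Sym.x (phaseDeg deg) (Sum.inl i) * aMon k deg J := mon_cons _ _ _

@[simp] theorem fMon_cons (i : ι) (J : List ι) :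
    fMon k deg (i :: J) = Sym.x (phaseDeg deg) (Sum.inr i) * fMon k deg J := mon_cons _ _ _

@[simp] theorem aMon_append (J J' : List ι) :
    aMon k deg (J ++ J') = aMon k deg J * aMon k deg J' := by
  simp [aMon]

@[simp] theorem fMon_append (J J' : List ι) :
    fMon k deg (J ++ J') = fMon k deg J * fMon k deg J' := by
  simp [fMon]

@[simp] theorem ldeg_map_inl (J : List ι) : ldeg (phaseDeg deg) (J.map Sum.inl) = ldeg deg J := by
  simp [ldeg, Function.comp_def]

@[simp] theorem ldeg_map_inr (J : List ι) : ldeg (phaseDeg deg) (J.map Sum.inr) = -ldeg deg J := by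
  induction J with
  | nil => simp
  | cons i J ih =>
    rw [List.map_cons, ldeg_cons, ih, ldeg_cons, phaseDeg_inr]
    ring

theorem listSymm_aMon : ListSymm (k := k) deg (aMon k deg) := fun p j l q => by
  simpa [aMon] using
    listSymm_mon (k := k) (deg := phaseDeg deg) (p.map Sum.inl) (Sum.inl j) (Sum.inl l) (q.map Sum.inl)

theorem listSymm_fMon : ListSymm (k := k) deg (fMon k deg) := fun p j l q => by
  simpa [fMon] using
    listSymm_mon (k := k) (deg := phaseDeg deg) (p.map Sum.inr) (Sum.inr j) (Sum.inr l) (q.map Sum.inr)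

theorem leftDer_fMon (i : ι) (I : List ι) :
    Sym.leftDer (phaseDeg deg) (Sum.inl i) (fMon k deg I) = 0 := by
  induction I with
  | nil => simp
  | cons j I ih => rw [fMon_cons, leftDer_x_mul, ih]; simp

theorem rightDer_aMon_mul (i : ι) (J : List ι) (y : Phase k deg) :
    Sym.rightDer (phaseDeg deg) (Sum.inr i) (aMon k deg J * y) =
      aMon k deg J * Sym.rightDer (phaseDeg deg) (Sum.inr i) y := by
  induction J with
  | nil => simp
  | cons j J ih => rw [aMon_cons, mul_assoc, rightDer_x_mul (phaseDeg deg) _ (by simp), ih, mul_assoc]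

/-- By graded symmetry each of the `m + 1` letters contributes the same amount to the derivative as
the first one, whence the factor. -/
theorem leftDer_listSum (i : ι) (m : ℕ) {W : List ι → Phase k deg} (hW : ListSymm (k := k) deg W)
    (h0 : ∀ J, Sym.leftDer (phaseDeg deg) (Sum.inl i) (W J) = 0) :
    Sym.leftDer (phaseDeg deg) (Sum.inl i) (listSum (m + 1) fun J => aMon k deg J * W J) =
      ((m + 1 : ℕ) : k) • listSum m fun J => aMon k deg J * W (i :: J) := by
  induction m generalizing W with
  | zero => simp [listSum_succ, leftDer_x_mul, h0]
  | succ m ih =>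
    rw [listSum_succ, map_sum]
    have h : ∀ j, Sym.leftDer (phaseDeg deg) (Sum.inl i)
        (listSum (m + 1) fun l => aMon k deg (j :: l) * W (j :: l)) =
        (if j = i then listSum (m + 1) fun l => aMon k deg l * W (i :: l) else 0) +
        ((m + 1 : ℕ) : k) • listSum m fun l => aMon k deg (j :: l) * W (i :: j :: l) := by
      intro j
      simp only [aMon_cons, mul_assoc]
      rw [← mul_listSum, leftDer_x_mul, ih (hW.cons j) fun J => h0 _]
      congr 1
      · by_cases hj : j = i
        · simp [hj]
        · simp [hj]
      · rw [mul_smul_comm, smul_comm, mul_listSum, smul_listSum]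
        congr 2
        funext l
        -- The sign from moving the derivative past `a_j` cancels the one from exchanging `i` and
        -- `j` in `W`.
        have := hW [] j i l
        simp only [List.nil_append] at this
        rw [this, mul_smul_comm, mul_smul_comm, smul_smul, mul_comm (deg j)]
        rw [phaseDeg_inl, phaseDeg_inl, sg_mul_self, one_smul]
    rw [Finset.sum_congr rfl fun j _ => h j, Finset.sum_add_distrib, ← Finset.smul_sum,
      ← listSum_succ (F := fun l => aMon k deg l * W (i :: l))]
    simp only [Finset.sum_ite_eq', Finset.mem_univ, if_true]
    push_cast
    module

/-- The reversal puts the first index of `K` at the right end of the monomial, where the right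
derivative begins; apart from that the count is the one for left derivatives. -/
theorem rightDer_listSum (i : ι) (n : ℕ) {W : List ι → Phase k deg} (hW : ListSymm (k := k) deg W)
    (h0 : ∀ J, Sym.rightDer (phaseDeg deg) (Sum.inr i) (W J) = 0) :
    Sym.rightDer (phaseDeg deg) (Sum.inr i) (listSum (n + 1) fun K => W K * fMon k deg K.reverse) =
      ((n + 1 : ℕ) : k) • listSum n fun K => W (i :: K) * fMon k deg K.reverse := by
  induction n generalizing W with
  | zero => simp [listSum_succ, rightDer_mul_x, h0]
  | succ m ih =>
    rw [listSum_succ, map_sum]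
    have h : ∀ j, Sym.rightDer (phaseDeg deg) (Sum.inr i)
        (listSum (m + 1) fun l => W (j :: l) * fMon k deg (j :: l).reverse) =
        (if j = i then listSum (m + 1) fun l => W (i :: l) * fMon k deg l.reverse else 0) +
        ((m + 1 : ℕ) : k) • listSum m fun l => W (i :: j :: l) * fMon k deg (j :: l).reverse := by
      intro j
      simp only [List.reverse_cons, fMon_append, fMon_cons, fMon_nil, mul_one, ← mul_assoc]
      rw [← listSum_mul, rightDer_mul_x, ih (hW.cons j) fun J => h0 _]
      congr 1
      · by_cases hj : j = i
        · simp [hj]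
        · simp [hj]
      · rw [smul_mul_assoc, smul_comm, listSum_mul, smul_listSum]
        congr 2
        funext l
        have := hW [] j i l
        simp only [List.nil_append] at this
        rw [this, smul_mul_assoc, smul_mul_assoc, smul_smul, mul_comm (deg j)]
        rw [phaseDeg_inr, phaseDeg_inr, neg_mul_neg, sg_mul_self, one_smul]
    rw [Finset.sum_congr rfl fun j _ => h j, Finset.sum_add_distrib, ← Finset.smul_sum,
      ← listSum_succ (F := fun l => W (i :: l) * fMon k deg l.reverse)]
    simp only [Finset.sum_ite_eq', Finset.mem_univ, if_true]
    push_cast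
    module

/-- The element `∑ (1 / (m! n!)) c(J, K) a_J φ^{K reversed}`. -/
def symbol (m n : ℕ) (c : List ι → List ι → k) : Phase k deg :=
  ((m.factorial * n.factorial : ℕ) : k)⁻¹ •
    listSum m fun J => listSum n fun K => c J K • (aMon k deg J * fMon k deg K.reverse)

/-- Graded symmetric coefficient systems. -/
structure CoeffSymm (c : List ι → List ι → k) : Prop where
  left : ∀ K, ListSymm (k := k) deg fun J => c J K
  right : ∀ J, ListSymm (k := k) deg fun K => c J K

variable {deg} {c : List ι → List ι → k}

theorem CoeffSymm.append_left (hc : CoeffSymm deg c) (r : List ι) :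
    CoeffSymm deg fun J K => c (r ++ J) K :=
  ⟨fun K => (hc.left K).append r, fun _ => hc.right _⟩

theorem CoeffSymm.append_right (hc : CoeffSymm deg c) (r : List ι) :
    CoeffSymm deg fun J K => c J (r ++ K) :=
  ⟨fun _ => hc.left _, fun J => (hc.right J).append r⟩

theorem leftDer_symbol_zero (i : ι) (n : ℕ) (c : List ι → List ι → k) :
    Sym.leftDer (phaseDeg deg) (Sum.inl i) (symbol deg 0 n c) = 0 := by
  simp [symbol, map_listSum, leftDer_fMon]

theorem rightDer_symbol_zero (i : ι) (m : ℕ) (c : List ι → List ι → k) :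
    Sym.rightDer (phaseDeg deg) (Sum.inr i) (symbol deg m 0 c) = 0 := by
  have h := fun J : List ι => rightDer_aMon_mul (k := k) deg i J 1
  simp only [mul_one, rightDer_one, mul_zero] at h
  simp [symbol, map_listSum, h]

variable [CharZero k]

/-- The factor `m + 1` from the equal contributions turns `1/(m + 1)!` into `1/m!`, so
differentiation only fixes the first argument of the coefficient system. -/
theorem leftDer_symbol (hc : CoeffSymm deg c) (i : ι) (m n : ℕ) :
    Sym.leftDer (phaseDeg deg) (Sum.inl i) (symbol deg (m + 1) n c) =
      symbol deg m n fun J K => c (i :: J) K := by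
  have h := leftDer_listSum deg i m (W := fun J => listSum n fun K => c J K • fMon k deg K.reverse)
    (fun p j l q => by
      rw [smul_listSum]
      refine listSum_congr fun K _ => ?_
      rw [show c (p ++ j :: l :: q) K = _ from hc.left K p j l q, smul_smul, smul_eq_mul])
    (fun J => by simp [map_listSum, leftDer_fMon])
  simp only [mul_listSum, mul_smul_comm] at h
  rw [symbol, map_smul, h, smul_smul, symbol]
  congr 1
  have := Nat.cast_ne_zero (R := k).2 (Nat.factorial_ne_zero m)
  have := Nat.cast_ne_zero (R := k).2 (Nat.factorial_ne_zero n)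
  have : ((m + 1 : ℕ) : k) ≠ 0 := Nat.cast_ne_zero.2 (Nat.succ_ne_zero m)
  rw [Nat.factorial_succ]
  push_cast at *
  field_simp

theorem rightDer_symbol (hc : CoeffSymm deg c) (i : ι) (m n : ℕ) :
    Sym.rightDer (phaseDeg deg) (Sum.inr i) (symbol deg m (n + 1) c) =
      symbol deg m n fun J K => c J (i :: K) := by
  have h := rightDer_listSum deg i n (W := fun K => listSum m fun J => c J K • aMon k deg J)
    (fun p j l q => by
      rw [smul_listSum]
      refine listSum_congr fun J _ => ?_
      rw [show c J (p ++ j :: l :: q) = _ from hc.right J p j l q, smul_smul, smul_eq_mul])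
    (fun K => by
      have h := fun J : List ι => rightDer_aMon_mul (k := k) deg i J 1
      simp only [mul_one, rightDer_one, mul_zero] at h
      simp [map_listSum, h])
  simp only [listSum_mul, smul_mul_assoc] at h
  rw [symbol, listSum_comm, map_smul, h, smul_smul, symbol, listSum_comm]
  congr 1
  have := Nat.cast_ne_zero (R := k).2 (Nat.factorial_ne_zero m)
  have := Nat.cast_ne_zero (R := k).2 (Nat.factorial_ne_zero n)
  have : ((n + 1 : ℕ) : k) ≠ 0 := Nat.cast_ne_zero.2 (Nat.succ_ne_zero n)
  rw [Nat.factorial_succ]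
  push_cast at *
  field_simp

theorem aug_symbol (m n : ℕ) (c : List ι → List ι → k) :
    aug k (phaseDeg deg) (symbol deg m n c) = if m = 0 ∧ n = 0 then c [] [] else 0 := by
  rcases m with _ | m
  · rcases n with _ | n
    · simp [symbol]
    · simp [symbol, map_listSum, listSum_succ]
  · simp [symbol, map_listSum, listSum_succ]

/-- Each contraction fixes the first remaining index on both sides to a common value, so `l`
contractions amount to a sum over common words of length `l`. -/
theorem contract_symbol {c' : List ι → List ι → k} (hc : CoeffSymm deg c) (hc' : CoeffSymm deg c')
    (l m₁ n₁ m₂ n₂ : ℕ) :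
    contract deg l (symbol deg m₁ (n₁ + l) c) (symbol deg (l + m₂) n₂ c') =
      listSum l fun K₀ => symbol deg m₁ n₁ (fun J K => c J (K₀ ++ K)) *
        symbol deg m₂ n₂ fun J K => c' (K₀ ++ J) K := by
  induction l generalizing c c' with
  | zero => simp [contract]
  | succ l ih =>
    rw [contract, listSum_succ]
    refine Finset.sum_congr rfl fun i _ => ?_
    rw [Nat.add_right_comm l 1 m₂, ← Nat.add_assoc, rightDer_symbol hc, leftDer_symbol hc']
    exact ih (hc.append_right [i]) (hc'.append_left [i])

/-- The composite of the operators `D i`, for `i` in a list, the first one being applied first. -/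
def iter {A : Type*} [AddCommGroup A] [Module k A] (D : ι → A →ₗ[k] A) : List ι → A →ₗ[k] A
  | [] => LinearMap.id
  | i :: l => iter D l ∘ₗ D i

variable (deg) in
/-- The coefficient of `a_J φ^{I}`, up to a factor, for `I` the reversed list `K`. -/
def coeffAt (J K : List ι) : Phase k deg →ₗ[k] k :=
  (aug k (phaseDeg deg)).toLinearMap ∘ₗ
    iter (fun i => Sym.rightDer (phaseDeg deg) (Sum.inr i)) K ∘ₗ
      iter (fun i => Sym.leftDer (phaseDeg deg) (Sum.inl i)) J

/-- Too many derivatives annihilate the symbol, and too few leave monomials of positive length,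
which the augmentation kills. Exactly one coefficient is left, and independence of the monomials is
never needed. -/
theorem coeffAt_symbol (hc : CoeffSymm deg c) (m n : ℕ) (J K : List ι) :
    coeffAt deg J K (symbol deg m n c) = if m = J.length ∧ n = K.length then c J K else 0 := by
  induction J generalizing m c with
  | nil =>
    induction K generalizing n c with
    | nil => exact (aug_symbol m n c).trans (by simp)
    | cons i K ih =>
      change coeffAt deg [] K (Sym.rightDer (phaseDeg deg) (Sum.inr i) (symbol deg m n c)) = _
      rcases n with _ | n
      · rw [rightDer_symbol_zero, map_zero]
        simp
      · rw [rightDer_symbol hc]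
        refine (ih n (hc.append_right [i])).trans ?_
        simp
  | cons i J ih =>
    change coeffAt deg J K (Sym.leftDer (phaseDeg deg) (Sum.inl i) (symbol deg m n c)) = _
    rcases m with _ | m
    · rw [leftDer_symbol_zero, map_zero]
      simp
    · rw [leftDer_symbol hc]
      refine (ih (hc.append_left [i]) m).trans ?_
      simp

end Symbols

/-! ### Operations in coordinates and their symbols -/

section Coordinates

variable {k : Type u} [Field k]

theorem kz_mul_self {m m' : ℕ} (ρ : Fin m ≃ Fin m') (e : Fin m → ℤ) :
    kz k ρ e * kz k ρ e = 1 := by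
  simp only [kz, ← Finset.prod_mul_distrib]
  refine Finset.prod_eq_one fun i _ => Finset.prod_eq_one fun j _ => ?_
  split_ifs
  · exact sg_mul_self _
  · exact one_mul 1

theorem kz_symm {m m' : ℕ} (ρ : Fin m ≃ Fin m') (e : Fin m → ℤ) :
    kz k ρ.symm (e ∘ ρ.symm) = kz k ρ e := by
  have h := kz_mul_symm (k := k) ρ e
  rw [← one_mul (kz k ρ.symm _), ← kz_mul_self ρ e, mul_assoc, h, mul_one]

/-- The converse passage from permutations of a fixed number of indices to adjacent letters of
words, for functions that vanish at words of other lengths. -/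
theorem listSymm_of_perm {ι : Type w} {deg : ι → ℤ} {M : Type*} [AddCommGroup M] [Module k M]
    {w : List ι → M} {m : ℕ} (h0 : ∀ l, l.length ≠ m → w l = 0)
    (h : ∀ (ρ : Equiv.Perm (Fin m)) (J : Fin m → ι),
      w (List.ofFn (J ∘ ρ.symm)) = kz k ρ (deg ∘ J) • w (List.ofFn J)) :
    ListSymm (k := k) deg w := by
  intro p j l q
  by_cases hm : (p ++ l :: j :: q).length = m
  · obtain ⟨n, rfl⟩ : ∃ n, m = n + 1 := ⟨p.length + q.length + 1, by rw [← hm]; simp; omega⟩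
    have hp : p.length < n := by simp at hm; omega
    have := h (Equiv.swap (Fin.castSucc ⟨p.length, hp⟩) (Fin.succ ⟨p.length, hp⟩))
      (fun r => (p ++ l :: j :: q)[r.1]'(by omega))
    rw [kz_swap] at this
    convert this using 2
    · refine List.ext_getElem (by simp at hm ⊢; omega) fun a h1 h2 => ?_
      simp only [List.getElem_ofFn, Function.comp_apply, Equiv.symm_swap, Equiv.swap_apply_def]
      split_ifs with h3 h4
      · simp only [Fin.ext_iff, Fin.val_castSucc] at h3
        subst h3
        simp
      · simp only [Fin.ext_iff, Fin.val_succ] at h4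
        subst h4
        simp
      · simp only [Fin.ext_iff, Fin.val_succ, Fin.val_castSucc] at h3 h4
        rw [List.getElem_append, List.getElem_append]
        split_ifs with h5
        · rfl
        -- Behind the two exchanged letters the words coincide.
        · obtain ⟨c, hc⟩ : ∃ c, a - p.length = c + 2 := ⟨a - p.length - 2, by omega⟩
          simp [hc]
    · simp [List.getElem_append, mul_comm]
    · congr 1
      refine List.ext_getElem (hm.trans List.length_ofFn.symm) fun a h1 h2 => ?_
      simp only [List.getElem_ofFn]
  · rw [h0 _ hm, h0 _ (by simpa using hm), smul_zero]

variable [CharZero k] {V : Type v} [AddCommGroup V] [Module k V]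
  {𝒱 : ℤ → Submodule k V} [DirectSum.Decomposition 𝒱]
  {ι : Type w} [Fintype ι] [DecidableEq ι] (b : Module.Basis ι k V) (deg : ι → ℤ)

/-- The basis tensor of a list of indices (zero if the length is wrong). -/
def basisT (n : ℕ) (l : List ι) : ⨂[k]^n V :=
  if h : l.length = n then PiTensorProduct.tprod k fun r => b (l.get (r.cast h.symm)) else 0

/-- The coordinate functional of a list of indices (zero if the length is wrong). -/
def coordT (n : ℕ) (l : List ι) : (⨂[k]^n V) →ₗ[k] k :=
  if h : l.length = n then
    (Basis.piTensorProduct fun _ : Fin n => b).coord fun r => l.get (r.cast h.symm) else 0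

theorem basisT_ofFn {n : ℕ} (J : Fin n → ι) :
    basisT b n (List.ofFn J) = PiTensorProduct.tprod k (b ∘ J) := by
  rw [basisT, dif_pos (by simp)]
  congr 1
  funext r
  simp

theorem basisT_of_ne {n : ℕ} {l : List ι} (h : l.length ≠ n) : basisT b n l = 0 := dif_neg h

theorem coordT_of_ne {n : ℕ} {l : List ι} (h : l.length ≠ n) : coordT b n l = 0 := dif_neg h

theorem coordT_ofFn {n : ℕ} (J : Fin n → ι) (x : ⨂[k]^n V) :
    coordT b n (List.ofFn J) x = (Basis.piTensorProduct fun _ : Fin n => b).repr x J := by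
  rw [coordT, dif_pos (by simp), Module.Basis.coord_apply]
  congr 1
  funext r
  simp

theorem coordT_tprod {n : ℕ} (J : Fin n → ι) (v : Fin n → V) :
    coordT b n (List.ofFn J) (PiTensorProduct.tprod k v) = ∏ r, b.repr (v r) (J r) := by
  rw [coordT_ofFn, Basis.piTensorProduct_repr_tprod_apply]

theorem exists_ofFn {n : ℕ} {l : List ι} (h : l.length = n) : ∃ J : Fin n → ι, l = List.ofFn J := by
  subst h
  exact ⟨l.get, (List.ofFn_get l).symm⟩

theorem basisT_append {m n : ℕ} {p : List ι} (hp : p.length = m) (q : List ι) :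
    basisT b (m + n) (p ++ q) = basisT b m p ⊙ basisT b n q := by
  by_cases hq : q.length = n
  · obtain ⟨J, rfl⟩ := exists_ofFn hp
    obtain ⟨K, rfl⟩ := exists_ofFn hq
    rw [← List.ofFn_fin_append, basisT_ofFn, basisT_ofFn, basisT_ofFn, tprod_mulT_tprod]
    congr 1
    funext r
    refine Fin.addCases (fun r => ?_) (fun r => ?_) r <;> simp
  · rw [basisT_of_ne b hq, basisT_of_ne b (by simp [hp, hq]), map_zero]

theorem listSum_coordT (n : ℕ) (x : ⨂[k]^n V) :
    (listSum n fun J => coordT b n J x • basisT b n J) = x := by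
  simp only [listSum, coordT_ofFn, basisT_ofFn]
  refine Eq.trans ?_ ((Basis.piTensorProduct fun _ : Fin n => b).sum_repr x)
  refine Finset.sum_congr rfl fun J _ => ?_
  rw [Basis.piTensorProduct_apply]
  rfl

theorem basisT_hom_ext {n : ℕ} {M : Type*} [AddCommGroup M] [Module k M]
    {F F' : (⨂[k]^n V) →ₗ[k] M} (h : ∀ J : Fin n → ι, F (PiTensorProduct.tprod k (b ∘ J)) =
      F' (PiTensorProduct.tprod k (b ∘ J))) : F = F' :=
  (Basis.piTensorProduct fun _ : Fin n => b).ext fun J => by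
    rw [Basis.piTensorProduct_apply]
    exact h J

theorem coordT_tprod_basis {n : ℕ} (J K : Fin n → ι) :
    coordT b n (List.ofFn J) (PiTensorProduct.tprod k (b ∘ K)) = if K = J then 1 else 0 := by
  rw [coordT_tprod]
  simp [Finsupp.single_apply, Fintype.prod_ite_zero, ← funext_iff]

/-- The image in the phase space of a tensor. -/
def toPhase (m : ℕ) : (⨂[k]^m V) →ₗ[k] Phase k deg :=
  listSum m fun J => (coordT b m J).smulRight (aMon k deg J)

theorem toPhase_apply (m : ℕ) (x : ⨂[k]^m V) :
    toPhase b deg m x = listSum m fun J => coordT b m J x • aMon k deg J := by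
  simp [toPhase, listSum]

theorem toPhase_tprod {m : ℕ} (J : Fin m → ι) :
    toPhase b deg m (PiTensorProduct.tprod k (b ∘ J)) = aMon k deg (List.ofFn J) := by
  rw [toPhase_apply, listSum]
  simp [coordT_tprod_basis]

theorem toPhase_mulT {m n : ℕ} (x : ⨂[k]^m V) (y : ⨂[k]^n V) :
    toPhase b deg (m + n) (x ⊙ y) = toPhase b deg m x * toPhase b deg n y := by
  have : (mulT (k := k) (V := V)).compr₂ (toPhase b deg (m + n)) =
      (LinearMap.mul k (Phase k deg)).compl₁₂ (toPhase b deg m) (toPhase b deg n) := by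
    refine basisT_hom_ext b fun J => basisT_hom_ext b fun K => ?_
    simp only [LinearMap.compr₂_apply, LinearMap.compl₁₂_apply, LinearMap.mul_apply']
    rw [toPhase_tprod, toPhase_tprod, tprod_mulT_tprod, ← aMon_append, ← List.ofFn_fin_append,
      ← toPhase_tprod b]
    congr 2
    funext r
    refine Fin.addCases (fun r => ?_) (fun r => ?_) r <;> simp
  exact LinearMap.congr_fun₂ this x y

section Homogeneous

variable {deg} (hb : ∀ i, b i ∈ 𝒱 (deg i))

include hb in
theorem deg_eq_of_repr_ne_zero {v : V} {e : ℤ} (hv : v ∈ 𝒱 e) {i : ι} (hi : b.repr v i ≠ 0) :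
    deg i = e := by
  by_contra h
  apply hi
  -- The `i`-th coordinate factors through the projection to degree `deg i`, since the basis is
  -- homogeneous.
  have key : ∀ v, b.repr (DirectSum.decomposeLinearEquiv 𝒱 v (deg i) : V) i = b.repr v i := by
    intro v
    have : b.coord i ∘ₗ (𝒱 (deg i)).subtype ∘ₗ DirectSum.component k ℤ (fun j => 𝒱 j) (deg i) ∘ₗ
        (DirectSum.decomposeLinearEquiv 𝒱).toLinearMap = b.coord i := by
      refine b.ext fun j => ?_
      simp only [LinearMap.comp_apply, LinearEquiv.coe_coe, Submodule.subtype_apply,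
        Module.Basis.coord_apply]
      change b.repr (DirectSum.decompose 𝒱 (b j) (deg i) : V) i = _
      by_cases hij : deg j = deg i
      · rw [DirectSum.decompose_of_mem_same 𝒱 (hij ▸ hb j)]
      · rw [DirectSum.decompose_of_mem_ne 𝒱 (hb j) hij]
        have : j ≠ i := fun h => hij (h ▸ rfl)
        simp [this]
    exact LinearMap.congr_fun this v
  have h2 : (DirectSum.decomposeLinearEquiv 𝒱 v (deg i) : V) = 0 :=
    DirectSum.decompose_of_mem_ne 𝒱 hv (Ne.symm h)
  rw [← key, h2]
  simp

include hb in
theorem ldeg_eq_of_coordT_ne_zero {n : ℕ} {x : ⨂[k]^n V} {r : ℤ} (hx : x ∈ tensorDegree 𝒱 n r)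
    {l : List ι} (hl : coordT b n l x ≠ 0) : ldeg deg l = r := by
  by_cases hn : l.length = n
  · obtain ⟨J, rfl⟩ := exists_ofFn hn
    by_contra h
    apply hl
    change coordT b n (List.ofFn J) x = (0 : (⨂[k]^n V) →ₗ[k] k) x
    refine eq_of_mem_degree hx fun e v hv hs => ?_
    rw [coordT_tprod, LinearMap.zero_apply]
    by_contra h0
    refine h ?_
    rw [ldeg_ofFn, ← hs]
    refine Finset.sum_congr rfl fun i _ => deg_eq_of_repr_ne_zero b hb (hv i) fun h1 => h0 ?_
    exact Finset.prod_eq_zero (Finset.mem_univ i) h1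
  · rw [coordT_of_ne b hn] at hl
    exact absurd rfl hl

include hb in
theorem basisT_mem (n : ℕ) (l : List ι) : basisT b n l ∈ tensorDegree 𝒱 n (ldeg deg l) := by
  by_cases hn : l.length = n
  · obtain ⟨J, rfl⟩ := exists_ofFn hn
    rw [basisT_ofFn, ldeg_ofFn]
    exact tprod_mem_degree 𝒱 fun i => hb _
  · rw [basisT_of_ne b hn]
    exact zero_mem _

include hb in
theorem permMap_basis {m m' : ℕ} (ρ : Fin m ≃ Fin m') (J : Fin m → ι) :
    permMap 𝒱 ρ (PiTensorProduct.tprod k (b ∘ J)) =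
      kz k ρ (deg ∘ J) • PiTensorProduct.tprod k (b ∘ (J ∘ ρ.symm)) :=
  permMap_tprod 𝒱 ρ fun i => hb (J i)

include hb in
-- The Koszul sign of permuting tensor factors and the one of reordering the monomial coincide, so
-- together they give a square.
theorem toPhase_permMap {m : ℕ} (ρ : Equiv.Perm (Fin m)) (x : ⨂[k]^m V) :
    toPhase b deg m (permMap 𝒱 ρ x) = toPhase b deg m x := by
  have : toPhase b deg m ∘ₗ permMap 𝒱 ρ = toPhase b deg m := by
    refine basisT_hom_ext b fun J => ?_
    rw [LinearMap.comp_apply, permMap_basis b hb, map_smul, toPhase_tprod, toPhase_tprod,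
      (listSymm_aMon deg).comp_perm, smul_smul, kz_mul_self, one_smul]
  exact LinearMap.congr_fun this x

include hb in
theorem coordT_permMap {m : ℕ} (ρ : Equiv.Perm (Fin m)) (J : Fin m → ι) (x : ⨂[k]^m V) :
    coordT b m (List.ofFn (J ∘ ρ.symm)) (permMap 𝒱 ρ x) =
      kz k ρ (deg ∘ J) * coordT b m (List.ofFn J) x := by
  have : coordT b m (List.ofFn (J ∘ ρ.symm)) ∘ₗ permMap 𝒱 ρ =
      kz k ρ (deg ∘ J) • coordT b m (List.ofFn J) := by
    refine basisT_hom_ext b fun K => ?_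
    rw [LinearMap.comp_apply, permMap_basis b hb, map_smul, LinearMap.smul_apply,
      coordT_tprod_basis, coordT_tprod_basis]
    by_cases h : K = J
    · subst h; simp
    · rw [if_neg h, if_neg fun h' => h ?_]
      · simp
      · funext i
        simpa using congrFun h' (ρ i)
  exact LinearMap.congr_fun this x

end Homogeneous

/-- The matrix coefficients of an operation. -/
def matCoeff {m n : ℕ} (f : EndV k V m n) (J K : List ι) : k := coordT b m J (f (basisT b n K))

variable {deg}

/-- Symmetry in the outputs and symmetry in the inputs are extracted separately, by taking the other
permutation to be trivial. -/
theorem coeffSymm_matCoeff (hb : ∀ i, b i ∈ 𝒱 (deg i)) {m n : ℕ} {f : EndV k V m n}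
    (hf : ∀ (ρ : Fin m ≃ Fin m) (σ : Fin n ≃ Fin n), endAct 𝒱 ρ σ f = f) :
    CoeffSymm deg (matCoeff b f) := by
  constructor
  · intro K
    refine listSymm_of_perm (m := m) (fun l hl => by simp [matCoeff, coordT_of_ne b hl])
      fun ρ J => ?_
    have h := LinearMap.congr_fun (hf ρ (Equiv.refl _)) (basisT b n K)
    rw [endAct_apply, Equiv.refl_symm, permMap_refl] at h
    rw [matCoeff, ← h, coordT_permMap b hb]
    rfl
  · intro J
    refine listSymm_of_perm (m := n) (fun l hl => by simp [matCoeff, basisT_of_ne b hl])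
      fun σ K => ?_
    have h := LinearMap.congr_fun (hf (Equiv.refl _) σ.symm) (basisT b n (List.ofFn K))
    rw [endAct_apply, permMap_refl, Equiv.symm_symm] at h
    rw [matCoeff, matCoeff, ← h, basisT_ofFn, basisT_ofFn, permMap_basis b hb, map_smul, map_smul,
      smul_smul, kz_mul_self, one_smul]

theorem eq_zero_of_matCoeff {m n : ℕ} {f : EndV k V m n}
    (h : ∀ J K : List ι, J.length = m → K.length = n → matCoeff b f J K = 0) : f = 0 := by
  refine basisT_hom_ext b fun K => ?_
  rw [LinearMap.zero_apply, ← listSum_coordT b m (f _)]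
  refine (listSum_congr fun J hJ => ?_).trans (listSum_const_zero m)
  have := h J (List.ofFn K) hJ (by simp)
  rw [matCoeff, basisT_ofFn] at this
  rw [this, zero_smul]

theorem matCoeff_degree (hb : ∀ i, b i ∈ 𝒱 (deg i)) {m n : ℕ} {f : EndV k V m n} {r : ℤ}
    (hf : HasDeg 𝒱 f r) {J K : List ι} (h : matCoeff b f J K ≠ 0) :
    ldeg deg J = ldeg deg K + r :=
  ldeg_eq_of_coordT_ne_zero b hb (hf _ _ (basisT_mem b hb n K)) h

variable (deg) in
/-- The (normalized) symbol of an operation. -/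
def symbolOf {m n : ℕ} : EndV k V m n →ₗ[k] Phase k deg where
  toFun f := symbol deg m n (matCoeff b f)
  map_add' f g := by
    simp only [symbol, matCoeff, LinearMap.add_apply, map_add, add_smul, listSum_add_distrib,
      smul_add]
  map_smul' c f := by
    simp only [symbol, matCoeff, LinearMap.smul_apply, map_smul, smul_eq_mul, mul_smul,
      RingHom.id_apply, ← smul_listSum]
    rw [smul_comm]

theorem symbolOf_apply {m n : ℕ} (f : EndV k V m n) :
    symbolOf b deg f = symbol deg m n (matCoeff b f) := rfl

theorem symbolOf_eq {m n : ℕ} (f : EndV k V m n) :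
    symbolOf b deg f = ((m.factorial * n.factorial : ℕ) : k)⁻¹ •
      listSum n fun K => toPhase b deg m (f (basisT b n K)) * fMon k deg K.reverse := by
  rw [symbolOf_apply, symbol, listSum_comm]
  simp only [toPhase_apply, listSum_mul, smul_mul_assoc, matCoeff]

theorem reverse_ofFn {α : Type*} {n : ℕ} (I : Fin n → α) :
    (List.ofFn I).reverse = List.ofFn fun r => I (Fin.rev r) := by
  refine List.ext_getElem (by simp) fun a h1 h2 => ?_
  simp only [List.getElem_reverse, List.getElem_ofFn]
  congr 1
  ext
  simp [Fin.rev]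
  omega

theorem coord_eq {m n : ℕ} (f : EndV k V m n) (J : Fin m → ι) (I : Fin n → ι) :
    coord b f J I = matCoeff b f (List.ofFn J) (List.ofFn I).reverse := by
  rw [reverse_ofFn, coord, matCoeff, coordT_ofFn, basisT_ofFn]
  rfl

theorem aphi_eq {m n : ℕ} (J : Fin m → ι) (I : Fin n → ι) :
    aphi k deg J I = aMon k deg (List.ofFn J) * fMon k deg (List.ofFn I) := by
  rw [aphi, monomial_eq_mon, monomial_eq_mon, aMon, fMon, List.map_ofFn, List.map_ofFn]
  rfl

theorem generating_eq (f : ∀ m n _G : ℕ, EndV k V m n) (m n G : ℕ) :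
    generating b deg f m n G = symbolOf b deg (f m n G) := by
  rw [symbolOf_apply, symbol, generating]
  congr 1
  refine Finset.sum_congr rfl fun J _ => ?_
  refine Eq.trans ?_ (listSum_reverse n _)
  refine Finset.sum_congr rfl fun I _ => ?_
  beta_reduce
  rw [coord_eq, aphi_eq, List.reverse_reverse]

/-- A symbol does not remember the order of inputs and outputs. All distributions of legs in the
quadratic relation therefore have the same symbol. -/
theorem symbolOf_endAct (hb : ∀ i, b i ∈ 𝒱 (deg i)) {m n m' n' : ℕ} (ρ : Fin m ≃ Fin m')
    (σ : Fin n ≃ Fin n') (f : EndV k V m n) :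
    symbolOf b deg (endAct 𝒱 ρ σ f) = symbolOf b deg f := by
  have hm : m = m' := by simpa using Fintype.card_congr ρ
  have hn : n = n' := by simpa using Fintype.card_congr σ
  subst hm hn
  rw [symbolOf_eq, symbolOf_eq]
  congr 1
  simp only [endAct_apply, toPhase_permMap b hb, listSum, basisT_ofFn]
  -- The input words are reindexed by `σ`; the signs of the tensor and of the word in the `φ`'s then
  -- cancel.
  refine (Fintype.sum_equiv (Equiv.arrowCongr σ (Equiv.refl ι)) _ _ fun K => ?_).symm
  change _ = toPhase b deg m (f (permMap 𝒱 σ.symm (PiTensorProduct.tprod k (b ∘ (K ∘ σ.symm))))) *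
    fMon k deg (List.ofFn (K ∘ σ.symm)).reverse
  rw [permMap_basis b hb, map_smul, map_smul, smul_mul_assoc,
    (listSymm_fMon deg).reverse.comp_perm, mul_smul_comm, smul_smul, ← Function.comp_assoc,
    kz_symm, kz_mul_self, one_smul]
  congr 5
  funext r
  simp

/-- The coefficients of a symmetric operation are recovered from its symbol by `coeffAt`. Symmetry
cannot be dropped, since a symbol only sees the symmetrization. -/
theorem symbolOf_injective {m n : ℕ} (hb : ∀ i, b i ∈ 𝒱 (deg i)) {f : EndV k V m n}
    (hf : ∀ (ρ : Fin m ≃ Fin m) (σ : Fin n ≃ Fin n), endAct 𝒱 ρ σ f = f)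
    (h : symbolOf b deg f = 0) : f = 0 := by
  refine eq_zero_of_matCoeff b fun J K hJ hK => ?_
  have := coeffAt_symbol (coeffSymm_matCoeff b hb hf) m n J K
  rw [← symbolOf_apply, h, if_pos ⟨hJ.symm, hK.symm⟩] at this
  rw [← this, map_zero]

end Coordinates

/-! ### Composition of operations and contraction of symbols -/

section SymbolCalculus

variable {k : Type u} [Field k] [CharZero k] {V : Type v} [AddCommGroup V] [Module k V]
  {𝒱 : ℤ → Submodule k V} [DirectSum.Decomposition 𝒱] {d : V →ₗ[k] V}
  {ι : Type w} [Fintype ι] [DecidableEq ι] (b : Module.Basis ι k V) {deg : ι → ℤ}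

theorem factorial_smul_symbol (m n : ℕ) (c : List ι → List ι → k) :
    ((m.factorial * n.factorial : ℕ) : k) • symbol deg m n c =
      listSum m fun J => listSum n fun K => c J K • (aMon k deg J * fMon k deg K.reverse) := by
  rw [symbol, smul_inv_smul₀]
  exact Nat.cast_ne_zero.2 (Nat.mul_ne_zero (Nat.factorial_ne_zero _) (Nat.factorial_ne_zero _))

theorem factorial_smul_symbolOf {m n : ℕ} (f : EndV k V m n) :
    ((m.factorial * n.factorial : ℕ) : k) • symbolOf b deg f =
      listSum n fun K => toPhase b deg m (f (basisT b n K)) * fMon k deg K.reverse := by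
  rw [symbolOf_eq, smul_inv_smul₀]
  exact Nat.cast_ne_zero.2 (Nat.mul_ne_zero (Nat.factorial_ne_zero _) (Nat.factorial_ne_zero _))

theorem listSymm_toPhase (hb : ∀ i, b i ∈ 𝒱 (deg i)) {m n : ℕ} {f : EndV k V m n}
    (hf : ∀ (ρ : Fin m ≃ Fin m) (σ : Fin n ≃ Fin n), endAct 𝒱 ρ σ f = f) :
    ListSymm (k := k) deg fun K => toPhase b deg m (f (basisT b n K)) := fun p j l q => by
  simp only [toPhase_apply, smul_listSum]
  refine listSum_congr fun J _ => ?_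
  have := (coeffSymm_matCoeff b hb hf).right J p j l q
  simp only [matCoeff, smul_eq_mul] at this
  rw [this, mul_smul]

/-- Expanding `y` in the basis splits its word into the glued letters `K₀` and the free outputs
`J₂`. -/
theorem toPhase_glue {m₁ n₁ l m₂ : ℕ} (g : EndV k V m₁ (n₁ + l)) (x : ⨂[k]^n₁ V)
    (y : ⨂[k]^(l + m₂) V) : toPhase b deg (m₁ + m₂) (glue g x y) =
      listSum l fun K₀ => listSum m₂ fun J₂ => coordT b (l + m₂) (K₀ ++ J₂) y •
        (toPhase b deg m₁ (g (x ⊙ basisT b l K₀)) * aMon k deg J₂) := by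
  conv_lhs => rw [← listSum_coordT b _ y, map_listSum, map_listSum, listSum_add]
  refine listSum_congr fun K₀ hK => listSum_congr fun J₂ hJ => ?_
  rw [map_smul, map_smul, basisT_append b hK, glue_mulT, toPhase_mulT]
  obtain ⟨J, rfl⟩ := exists_ofFn hJ
  rw [basisT_ofFn, toPhase_tprod]

theorem phase_swap (J K K' : List ι) :
    aMon k deg J * fMon k deg K * fMon k deg K' =
      sg k ((ldeg deg J - ldeg deg K) * ldeg deg K') •
        (fMon k deg K' * (aMon k deg J * fMon k deg K)) := by
  have := mon_mul_mon (k := k) (phaseDeg deg) (J.map Sum.inl ++ K.map Sum.inr) (K'.map Sum.inr)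
  rw [mon_append] at this
  refine this.trans ?_
  congr 1
  rw [ldeg_append, ldeg_map_inl, ldeg_map_inr, ldeg_map_inr]
  refine sg_congr ⟨-((ldeg deg J - ldeg deg K) * ldeg deg K'), by ring⟩

theorem listSum_comm₄ {M : Type*} [AddCommMonoid M] (p q r s : ℕ)
    (F : List ι → List ι → List ι → List ι → M) :
    (listSum p fun x => listSum q fun y => listSum r fun z => listSum s fun t => F x y z t) =
      listSum s fun t => listSum r fun z => listSum p fun x => listSum q fun y => F x y z t := by
  have h1 : ∀ x y, (listSum r fun z => listSum s fun t => F x y z t) = _ :=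
    fun x y => listSum_comm _ _ _
  have h2 : ∀ x, (listSum q fun y => listSum s fun t => listSum r fun z => F x y z t) = _ :=
    fun x => listSum_comm _ _ _
  simp only [h1, h2]
  rw [listSum_comm]
  refine listSum_congr fun t _ => ?_
  have h3 : ∀ x, (listSum q fun y => listSum r fun z => F x y z t) = _ :=
    fun x => listSum_comm _ _ _
  simp only [h3]
  exact listSum_comm _ _ _

/-- Both sides are sums over the same words: `K₀` on the glued edges, `K₁` and `K₂` at the free
inputs, `J₂` at the free outputs of `f`. Three signs arise: `f` passes the inputs `K₁`, the letters
`K₀` are moved before `K₁` inside `g`, and the `φ`'s of `K₁` pass the monomial of `f`. They cancel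
because `f` has degree 1. The factorials are cleared here and are restored by the weights of
`splitSum`. -/
theorem symbolOf_endComp (hb : ∀ i, b i ∈ 𝒱 (deg i)) {m₁ n₁ m₂ n₂ j : ℕ}
    {g : EndV k V m₁ (n₁ + (j + 1))} {f : EndV k V ((j + 1) + m₂) n₂} (hf : HasDeg 𝒱 f 1)
    (hgs : ∀ ρ σ, endAct 𝒱 ρ σ g = g) (hfs : ∀ ρ σ, endAct 𝒱 ρ σ f = f) :
    (((m₁ + m₂).factorial * (n₁ + n₂).factorial : ℕ) : k) •
      symbolOf b deg (endComp 𝒱 j g f) =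
    ((m₁.factorial * n₁.factorial * (m₂.factorial * n₂.factorial) : ℕ) : k) •
      contract deg (j + 1) (symbolOf b deg g) (symbolOf b deg f) := by
  rw [factorial_smul_symbolOf, symbolOf_apply, symbolOf_apply,
    contract_symbol (coeffSymm_matCoeff b hb hgs) (coeffSymm_matCoeff b hb hfs), Nat.cast_mul,
    smul_listSum]
  simp only [← smul_mul_smul_comm, factorial_smul_symbol]
  have hR : ∀ K₀ : List ι, (listSum m₁ fun J => listSum n₁ fun K =>
      matCoeff b g J (K₀ ++ K) • (aMon k deg J * fMon k deg K.reverse)) =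
      listSum n₁ fun K₁ => toPhase b deg m₁ (g (basisT b _ (K₀ ++ K₁))) *
        fMon k deg K₁.reverse := by
    intro K₀
    rw [listSum_comm]
    simp only [toPhase_apply, listSum_mul, smul_mul_assoc, matCoeff]
  simp only [hR, listSum_mul, mul_listSum]
  rw [listSum_add, listSum_comm₄]
  refine listSum_congr fun K₁ hK₁ => listSum_congr fun K₂ hK₂ => ?_
  rw [basisT_append b hK₁, endComp_mulT g hf (basisT_mem b hb n₁ K₁), map_smul, toPhase_glue,
    List.reverse_append, fMon_append, smul_mul_assoc, listSum_mul, smul_listSum]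
  refine listSum_congr fun K₀ hK₀ => ?_
  rw [listSum_mul, smul_listSum]
  refine listSum_congr fun J₂ hJ₂ => ?_
  change sg k _ • (matCoeff b f (K₀ ++ J₂) K₂ • _ * _) = _
  -- The degree relation between the words is available only when the coefficient is nonzero.
  by_cases h0 : matCoeff b f (K₀ ++ J₂) K₂ = 0
  · simp [h0]
  · have hdeg := matCoeff_degree b hb hf h0
    rw [ldeg_append] at hdeg
    rw [← basisT_append b hK₁]
    have hs := (listSymm_toPhase b hb hgs).swap K₁ K₀ []
    simp only [List.append_nil] at hs
    have hp := phase_swap (k := k) (deg := deg) J₂ K₂.reverse K₁.reverse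
    rw [hs, smul_mul_assoc, smul_mul_assoc, smul_mul_assoc, mul_assoc, ← mul_assoc (aMon k deg J₂),
      hp, mul_smul_comm, mul_smul_comm, ← mul_assoc, smul_comm (matCoeff b f (K₀ ++ J₂) K₂),
      smul_comm (matCoeff b f (K₀ ++ J₂) K₂), smul_smul, smul_smul, ← sg_add, ← sg_add, ldeg_reverse,
      ldeg_reverse, sg_even, one_smul]
    -- Substituting the degree of the operation makes the total exponent twice the degree of `K₁`.
    have : ldeg deg J₂ - ldeg deg K₂ = 1 - ldeg deg K₀ := by linarith
    rw [this]
    exact ⟨ldeg deg K₁, by ring⟩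

/-! ### The differential -/

theorem phaseD_inl (hb : ∀ i, b i ∈ 𝒱 (deg i)) (hd : ∀ i : ℤ, ∀ x ∈ 𝒱 i, d x ∈ 𝒱 (i + 1)) (j : ι) :
    phaseD b deg d (Sym.x (phaseDeg deg) (Sum.inl j)) =
      ∑ i, b.repr (d (b j)) i • Sym.x (phaseDeg deg) (Sum.inl i) := by
  rw [phaseD, der_x, Fintype.sum_sum_type]
  simp only [zero_smul, ite_self, Finset.sum_const_zero, add_zero, phaseDeg_inl]
  refine Finset.sum_congr rfl fun i _ => ?_
  by_cases h : b.repr (d (b j)) i = 0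
  · simp [h]
  · exact if_pos (deg_eq_of_repr_ne_zero b hb (hd _ _ (hb j)) h)

theorem phaseD_inr (hb : ∀ i, b i ∈ 𝒱 (deg i)) (hd : ∀ i : ℤ, ∀ x ∈ 𝒱 i, d x ∈ 𝒱 (i + 1)) (j : ι) :
    phaseD b deg d (Sym.x (phaseDeg deg) (Sum.inr j)) =
      ∑ i, (-sg k (deg j) * b.repr (d (b i)) j) • Sym.x (phaseDeg deg) (Sum.inr i) := by
  rw [phaseD, der_x, Fintype.sum_sum_type]
  simp only [zero_smul, ite_self, Finset.sum_const_zero, zero_add, phaseDeg_inr]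
  refine Finset.sum_congr rfl fun i _ => ?_
  by_cases h : b.repr (d (b i)) j = 0
  · simp [h]
  · have := deg_eq_of_repr_ne_zero b hb (hd _ _ (hb i)) h
    exact if_pos (show -deg i = -deg j + 1 by omega)

theorem phaseD_mon_mul (l : List (ι ⊕ ι)) (y : Phase k deg) :
    phaseD b deg d (mon k (phaseDeg deg) l * y) = phaseD b deg d (mon k (phaseDeg deg) l) * y +
      sg k (ldeg (phaseDeg deg) l) • (mon k (phaseDeg deg) l * phaseD b deg d y) :=
  der_mon_mul (phaseDeg deg) _ l y

theorem phaseD_aMon_mul (J : List ι) (y : Phase k deg) : phaseD b deg d (aMon k deg J * y) =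
    phaseD b deg d (aMon k deg J) * y + sg k (ldeg deg J) • (aMon k deg J * phaseD b deg d y) := by
  have h := phaseD_mon_mul b (d := d) (J.map Sum.inl) y
  rw [ldeg_map_inl] at h
  exact h

theorem tensorD_basisT_singleton (hb : ∀ i, b i ∈ 𝒱 (deg i)) (j : ι) :
    tensorD 𝒱 d 1 (basisT b 1 [j]) = ∑ i, b.repr (d (b j)) i • basisT b 1 [i] := by
  have h : ∀ i, basisT b 1 [i] = PiTensorProduct.tprod k fun _ => b i := fun i =>
    basisT_ofFn b fun _ : Fin 1 => i
  simp only [h]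
  rw [tensorD_tprod 𝒱 fun _ => hb j, Fin.sum_univ_one]
  simp only [Fin.prod_univ_one, lt_self_iff_false, if_false, one_smul]
  have h2 : ∀ v : V, PiTensorProduct.tprod k (fun _ : Fin 1 => v) =
      (PiTensorProduct.subsingletonEquiv (R := k) (s := fun _ => V) (0 : Fin 1)).symm v := fun v =>
    (PiTensorProduct.subsingletonEquiv_symm_apply' (0 : Fin 1) v).symm
  have h3 : Function.update (fun _ : Fin 1 => b j) 0 (d (b j)) = fun _ => d (b j) := by
    funext i
    rw [Subsingleton.elim i 0]
    simp
  rw [h3]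
  simp only [h2]
  conv_lhs => rw [← b.sum_repr (d (b j)), map_sum]
  simp only [map_smul]

/-- Both differentials are derivations that agree on letters, so an induction that splits off the
last letter suffices. -/
theorem phaseD_toPhase (hb : ∀ i, b i ∈ 𝒱 (deg i)) (hd : ∀ i : ℤ, ∀ x ∈ 𝒱 i, d x ∈ 𝒱 (i + 1)) (m : ℕ)
    (x : ⨂[k]^m V) :
    phaseD b deg d (toPhase b deg m x) = toPhase b deg m (tensorD 𝒱 d m x) := by
  have key : ∀ (m : ℕ) (l : List ι), l.length = m → phaseD b deg d (toPhase b deg m (basisT b m l)) =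
      toPhase b deg m (tensorD 𝒱 d m (basisT b m l)) := by
    have hP : ∀ (m : ℕ) (l : List ι), l.length = m →
        toPhase b deg m (basisT b m l) = aMon k deg l := by
      intro m l hl
      obtain ⟨J, rfl⟩ := exists_ofFn hl
      rw [basisT_ofFn, toPhase_tprod]
    intro m
    induction m with
    | zero =>
      intro l hl
      rw [hP _ _ hl]
      obtain rfl : l = [] := by simpa using hl
      simp [tensorD, phaseD]
    | succ m ih =>
      intro l hl
      obtain ⟨p, j, rfl⟩ : ∃ p j, l = p ++ [j] := by
        rcases l.eq_nil_or_concat with rfl | ⟨p, j, h⟩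
        · simp at hl
        · exact ⟨p, j, by simpa using h⟩
      have hp : p.length = m := by simpa using hl
      rw [basisT_append b hp, tensorD_mulT 𝒱 (basisT_mem b hb m p), map_add, map_smul,
        toPhase_mulT, toPhase_mulT, toPhase_mulT, ← ih p hp, hP _ _ hp, hP 1 [j] rfl,
        tensorD_basisT_singleton b hb, phaseD_aMon_mul]
      congr 3
      simp only [map_sum, map_smul, hP 1 _ (List.length_singleton)]
      simpa using phaseD_inl b hb hd j
  rw [← listSum_coordT b m x]
  simp only [map_listSum, map_smul]
  exact listSum_congr fun l hl => by rw [key m l hl]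

/-- A transposition: summed over all basis tensors and dual monomials, the differential on the
inputs can be moved to the `φ`'s, where it acts by minus the transposed matrix with a sign. The
induction splits off the last input, which is the first letter of the reversed word. -/
theorem listSum_tensorD (hb : ∀ i, b i ∈ 𝒱 (deg i)) (hd : ∀ i : ℤ, ∀ x ∈ 𝒱 i, d x ∈ 𝒱 (i + 1)) (n : ℕ)
    (F : (⨂[k]^n V) →ₗ[k] Phase k deg) :
    (listSum n fun K => F (tensorD 𝒱 d n (basisT b n K)) * fMon k deg K.reverse) =
      listSum n fun K => (-sg k (ldeg deg K)) •
        (F (basisT b n K) * phaseD b deg d (fMon k deg K.reverse)) := by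
  induction n with
  | zero => simp [tensorD, phaseD]
  | succ n ih =>
    rw [listSum_snoc, listSum_snoc]
    have h1 : ∀ K : List ι, K.length = n →
        (∑ i, F (tensorD 𝒱 d (n + 1) (basisT b (n + 1) (K ++ [i]))) * fMon k deg (K ++ [i]).reverse) =
        (∑ i, (LinearMap.mulRight k (Sym.x (phaseDeg deg) (Sum.inr i)) ∘ₗ F ∘ₗ
            (mulT (k := k) (V := V) (a := n) (b := 1)).flip (basisT b 1 [i]))
              (tensorD 𝒱 d n (basisT b n K)) * fMon k deg K.reverse) +
        ∑ i, (-sg k (ldeg deg (K ++ [i]))) • (F (basisT b (n + 1) (K ++ [i])) *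
          (phaseD b deg d (Sym.x (phaseDeg deg) (Sum.inr i)) * fMon k deg K.reverse)) := by
      intro K hK
      have h2 : ∀ i, F (tensorD 𝒱 d (n + 1) (basisT b (n + 1) (K ++ [i]))) *
          fMon k deg (K ++ [i]).reverse =
          (LinearMap.mulRight k (Sym.x (phaseDeg deg) (Sum.inr i)) ∘ₗ F ∘ₗ
            (mulT (k := k) (V := V) (a := n) (b := 1)).flip (basisT b 1 [i]))
              (tensorD 𝒱 d n (basisT b n K)) * fMon k deg K.reverse +
          ∑ a, (sg k (ldeg deg K) * b.repr (d (b i)) a) • (F (basisT b (n + 1) (K ++ [a])) *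
            (Sym.x (phaseDeg deg) (Sum.inr i) * fMon k deg K.reverse)) := by
        intro i
        rw [basisT_append b hK, tensorD_mulT 𝒱 (basisT_mem b hb n K), map_add, add_mul,
          tensorD_basisT_singleton b hb]
        simp only [List.reverse_append, List.reverse_singleton, List.singleton_append, fMon_cons,
          LinearMap.comp_apply, LinearMap.flip_apply, LinearMap.mulRight_apply, mul_assoc,
          map_smul, map_sum, Finset.smul_sum, Finset.sum_mul, smul_mul_assoc, mul_smul]
        congr 1
        refine Finset.sum_congr rfl fun a _ => ?_
        rw [basisT_append b hK]
      simp only [h2]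
      -- Exchanging the sums over the letter and its image under `d` transposes the matrix of `d`.
      rw [Finset.sum_add_distrib, Finset.sum_comm]
      congr 1
      refine Finset.sum_congr rfl fun a _ => ?_
      rw [phaseD_inr b hb hd, ldeg_append, Finset.sum_mul, Finset.mul_sum, Finset.smul_sum]
      refine Finset.sum_congr rfl fun i _ => ?_
      rw [smul_mul_assoc, mul_smul_comm, smul_smul]
      congr 1
      rw [sg_add, ldeg_cons, ldeg_nil, add_zero, ← mul_assoc, neg_mul_neg, mul_assoc (sg k _),
        sg_mul_self, mul_one]
    rw [listSum_congr h1, listSum_add_distrib, ← listSum_sum]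
    simp only [ih]
    rw [listSum_sum, listSum, listSum, listSum, ← Finset.sum_add_distrib]
    refine Finset.sum_congr rfl fun K' _ => ?_
    rw [← Finset.sum_add_distrib]
    refine Finset.sum_congr rfl fun i _ => ?_
    have hD := phaseD_mon_mul b (d := d) [Sum.inr i] (fMon k deg (List.ofFn K').reverse)
    have hD' : phaseD b deg d (Sym.x (phaseDeg deg) (Sum.inr i) * fMon k deg (List.ofFn K').reverse) =
        phaseD b deg d (Sym.x (phaseDeg deg) (Sum.inr i)) * fMon k deg (List.ofFn K').reverse +
        sg k (deg i) • (Sym.x (phaseDeg deg) (Sum.inr i) *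
          phaseD b deg d (fMon k deg (List.ofFn K').reverse)) := by
      simp only [mon_cons, mon_nil, mul_one, ldeg_cons, ldeg_nil, add_zero, phaseDeg_inr, sg_neg] at hD
      exact hD
    simp only [List.reverse_append, List.reverse_singleton, List.singleton_append, fMon_cons, hD']
    rw [basisT_append b (by simp), mul_add, smul_add, add_comm]
    congr 1
    simp only [LinearMap.comp_apply, LinearMap.flip_apply, LinearMap.mulRight_apply]
    rw [mul_smul_comm, smul_smul, neg_mul, ← sg_add, ldeg_append, ldeg_cons, ldeg_nil, mul_assoc]
    congr 2
    exact sg_congr ⟨-deg i, by ring⟩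

/-- The part `d f` differentiates the `a`'s, the part `f d` is transposed to the `φ`'s by
`listSum_tensorD`, and the Leibniz rule for `phaseD` combines them. -/
theorem symbolOf_endD (hb : ∀ i, b i ∈ 𝒱 (deg i)) (hd : ∀ i : ℤ, ∀ x ∈ 𝒱 i, d x ∈ 𝒱 (i + 1)) {m n : ℕ}
    {f : EndV k V m n} (hf : HasDeg 𝒱 f 1) :
    symbolOf b deg (endD 𝒱 d f) = phaseD b deg d (symbolOf b deg f) := by
  rw [symbolOf_eq, symbolOf_eq, map_smul]
  congr 1
  simp only [endD_apply hf, sg_one, neg_smul, one_smul, sub_neg_eq_add, map_add, add_mul]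
  rw [listSum_add_distrib]
  refine (congrArg (_ + ·) (listSum_tensorD b hb hd n (toPhase b deg m ∘ₗ f))).trans ?_
  rw [map_listSum, ← listSum_add_distrib]
  refine listSum_congr fun K _ => ?_
  rw [← phaseD_toPhase b hb hd]
  -- The sign in front of the second term is that of the degree `ldeg deg K + 1` of the output of
  -- `f`.
  have key : ∀ (w : ⨂[k]^m V), w ∈ tensorDegree 𝒱 m (ldeg deg K + 1) → ∀ y,
      phaseD b deg d (toPhase b deg m w * y) = phaseD b deg d (toPhase b deg m w) * y +
        (-sg k (ldeg deg K)) • (toPhase b deg m w * phaseD b deg d y) := by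
    intro w hw y
    simp only [toPhase_apply, listSum_mul, map_listSum, smul_listSum]
    rw [← listSum_add_distrib]
    refine listSum_congr fun J _ => ?_
    by_cases h : coordT b m J w = 0
    · simp [h]
    · rw [smul_mul_assoc, map_smul, phaseD_aMon_mul, ldeg_eq_of_coordT_ne_zero b hb hw h, sg_add,
        sg_one, map_smul, smul_mul_assoc, smul_mul_assoc, smul_add, mul_neg_one, smul_comm]
  exact (key _ (hf _ _ (basisT_mem b hb n K)) _).symm

/-! ### The quadratic relations -/

theorem sum_range_antidiagonal {M : Type*} [AddCommMonoid M] (n : ℕ) (F : ℕ → ℕ → M) :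
    (∑ p ∈ Finset.range (n + 1), ∑ q ∈ Finset.range (n + 1), if p + q = n then F p q else 0) =
      ∑ p ∈ Finset.HasAntidiagonal.antidiagonal n, F p.1 p.2 := by
  rw [← Finset.sum_product', ← Finset.sum_filter]
  refine Finset.sum_congr ?_ fun _ _ => rfl
  ext ⟨p, q⟩
  simp only [Finset.mem_filter, Finset.mem_product, Finset.mem_range,
    Finset.HasAntidiagonal.mem_antidiagonal]
  omega

theorem sum_range_antidiagonal₃ {M : Type*} [AddCommMonoid M] (n : ℕ) (F : ℕ → ℕ → ℕ → M) :
    (∑ p ∈ Finset.range (n + 1), ∑ q ∈ Finset.range (n + 1), ∑ r ∈ Finset.range (n + 1),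
      if p + q + r = n then F p q r else 0) =
      ∑ r ∈ Finset.HasAntidiagonal.antidiagonal n, ∑ s ∈ Finset.HasAntidiagonal.antidiagonal r.1,
        F s.1 s.2 r.2 := by
  have h : ∀ p q : ℕ, (∑ r ∈ Finset.range (n + 1), if p + q + r = n then F p q r else 0) =
      if p + q ≤ n then F p q (n - (p + q)) else 0 := by
    intro p q
    split_ifs with h
    · rw [Finset.sum_eq_single (n - (p + q))]
      · rw [if_pos (by omega)]
      · intro r _ hr
        exact if_neg (by omega)
      · intro hr
        simp at hr
    · exact Finset.sum_eq_zero fun r _ => if_neg (by omega)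
  simp only [h]
  rw [← Finset.sum_product', ← Finset.sum_filter, Finset.sum_sigma']
  refine Finset.sum_nbij' (fun p => ⟨(p.1 + p.2, n - (p.1 + p.2)), p⟩) (fun x => x.2) ?_ ?_ ?_ ?_ ?_
  · rintro ⟨p, q⟩ hp
    simp at hp ⊢
    omega
  · rintro ⟨⟨r, r'⟩, ⟨s, s'⟩⟩ hp
    simp at hp ⊢
    omega
  · intro p _
    rfl
  · rintro ⟨⟨r, r'⟩, ⟨s, s'⟩⟩ hp
    simp at hp ⊢
    obtain ⟨h1, rfl⟩ := hp
    omega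
  · intro p _
    rfl

theorem sum_equiv_const {M : Type*} [AddCommGroup M] [Module k M] (m m' : ℕ) (x : M) :
    ∑ _ρ : Fin m ≃ Fin m', x = if m = m' then ((m.factorial : ℕ) : k) • x else 0 := by
  split_ifs with h
  · subst h
    rw [Finset.sum_const, Finset.card_univ, Fintype.card_perm, Fintype.card_fin, Nat.cast_smul_eq_nsmul]
  · have : IsEmpty (Fin m ≃ Fin m') := ⟨fun e => h (by simpa using Fintype.card_congr e)⟩
    simp

/-- Every pair `(ρ, σ)` contributes the same symbol, so these sums give the factorials of `m` and
`n`. Together with `symbolOf_endComp` they cancel all weights except `1/(j + 1)!`, the one in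
`circ`. If the numbers of legs do not add up, there are no bijections and the term is zero. -/
theorem symbolOf_quadratic (hb : ∀ i, b i ∈ 𝒱 (deg i)) {ne : Bool} {f : ∀ m n _G : ℕ, EndV k V m n}
    (hf : IsOperations 𝒱 ne f) (m n G : ℕ) :
    symbolOf b deg (quadratic 𝒱 f m n G) =
      circ deg (generating b deg f) (generating b deg f) m n G := by
  rw [quadratic, map_splitSum]
  simp only [symbolOf_endAct b hb]
  rw [circ, ← sum_range_antidiagonal m fun m₁ m₂ => ∑ q ∈ Finset.HasAntidiagonal.antidiagonal n,
    ∑ r ∈ Finset.HasAntidiagonal.antidiagonal G, ∑ s ∈ Finset.HasAntidiagonal.antidiagonal r.1,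
      ((r.2 + 1).factorial : k)⁻¹ • contract deg (r.2 + 1)
        (generating b deg f m₁ (q.1 + (r.2 + 1)) s.1)
        (generating b deg f ((r.2 + 1) + m₂) q.2 s.2), splitSum]
  refine Finset.sum_congr rfl fun m₁ _ => Finset.sum_congr rfl fun m₂ _ => ?_
  split_ifs with hm
  · subst hm
    rw [← sum_range_antidiagonal n fun n₁ n₂ =>
      ∑ r ∈ Finset.HasAntidiagonal.antidiagonal G, ∑ s ∈ Finset.HasAntidiagonal.antidiagonal r.1,
        ((r.2 + 1).factorial : k)⁻¹ • contract deg (r.2 + 1)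
          (generating b deg f m₁ (n₁ + (r.2 + 1)) s.1)
          (generating b deg f ((r.2 + 1) + m₂) n₂ s.2)]
    refine Finset.sum_congr rfl fun n₁ _ => Finset.sum_congr rfl fun n₂ _ => ?_
    split_ifs with hn
    · subst hn
      rw [← sum_range_antidiagonal₃ G fun G₁ G₂ j => ((j + 1).factorial : k)⁻¹ •
        contract deg (j + 1) (generating b deg f m₁ (n₁ + (j + 1)) G₁)
          (generating b deg f ((j + 1) + m₂) n₂ G₂)]
      refine Finset.sum_congr rfl fun G₁ _ => Finset.sum_congr rfl fun G₂ _ =>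
        Finset.sum_congr rfl fun j _ => ?_
      split_ifs with hG
      · rw [sum_equiv_const (k := k), sum_equiv_const (k := k), if_pos rfl, if_pos rfl, smul_smul,
          smul_smul, mul_assoc, ← Nat.cast_mul, mul_smul, symbolOf_endComp b hb (hf.degree _ _ _)
          (hf.symm _ _ _) (hf.symm _ _ _), smul_smul, generating_eq, generating_eq]
        congr 1
        have h := fun n => Nat.cast_ne_zero (R := k).2 (Nat.factorial_ne_zero n)
        have := h m₁
        have := h m₂
        have := h n₁
        have := h n₂
        have := h (j + 1)
        push_cast
        field_simp
      · rfl
    · refine Finset.sum_eq_zero fun G₁ _ => Finset.sum_eq_zero fun G₂ _ =>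
        Finset.sum_eq_zero fun j _ => ?_
      split_ifs
      · rw [sum_equiv_const (k := k), sum_equiv_const (k := k), if_neg hn]
        simp
      · rfl
  · refine Finset.sum_eq_zero fun n₁ _ => Finset.sum_eq_zero fun n₂ _ =>
      Finset.sum_eq_zero fun G₁ _ => Finset.sum_eq_zero fun G₂ _ =>
        Finset.sum_eq_zero fun j _ => ?_
    split_ifs
    · rw [sum_equiv_const (k := k), if_neg hm, smul_zero]
    · rfl

end SymbolCalculus

/-! ### Operations, symbols and the master equation -/

section Bijections

variable {k : Type u} [Field k] [CharZero k] {V : Type v} [AddCommGroup V] [Module k V]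
  {𝒱 : ℤ → Submodule k V} [DirectSum.Decomposition 𝒱] {d : V →ₗ[k] V}
  {ι : Type w} [Fintype ι] [DecidableEq ι] (b : Module.Basis ι k V) {deg : ι → ℤ} {ne : Bool}

theorem isSymbol_generating (hb : ∀ i, b i ∈ 𝒱 (deg i)) {f : ∀ m n _G : ℕ, EndV k V m n}
    (hf : IsOperations 𝒱 ne f) : IsSymbol deg ne (generating b deg f) := by
  refine fun m n G => ⟨fun h => ?_, ?_⟩
  · rw [generating_eq, hf.support m n G h, map_zero]
  · refine Submodule.smul_mem _ _ (Submodule.sum_mem _ fun J _ => Submodule.sum_mem _ fun I _ => ?_)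
    by_cases h : coord b (f m n G) J I = 0
    · rw [h, zero_smul]
      exact zero_mem _
    · refine Submodule.smul_mem _ _ (Submodule.subset_span ⟨J, I, ?_, rfl⟩)
      rw [coord_eq] at h
      have := matCoeff_degree b hb (hf.degree m n G) h
      rw [ldeg_reverse, ldeg_ofFn, ldeg_ofFn] at this
      rw [this, add_sub_cancel_left]

theorem exists_symbolOf_eq_aphi (hb : ∀ i, b i ∈ 𝒱 (deg i)) {m n : ℕ} (J : Fin m → ι)
    (I : Fin n → ι) (h : ∑ r, deg (J r) - ∑ r, deg (I r) = 1) :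
    ∃ f : EndV k V m n, HasDeg 𝒱 f 1 ∧ symbolOf b deg f =
      ((m.factorial * n.factorial : ℕ) : k)⁻¹ • aphi k deg J I := by
  -- An elementary operator: it sends one basis tensor to one basis tensor and kills the others. The
  -- reversal of `I` matches the convention for symbols.
  refine ⟨(coordT b n (List.ofFn I).reverse).smulRight (basisT b m (List.ofFn J)),
    fun s x hx => ?_, ?_⟩
  · rw [LinearMap.smulRight_apply]
    by_cases h0 : coordT b n (List.ofFn I).reverse x = 0
    · rw [h0, zero_smul]
      exact zero_mem _
    · refine Submodule.smul_mem _ _ (mem_degree_congr ?_ (basisT_mem b hb m _))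
      rw [← ldeg_eq_of_coordT_ne_zero b hb hx h0, ldeg_reverse, ldeg_ofFn, ldeg_ofFn]
      linarith
  · rw [symbolOf_eq, aphi_eq]
    congr 1
    rw [reverse_ofFn]
    simp only [LinearMap.smulRight_apply, listSum, basisT_ofFn, coordT_tprod_basis, ite_smul,
      one_smul, zero_smul]
    rw [Finset.sum_eq_single_of_mem _ (Finset.mem_univ fun r => I (Fin.rev r)) fun K _ hK => by
      rw [if_neg hK, map_zero, zero_mul], if_pos rfl, toPhase_tprod]
    rw [← reverse_ofFn, List.reverse_reverse]

/-- Summing over all relabellings makes an operation symmetric, and each summand has the same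
symbol, hence the factor. -/
theorem exists_symm_symbolOf_eq (hb : ∀ i, b i ∈ 𝒱 (deg i)) {m n : ℕ} {f : EndV k V m n}
    (hf : HasDeg 𝒱 f 1) :
    ∃ g : EndV k V m n, HasDeg 𝒱 g 1 ∧ (∀ ρ σ, endAct 𝒱 ρ σ g = g) ∧
      symbolOf b deg g = ((m.factorial * n.factorial : ℕ) : k) • symbolOf b deg f := by
  refine ⟨∑ ρ : Fin m ≃ Fin m, ∑ σ : Fin n ≃ Fin n, endAct 𝒱 ρ σ f, ?_, fun ρ' σ' => ?_, ?_⟩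
  · exact HasDeg.sum _ fun ρ _ => HasDeg.sum _ fun σ _ => hf.endAct ρ σ
  · change endActL 𝒱 ρ' σ' _ = _
    simp only [map_sum]
    refine Fintype.sum_equiv (Equiv.equivCongr (Equiv.refl _) ρ') _ _ fun ρ => ?_
    refine Fintype.sum_equiv (Equiv.equivCongr (Equiv.refl _) σ') _ _ fun σ => ?_
    exact endAct_endAct ρ σ ρ' σ' f
  · simp only [map_sum, symbolOf_endAct b hb, Finset.sum_const, Finset.card_univ,
      Fintype.card_perm, Fintype.card_fin]
    rw [Nat.cast_smul_eq_nsmul, mul_smul]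

theorem exists_symbolOf_eq (hb : ∀ i, b i ∈ 𝒱 (deg i)) {m n : ℕ} {p : Phase k deg}
    (hp : p ∈ Submodule.span k {y | ∃ (J : Fin m → ι) (I : Fin n → ι),
      ∑ r, deg (J r) - ∑ r, deg (I r) = 1 ∧ aphi k deg J I = y}) :
    ∃ f : EndV k V m n, HasDeg 𝒱 f 1 ∧ (∀ ρ σ, endAct 𝒱 ρ σ f = f) ∧ symbolOf b deg f = p := by
  induction hp using Submodule.span_induction with
  | mem y hy =>
    obtain ⟨J, I, h, rfl⟩ := hy
    obtain ⟨f, hf, hs⟩ := exists_symbolOf_eq_aphi b hb J I h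
    obtain ⟨g, hg, hgs, hg'⟩ := exists_symm_symbolOf_eq b hb hf
    refine ⟨g, hg, hgs, ?_⟩
    rw [hg', hs, smul_inv_smul₀]
    exact Nat.cast_ne_zero.2 (Nat.mul_ne_zero (Nat.factorial_ne_zero _) (Nat.factorial_ne_zero _))
  | zero => exact ⟨0, HasDeg.zero 1, fun ρ σ => map_zero (endActL 𝒱 ρ σ), map_zero _⟩
  | add x y _ _ hx hy =>
    obtain ⟨f, hf, hfs, rfl⟩ := hx
    obtain ⟨g, hg, hgs, rfl⟩ := hy
    exact ⟨f + g, hf.add hg, fun ρ σ => by rw [endAct_add, hfs, hgs], map_add _ _ _⟩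
  | smul c x _ hx =>
    obtain ⟨f, hf, hfs, rfl⟩ := hx
    exact ⟨c • f, hf.smul c, fun ρ σ => by rw [endAct_smul, hfs], map_smul _ _ _⟩

theorem bijOn_generating (hb : ∀ i, b i ∈ 𝒱 (deg i)) :
    Set.BijOn (generating b deg) {f | IsOperations 𝒱 ne f} {L | IsSymbol deg ne L} := by
  refine ⟨fun f hf => isSymbol_generating b hb hf, fun f hf g hg h => ?_, fun L hL => ?_⟩
  · funext m n G
    have h' := congrFun (congrFun (congrFun h m) n) G
    rw [generating_eq, generating_eq] at h'
    rw [← sub_eq_zero]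
    refine symbolOf_injective b hb (𝒱 := 𝒱) (fun ρ σ => ?_) (by rw [map_sub, h', sub_self])
    change endActL 𝒱 ρ σ (f m n G - g m n G) = _
    rw [map_sub]
    exact congrArg₂ (· - ·) (hf.symm m n G ρ σ) (hg.symm m n G ρ σ)
  · choose f hf hs he using fun m n G => exists_symbolOf_eq b hb (hL m n G).2
    refine ⟨f, ⟨hf, fun m n G h => ?_, hs⟩, ?_⟩
    -- The support condition on operations follows from the one on symbols by injectivity.
    · exact symbolOf_injective b hb (hs m n G) (by rw [he, (hL m n G).1 h])
    · funext m n G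
      rw [generating_eq, he]

/-- A relabelling only permutes the distributions over which the sum runs, so no symmetry of the
operations is used. -/
theorem endAct_quadratic {f : ∀ m n _G : ℕ, EndV k V m n} {m n : ℕ} (G : ℕ) (ρ₀ : Fin m ≃ Fin m)
    (σ₀ : Fin n ≃ Fin n) :
    endAct 𝒱 ρ₀ σ₀ (quadratic 𝒱 f m n G) = quadratic 𝒱 f m n G := by
  change endActL 𝒱 ρ₀ σ₀ _ = _
  rw [quadratic, map_splitSum]
  refine Eq.trans ?_ (splitSum_reindex ρ₀ σ₀ rfl _)
  exact splitSum_congr fun m₁ m₂ n₁ n₂ G₁ G₂ j ρ σ h => endAct_endAct _ _ _ _ _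

/-- The master equation is the symbol of the defect of the quadratic relation. This identity links
operations to both the symbols and the operators. -/
theorem symbolOf_relation (hb : ∀ i, b i ∈ 𝒱 (deg i)) (hd : ∀ i : ℤ, ∀ x ∈ 𝒱 i, d x ∈ 𝒱 (i + 1))
    {f : ∀ m n _G : ℕ, EndV k V m n} (hf : IsOperations 𝒱 ne f) (m n G : ℕ) :
    symbolOf b deg (quadratic 𝒱 f m n G - endD 𝒱 d (f m n G)) =
      -phaseD b deg d (generating b deg f m n G) +
        circ deg (generating b deg f) (generating b deg f) m n G := by
  rw [map_sub, symbolOf_quadratic b hb hf, symbolOf_endD b hb hd (hf.degree m n G), generating_eq]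
  exact sub_eq_neg_add _ _

/-- The defect is graded symmetric, so it vanishes as soon as its symbol does. -/
theorem isIBL_iff_masterEq (hb : ∀ i, b i ∈ 𝒱 (deg i))
    (hd : ∀ i : ℤ, ∀ x ∈ 𝒱 i, d x ∈ 𝒱 (i + 1)) {f : ∀ m n _G : ℕ, EndV k V m n}
    (hf : IsOperations 𝒱 ne f) : IsIBL 𝒱 d ne f ↔ MasterEq b deg d (generating b deg f) := by
  constructor
  · intro h m n G
    rw [← symbolOf_relation b hb hd hf, show endD 𝒱 d (f m n G) = quadratic 𝒱 f m n G from
      h.relation m n G, sub_self, map_zero]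
  · intro h
    refine ⟨hf, fun m n G => ?_⟩
    have h0 := h m n G
    rw [← symbolOf_relation b hb hd hf] at h0
    refine (sub_eq_zero.1 (symbolOf_injective b hb (𝒱 := 𝒱) (fun ρ σ => ?_) h0)).symm
    change endActL 𝒱 ρ σ _ = _
    rw [map_sub]
    refine congrArg₂ (· - ·) (endAct_quadratic G ρ σ) ?_
    change endAct 𝒱 ρ σ (endD 𝒱 d (f m n G)) = _
    rw [← endD_endAct hd, hf.symm]

theorem bijOn_generating_operations (hb : ∀ i, b i ∈ 𝒱 (deg i))
    (hd : ∀ i : ℤ, ∀ x ∈ 𝒱 i, d x ∈ 𝒱 (i + 1)) :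
    Set.BijOn (fun α : CobarAlgebra 𝒱 d (frob k ne) => generating b deg (operations 𝒱 d α))
      Set.univ {L | IsSymbol deg ne L ∧ MasterEq b deg d L} := by
  have h := bijOn_generating (ne := ne) b hb
  have h' : Set.BijOn (generating b deg) {f | IsIBL 𝒱 d ne f}
      {L | IsSymbol deg ne L ∧ MasterEq b deg d L} := by
    refine ⟨fun f hf => ⟨h.mapsTo hf.toIsOperations,
      (isIBL_iff_masterEq b hb hd hf.toIsOperations).1 hf⟩,
      h.injOn.mono fun f hf => hf.toIsOperations, fun L hL => ?_⟩
    obtain ⟨f, hf, rfl⟩ := h.surjOn hL.1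
    exact ⟨f, (isIBL_iff_masterEq b hb hd hf).2 hL.2, rfl⟩
  exact h'.comp (bijOn_operations hd)

end Bijections

/-! ### Parity twists, derivatives and derivations of `S(V)` -/

section Operators

variable {k : Type u} [Field k] {ι : Type w} (deg : ι → ℤ)

variable (k) in
/-- The automorphism multiplying elements of degree `r` by `(-1) ^ (e r)`. -/
def twistHom (e : ℤ) : Sym k deg →ₐ[k] Sym k deg :=
  RingQuot.liftAlgHom k (s := SymRel k deg)
    ⟨FreeAlgebra.lift k fun i => sg k (e * deg i) • Sym.x deg i, by
      rintro _ _ ⟨i, j⟩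
      simp only [map_mul, map_smul, FreeAlgebra.lift_ι_apply, smul_mul_smul_comm]
      rw [Sym.x_mul_x, smul_comm, mul_comm (sg k _)]⟩

variable (k) in
/-- `twistHom` as a linear map. -/
def twist (e : ℤ) : Module.End k (Sym k deg) := (twistHom k deg e).toLinearMap

variable {deg}

theorem twist_x_mul (e : ℤ) (i : ι) (y : Sym k deg) :
    twist k deg e (Sym.x deg i * y) = sg k (e * deg i) • (Sym.x deg i * twist k deg e y) := by
  have h : twistHom k deg e (Sym.x deg i) = sg k (e * deg i) • Sym.x deg i := by
    rw [twistHom, Sym.x]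
    erw [RingQuot.liftAlgHom_mkAlgHom_apply]
    exact FreeAlgebra.lift_ι_apply _ _
  change twistHom k deg e (Sym.x deg i * y) = _
  rw [map_mul, h, smul_mul_assoc]
  rfl

@[simp] theorem twist_one (e : ℤ) : twist k deg e 1 = 1 := map_one (twistHom k deg e)

theorem twist_mon (e : ℤ) (l : List ι) :
    twist k deg e (mon k deg l) = sg k (e * ldeg deg l) • mon k deg l := by
  induction l with
  | nil => simp
  | cons i l ih =>
    rw [mon_cons, twist_x_mul, ih, mul_smul_comm, smul_smul, ldeg_cons, mul_add, sg_add]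

theorem twist_twist (e e' : ℤ) (y : Sym k deg) :
    twist k deg e (twist k deg e' y) = twist k deg (e + e') y := by
  have : twist k deg e ∘ₗ twist k deg e' = twist k deg (e + e') := sym_hom_ext fun l => by
    rw [LinearMap.comp_apply, twist_mon, map_smul, twist_mon, twist_mon, smul_smul, ← sg_add]
    congr 2
    ring
  exact LinearMap.congr_fun this y

theorem twist_twist_self (e : ℤ) (y : Sym k deg) :
    twist k deg e (twist k deg e y) = y := by
  have : twist k deg e ∘ₗ twist k deg e = LinearMap.id := sym_hom_ext fun l => by
    rw [LinearMap.comp_apply, twist_mon, map_smul, twist_mon, smul_smul, sg_mul_self, one_smul]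
    rfl
  exact LinearMap.congr_fun this y

section Derivatives

variable [DecidableEq ι]

theorem leftDer_twist (i : ι) (e : ℤ) (y : Sym k deg) : Sym.leftDer deg i (twist k deg e y) =
    sg k (e * deg i) • twist k deg e (Sym.leftDer deg i y) := by
  have : Sym.leftDer deg i ∘ₗ twist k deg e =
      sg k (e * deg i) • twist k deg e ∘ₗ Sym.leftDer deg i := sym_hom_ext fun l => by
    simp only [LinearMap.comp_apply, LinearMap.smul_apply]
    induction l with
    | nil => simp
    | cons j l ih =>
      rw [mon_cons, twist_x_mul, map_smul, leftDer_x_mul, leftDer_x_mul, ih, map_add, map_smul,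
        twist_x_mul, smul_add, smul_add]
      congr 1
      · split_ifs with h
        · rw [h]
        · simp
      · simp only [mul_smul_comm, smul_smul]
        congr 1
        ring
  exact LinearMap.congr_fun this y

theorem leftDer_leftDer (i j : ι) (y : Sym k deg) :
    Sym.leftDer deg i (Sym.leftDer deg j y) =
      sg k (deg i * deg j) • Sym.leftDer deg j (Sym.leftDer deg i y) := by
  have : Sym.leftDer (k := k) deg i ∘ₗ Sym.leftDer deg j =
      sg k (deg i * deg j) • Sym.leftDer deg j ∘ₗ Sym.leftDer deg i := sym_hom_ext fun l => by
    simp only [LinearMap.comp_apply, LinearMap.smul_apply]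
    induction l with
    | nil => simp
    | cons a l ih =>
      rw [mon_cons, leftDer_x_mul, leftDer_x_mul, map_add, map_add, map_smul, map_smul,
        leftDer_x_mul, leftDer_x_mul, ih]
      simp only [smul_add, mul_smul_comm, smul_smul]
      by_cases hi : a = i <;> by_cases hj : a = j
      · subst hi hj
        simp [sg_mul_self]
        abel
      · subst hi
        simp only [if_neg hj, if_true, map_zero, zero_add, smul_zero]
        rw [mul_comm (deg a) (deg j)]
      · subst hj
        simp only [if_neg hi, if_true, map_zero, zero_add, smul_zero]
        congr 1
        · rw [sg_mul_self, one_smul]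
        · congr 1
          ring
      · simp only [if_neg hi, if_neg hj, map_zero, zero_add, smul_zero]
        congr 1
        ring
  exact LinearMap.congr_fun this y

end Derivatives

section Derivation

variable [Fintype ι] {c : ι → ι → k} (hc : ∀ i j, c i j ≠ 0 → deg i = deg j + 1)

include hc in
theorem der_x_eq (j : ι) : Sym.der deg c (Sym.x deg j) = ∑ i, c i j • Sym.x deg i := by
  rw [der_x]
  refine Finset.sum_congr rfl fun i _ => ?_
  by_cases h : c i j = 0
  · simp [h]
  · rw [if_pos (hc i j h)]

include hc in
-- The graded commutator of a derivative with a linear vector field has constant coefficients. It is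
-- computed on letters and propagated along words.
theorem leftDer_der [DecidableEq ι] (j : ι) (y : Sym k deg) :
    Sym.leftDer deg j (Sym.der deg c y) = sg k (deg j) • Sym.der deg c (Sym.leftDer deg j y) +
      ∑ a, c j a • Sym.leftDer deg a y := by
  have : Sym.leftDer deg j ∘ₗ Sym.der deg c = sg k (deg j) • Sym.der deg c ∘ₗ Sym.leftDer deg j +
      ∑ a, c j a • Sym.leftDer deg a := sym_hom_ext fun l => by
    simp only [LinearMap.comp_apply, LinearMap.smul_apply, LinearMap.add_apply, LinearMap.sum_apply]
    induction l with
    | nil => simp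
    | cons a l ih =>
      have h1 : Sym.leftDer deg j (Sym.der deg c (Sym.x deg a) * mon k deg l) =
          c j a • mon k deg l + sg k (deg j * (deg a + 1)) •
            (Sym.der deg c (Sym.x deg a) * Sym.leftDer deg j (mon k deg l)) := by
        rw [der_x_eq hc, Finset.sum_mul, Finset.sum_mul, map_sum, Finset.smul_sum]
        -- Where `c i a` is nonzero, the degree of `x_i` is determined by that of `x_a`, so the sign
        -- can be taken out of the sum.
        have h2 : ∀ i, Sym.leftDer deg j (c i a • Sym.x deg i * mon k deg l) =
            (if i = j then c j a • mon k deg l else 0) + sg k (deg j * (deg a + 1)) •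
              (c i a • Sym.x deg i * Sym.leftDer deg j (mon k deg l)) := by
          intro i
          by_cases h : c i a = 0
          · have : i = j → c j a = 0 := fun e => e ▸ h
            simp only [h, zero_smul, zero_mul, map_zero, smul_zero, add_zero]
            split_ifs with hi
            · rw [this hi, zero_smul]
            · rfl
          · rw [smul_mul_assoc, map_smul, leftDer_x_mul, ← hc i a h, smul_add, smul_mul_assoc,
              smul_comm (c i a)]
            congr 1
            split_ifs with hi
            · rw [hi]
            · exact smul_zero _
        simp only [h2, Finset.sum_add_distrib, Finset.sum_ite_eq', Finset.mem_univ, if_true]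
      have h3 : ∑ i, c j i • Sym.leftDer deg i (Sym.x deg a * mon k deg l) =
          c j a • mon k deg l + sg k ((deg j - 1) * deg a) •
            (Sym.x deg a * ∑ i, c j i • Sym.leftDer deg i (mon k deg l)) := by
        rw [Finset.mul_sum, Finset.smul_sum]
        have h2 : ∀ i, c j i • Sym.leftDer deg i (Sym.x deg a * mon k deg l) =
            (if a = i then c j i • mon k deg l else 0) + sg k ((deg j - 1) * deg a) •
              (Sym.x deg a * c j i • Sym.leftDer deg i (mon k deg l)) := by
          intro i
          by_cases h : c j i = 0
          · simp [h]
          · rw [leftDer_x_mul, hc j i h, smul_add, mul_smul_comm, smul_comm (c j i),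
              add_sub_cancel_right]
            congr 1
            split_ifs with hi
            · rfl
            · exact smul_zero _
        simp only [h2, Finset.sum_add_distrib, Finset.sum_ite_eq, Finset.mem_univ, if_true]
      have h4 : Sym.der deg c (if a = j then mon k deg l else 0) =
          if a = j then Sym.der deg c (mon k deg l) else 0 := by
        split_ifs <;> simp
      rw [mon_cons, der_x_mul, map_add, h1, map_smul, leftDer_x_mul, ih, h3, leftDer_x_mul,
        map_add, map_smul, der_x_mul, h4]
      simp only [smul_add, mul_add, mul_smul_comm, smul_smul, mul_one]
      have e1 : sg k (deg a) * sg k (deg j * deg a) = sg k ((deg j - 1) * deg a) := by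
        rw [← sg_add]
        exact sg_congr ⟨deg a, by ring⟩
      have e2 : (sg k (deg a) • if a = j then Sym.der deg c (mon k deg l) else 0) =
          sg k (deg j) • if a = j then Sym.der deg c (mon k deg l) else 0 := by
        split_ifs with h
        · rw [h]
        · simp
      rw [e2, sg_add, ← e1]
      module
  have h := LinearMap.congr_fun this y
  simpa only [LinearMap.add_apply, LinearMap.sum_apply, LinearMap.smul_apply,
    LinearMap.comp_apply] using h

include hc in
-- The square of an odd derivation is a derivation, since the mixed terms cancel, and it vanishes on
-- generators because the square of the matrix is zero.
theorem der_der (hcc : ∀ i j, ∑ a, c i a * c a j = 0) (y : Sym k deg) :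
    Sym.der deg c (Sym.der deg c y) = 0 := by
  have : Sym.der deg c ∘ₗ Sym.der deg c = 0 := sym_hom_ext fun l => by
    simp only [LinearMap.comp_apply, LinearMap.zero_apply]
    induction l with
    | nil => simp
    | cons j l ih =>
      have h1 : Sym.der deg c (Sym.der deg c (Sym.x deg j) * mon k deg l) =
          sg k (deg j + 1) • (Sym.der deg c (Sym.x deg j) * Sym.der deg c (mon k deg l)) := by
        have h0 : ∑ i, c i j • Sym.der deg c (Sym.x deg i) = 0 := by
          simp only [der_x_eq hc, Finset.smul_sum, smul_smul]
          rw [Finset.sum_comm]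
          refine Finset.sum_eq_zero fun i _ => ?_
          rw [← Finset.sum_smul]
          simp only [mul_comm (c _ j), hcc, zero_smul]
        rw [der_x_eq hc j, Finset.sum_mul, Finset.sum_mul, map_sum, Finset.smul_sum]
        have h2 : ∀ i, Sym.der deg c (c i j • Sym.x deg i * mon k deg l) =
            (c i j • Sym.der deg c (Sym.x deg i)) * mon k deg l +
            sg k (deg j + 1) • (c i j • Sym.x deg i * Sym.der deg c (mon k deg l)) := by
          intro i
          by_cases h : c i j = 0
          · simp [h]
          · rw [smul_mul_assoc, map_smul, der_x_mul, ← hc i j h, smul_add, smul_mul_assoc,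
              smul_mul_assoc, smul_comm (c i j)]
        simp only [h2, Finset.sum_add_distrib]
        rw [← Finset.sum_mul, h0, zero_mul, zero_add]
      rw [mon_cons, der_x_mul, map_add, h1, map_smul, der_x_mul, ih, sg_add, sg_one]
      simp only [mul_neg_one, mul_zero, smul_zero, add_zero]
      rw [← add_smul, neg_add_cancel, zero_smul]
  exact LinearMap.congr_fun this y

end Derivation

/-! ### Degrees -/

theorem mon_mem_degree (l : List ι) : mon k deg l ∈ Sym.degree deg (ldeg deg l) := by
  refine Submodule.subset_span ⟨l.length, l.get, ?_, ?_⟩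
  · rw [← ldeg_ofFn, List.ofFn_get]
  · rw [monomial_eq_mon, List.ofFn_get]

theorem mem_degree_of_eq {r s : ℤ} (h : r = s) {y : Sym k deg} (hy : y ∈ Sym.degree deg r) :
    y ∈ Sym.degree deg s := h ▸ hy

theorem map_mem_degree {r s : ℤ} {F : Module.End k (Sym k deg)}
    (h : ∀ l, F (mon k deg l) ∈ Sym.degree deg (ldeg deg l + s)) {y : Sym k deg}
    (hy : y ∈ Sym.degree deg r) : F y ∈ Sym.degree deg (r + s) := by
  induction hy using Submodule.span_induction with
  | mem y hy =>
    obtain ⟨m, J, rfl, rfl⟩ := hy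
    rw [monomial_eq_mon, ← ldeg_ofFn]
    exact h _
  | zero => rw [map_zero]; exact zero_mem _
  | add x y _ _ hx hy => rw [map_add]; exact add_mem hx hy
  | smul c x _ hx => rw [map_smul]; exact Submodule.smul_mem _ c hx

theorem mon_mul_mem_degree (l : List ι) {r : ℤ} {y : Sym k deg} (hy : y ∈ Sym.degree deg r) :
    mon k deg l * y ∈ Sym.degree deg (r + ldeg deg l) :=
  map_mem_degree (F := LinearMap.mulLeft k (mon k deg l)) (fun l' => by
    rw [LinearMap.mulLeft_apply, ← mon_append]
    exact mem_degree_of_eq (by rw [ldeg_append, add_comm]) (mon_mem_degree _)) hy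

theorem x_mul_mem_degree (i : ι) {r : ℤ} {y : Sym k deg} (hy : y ∈ Sym.degree deg r) :
    Sym.x deg i * y ∈ Sym.degree deg (r + deg i) := by
  simpa using mon_mul_mem_degree [i] hy

theorem leftDer_mem_degree [DecidableEq ι] (i : ι) {r : ℤ} {y : Sym k deg}
    (hy : y ∈ Sym.degree deg r) : Sym.leftDer deg i y ∈ Sym.degree deg (r - deg i) := by
  refine map_mem_degree (s := -deg i) (fun l => ?_) hy
  induction l with
  | nil => simp
  | cons j l ih =>
    rw [mon_cons, leftDer_x_mul]
    refine add_mem ?_ (Submodule.smul_mem _ _ (mem_degree_of_eq ?_ (x_mul_mem_degree j ih)))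
    · split_ifs with h
      · subst h
        exact mem_degree_of_eq (by rw [ldeg_cons]; ring) (mon_mem_degree l)
      · exact zero_mem _
    · rw [ldeg_cons]
      ring

theorem der_mem_degree [Fintype ι] (c : ι → ι → k) {r : ℤ} {y : Sym k deg}
    (hy : y ∈ Sym.degree deg r) : Sym.der deg c y ∈ Sym.degree deg (r + 1) := by
  refine map_mem_degree (fun l => ?_) hy
  induction l with
  | nil => simp
  | cons j l ih =>
    rw [mon_cons, der_x_mul, der_x, Finset.sum_mul]
    refine add_mem (Submodule.sum_mem _ fun i _ => ?_)
      (Submodule.smul_mem _ _ (mem_degree_of_eq ?_ (x_mul_mem_degree j ih)))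
    · split_ifs with h
      · rw [smul_mul_assoc]
        refine Submodule.smul_mem _ _ (mem_degree_of_eq ?_ (x_mul_mem_degree i (mon_mem_degree l)))
        rw [h, ldeg_cons]
        ring
      · rw [zero_mul]
        exact zero_mem _
    · rw [ldeg_cons]
      ring

end Operators

/-! ### Normally ordered quantization of symbols -/

section Quantization

variable {k : Type u} [Field k] {ι : Type w} [Fintype ι] [DecidableEq ι] (deg : ι → ℤ)

variable (k) in
/-- The action of the generators of the phase space on the operators on `S(V)`. -/
def quantGen : ι ⊕ ι → Module.End k (Module.End k (Sym k deg))
  | .inl i => LinearMap.mulLeft k (LinearMap.mulLeft k (Sym.x deg i))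
  | .inr i => LinearMap.mulLeft k (twist k deg (deg i)) ∘ₗ
      LinearMap.mulRight k (twist k deg (deg i) * Sym.leftDer deg i)

theorem quantGen_inl (i : ι) (T : Module.End k (Sym k deg)) (y : Sym k deg) :
    quantGen k deg (.inl i) T y = Sym.x deg i * T y := rfl

theorem quantGen_inr (i : ι) (T : Module.End k (Sym k deg)) (y : Sym k deg) :
    quantGen k deg (.inr i) T y =
      twist k deg (deg i) (T (twist k deg (deg i) (Sym.leftDer deg i y))) := rfl

/-- The `a`'s act on an operator from the left and the `φ`'s from the right, so the two kinds do not
interact, and the parity twists supply the Koszul signs. Normal ordering is therefore well defined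
on the graded commutative algebra. -/
theorem quantGen_comm (p q : ι ⊕ ι) : quantGen k deg p * quantGen k deg q =
    sg k (phaseDeg deg p * phaseDeg deg q) • (quantGen k deg q * quantGen k deg p) := by
  refine LinearMap.ext fun T => LinearMap.ext fun y => ?_
  simp only [LinearMap.smul_apply, Module.End.mul_apply]
  rcases p with i | i <;> rcases q with j | j
  · simp only [quantGen_inl, phaseDeg_inl]
    rw [← mul_assoc, x_mul_x, smul_mul_assoc, mul_assoc]
  · simp only [quantGen_inl, quantGen_inr, phaseDeg_inl, phaseDeg_inr]
    rw [twist_x_mul, smul_smul, ← sg_add, sg_even ⟨0, by ring⟩, one_smul]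
  · simp only [quantGen_inl, quantGen_inr, phaseDeg_inl, phaseDeg_inr]
    rw [twist_x_mul]
    congr 1
    exact sg_congr ⟨deg i * deg j, by ring⟩
  · simp only [quantGen_inr, phaseDeg_inr, neg_mul_neg]
    simp only [leftDer_twist, map_smul, twist_twist]
    rw [leftDer_leftDer i j, map_smul, map_smul, map_smul, add_comm (deg i)]
    simp only [smul_smul]
    congr 1
    rw [mul_comm (deg j) (deg i), mul_comm, sg_mul_self, mul_one]

variable (k) in
/-- The normally ordered quantization `a_i ↦ x_i`, `φ^i ↦ ∂_i`. -/
def quant : Phase k deg →ₗ[k] Module.End k (Sym k deg) :=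
  LinearMap.applyₗ (1 : Module.End k (Sym k deg)) ∘ₗ
    (RingQuot.liftAlgHom k (s := SymRel k (phaseDeg deg))
      ⟨FreeAlgebra.lift k (quantGen k deg), by
        rintro _ _ ⟨p, q⟩
        simp only [map_mul, map_smul, FreeAlgebra.lift_ι_apply]
        exact quantGen_comm deg p q⟩).toLinearMap

variable {deg}

theorem quant_one : quant k deg 1 = 1 := by
  simp [quant]

theorem quant_x_mul (p : ι ⊕ ι) (q : Phase k deg) :
    quant k deg (Sym.x (phaseDeg deg) p * q) = quantGen k deg p (quant k deg q) := by
  simp only [quant, LinearMap.comp_apply, AlgHom.toLinearMap_apply, map_mul]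
  rw [Sym.x]
  erw [RingQuot.liftAlgHom_mkAlgHom_apply]
  simp only [FreeAlgebra.lift_ι_apply]
  rfl

theorem quant_a_mul (i : ι) (q : Phase k deg) (y : Sym k deg) :
    quant k deg (Sym.x (phaseDeg deg) (Sum.inl i) * q) y = Sym.x deg i * quant k deg q y := by
  rw [quant_x_mul, quantGen_inl]

theorem quant_f_mul (i : ι) (q : Phase k deg) (y : Sym k deg) :
    quant k deg (Sym.x (phaseDeg deg) (Sum.inr i) * q) y =
      twist k deg (deg i) (quant k deg q (twist k deg (deg i) (Sym.leftDer deg i y))) := by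
  rw [quant_x_mul, quantGen_inr]

/-- Conjugation by a parity twist multiplies a homogeneous operator by the sign of its degree. The
twists in `quantGen` become explicit signs in this way. -/
theorem twist_quant_mon (e : ℤ) (L : List (ι ⊕ ι)) (y : Sym k deg) :
    twist k deg e (quant k deg (mon k (phaseDeg deg) L) (twist k deg e y)) =
      sg k (e * ldeg (phaseDeg deg) L) • quant k deg (mon k (phaseDeg deg) L) y := by
  induction L generalizing y with
  | nil => simp [quant_one, twist_twist_self]
  | cons p L ih =>
    rcases p with i | i
    · rw [mon_cons, quant_a_mul, twist_x_mul, ih, quant_a_mul, mul_smul_comm, smul_smul, ← sg_add,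
        ldeg_cons, phaseDeg_inl, mul_add]
    · rw [mon_cons, quant_f_mul, quant_f_mul, leftDer_twist, map_smul, map_smul, map_smul, map_smul,
        twist_twist, twist_twist, add_comm (deg i) e, ← twist_twist e (deg i) (Sym.leftDer deg i y),
        add_comm e (deg i), ← twist_twist,
        ih, map_smul, smul_smul, ← sg_add, ldeg_cons, phaseDeg_inr]
      congr 1
      exact sg_congr ⟨e * deg i, by ring⟩

theorem quant_f_mul_mon (i : ι) (L : List (ι ⊕ ι)) (y : Sym k deg) :
    quant k deg (Sym.x (phaseDeg deg) (Sum.inr i) * mon k (phaseDeg deg) L) y =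
      sg k (deg i * ldeg (phaseDeg deg) L) •
        quant k deg (mon k (phaseDeg deg) L) (Sym.leftDer deg i y) := by
  rw [quant_f_mul, twist_quant_mon]

/-- On the right no sign occurs: the sign of moving `φ^i` to the front is undone by the twist. -/
theorem quant_mul_f (i : ι) (q : Phase k deg) (y : Sym k deg) :
    quant k deg (q * Sym.x (phaseDeg deg) (Sum.inr i)) y =
      quant k deg q (Sym.leftDer deg i y) := by
  induction q using sym_induction with
  | mon L =>
    have h := x_mul_mon (k := k) (phaseDeg deg) (Sum.inr i) L
    have h2 : mon k (phaseDeg deg) L * Sym.x (phaseDeg deg) (Sum.inr i) =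
        sg k (deg i * ldeg (phaseDeg deg) L) •
          (Sym.x (phaseDeg deg) (Sum.inr i) * mon k (phaseDeg deg) L) := by
      rw [h, smul_smul, ← sg_add, phaseDeg_inr, sg_even ⟨0, by ring⟩, one_smul]
    rw [h2, map_smul, LinearMap.smul_apply, quant_f_mul_mon, smul_smul, sg_mul_self, one_smul]
  | zero => simp
  | add p q hp hq => simp only [add_mul, map_add, LinearMap.add_apply, hp, hq]
  | smul c p hp => simp only [smul_mul_assoc, map_smul, LinearMap.smul_apply, hp]

theorem quant_aMon_mul (J : List ι) (q : Phase k deg) (y : Sym k deg) :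
    quant k deg (aMon k deg J * q) y = mon k deg J * quant k deg q y := by
  induction J with
  | nil => simp
  | cons i J ih => rw [aMon_cons, mul_assoc, quant_a_mul, ih, mon_cons, mul_assoc]

theorem quant_mul_fMon (q : Phase k deg) (I : List ι) :
    quant k deg (q * fMon k deg I) = quant k deg q *
      (I.map fun i => (Sym.leftDer deg i : Module.End k (Sym k deg))).prod := by
  induction I generalizing q with
  | nil => simp
  | cons i I ih =>
    rw [fMon_cons, ← mul_assoc, ih, List.map_cons, List.prod_cons, ← mul_assoc]
    congr 1
    exact LinearMap.ext fun y => quant_mul_f i q y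

/-- The canonical commutation relation at the level of symbols: a derivative composed from the left
either meets an `a_i` of the symbol or joins its `φ`'s. -/
theorem leftDer_quant (i : ι) (q : Phase k deg) (y : Sym k deg) :
    Sym.leftDer deg i (quant k deg q y) =
      quant k deg (Sym.leftDer (phaseDeg deg) (Sum.inl i) q) y +
        quant k deg (Sym.x (phaseDeg deg) (Sum.inr i) * q) y := by
  induction q using sym_induction generalizing y with
  | mon L =>
    induction L generalizing y with
    | nil =>
      rw [mon_nil, leftDer_one, quant_f_mul, quant_one]
      simp [twist_twist_self]
    | cons p L ih =>
      rw [mon_cons]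
      rcases p with j | j
      · rw [quant_a_mul, leftDer_x_mul, ih, leftDer_x_mul, map_add, map_smul, LinearMap.add_apply,
          LinearMap.smul_apply, quant_a_mul, ← mul_assoc, x_mul_x (phaseDeg deg), smul_mul_assoc,
          mul_assoc, map_smul, LinearMap.smul_apply, quant_a_mul, mul_add, smul_add, ← add_assoc]
        simp only [phaseDeg_inl, phaseDeg_inr]
        congr 1
        · congr 1
          by_cases h : j = i
          · simp [h]
          · simp [h]
        · congr 1
          exact sg_congr ⟨deg i * deg j, by ring⟩
      · rw [quant_f_mul, leftDer_twist, ih, leftDer_x_mul, map_add (quant k deg), map_smul,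
          LinearMap.add_apply, LinearMap.smul_apply, quant_f_mul, ← mul_assoc,
          x_mul_x (phaseDeg deg), smul_mul_assoc, mul_assoc, map_smul, LinearMap.smul_apply,
          quant_f_mul j, quant_f_mul j, quant_f_mul i, map_add, smul_add]
        simp only [phaseDeg_inl, phaseDeg_inr, reduceCtorEq, if_false, map_zero,
          LinearMap.zero_apply, zero_add]
        congr 2
        · exact sg_congr ⟨deg i * deg j, by ring⟩
        · rw [neg_mul_neg, mul_comm]
  | zero => simp
  | add p q hp hq => simp only [mul_add, map_add, LinearMap.add_apply, hp, hq]; abel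
  | smul c p hp => simp only [mul_smul_comm, map_smul, LinearMap.smul_apply, hp, smul_add]

theorem quant_mul_a (i : ι) (q : Phase k deg) (y : Sym k deg) :
    quant k deg (q * Sym.x (phaseDeg deg) (Sum.inl i)) y =
      Sym.x deg i * twist k deg (deg i) (quant k deg q (twist k deg (deg i) y)) := by
  induction q using sym_induction with
  | mon L =>
    have h := x_mul_mon (k := k) (phaseDeg deg) (Sum.inl i) L
    have h2 : mon k (phaseDeg deg) L * Sym.x (phaseDeg deg) (Sum.inl i) =
        sg k (deg i * ldeg (phaseDeg deg) L) •
          (Sym.x (phaseDeg deg) (Sum.inl i) * mon k (phaseDeg deg) L) := by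
      rw [h, smul_smul, phaseDeg_inl, sg_mul_self, one_smul]
    rw [h2, map_smul, LinearMap.smul_apply, quant_a_mul, twist_quant_mon, mul_smul_comm]
  | zero => simp
  | add p q hp hq => simp only [add_mul, map_add, LinearMap.add_apply, hp, hq, mul_add]
  | smul c p hp => simp only [smul_mul_assoc, map_smul, LinearMap.smul_apply, hp, mul_smul_comm]

/-- The mirror relation: a multiplication operator composed from the right either meets a `φ^i` or
joins the `a`'s. -/
theorem quant_apply_x_mul (i : ι) (q : Phase k deg) (y : Sym k deg) :
    quant k deg q (Sym.x deg i * y) =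
      quant k deg (Sym.rightDer (phaseDeg deg) (Sum.inr i) q) y +
        quant k deg (q * Sym.x (phaseDeg deg) (Sum.inl i)) y := by
  induction q using sym_induction generalizing y with
  | mon L =>
    induction L using List.reverseRecOn generalizing y with
    | nil =>
      rw [mon_nil, rightDer_one, quant_mul_a, quant_one]
      simp [twist_twist_self]
    | append_singleton L p ih =>
      rw [mon_append, mon_cons, mon_nil, mul_one]
      rcases p with j | j
      · rw [quant_mul_a, twist_x_mul, map_smul, ih, rightDer_mul_x, map_add, mul_assoc,
          x_mul_x (phaseDeg deg), mul_smul_comm, ← mul_assoc]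
        simp only [LinearMap.add_apply, map_smul, LinearMap.smul_apply, quant_mul_a j, map_add,
          mul_smul_comm, mul_add, smul_add]
        simp only [phaseDeg_inl, phaseDeg_inr, reduceCtorEq, if_false, map_zero,
          LinearMap.zero_apply, zero_add]
        congr 2
        · exact sg_congr ⟨deg i * deg j, by ring⟩
      · rw [quant_mul_f, leftDer_x_mul, map_add, map_smul, ih, rightDer_mul_x, map_add, map_smul,
          LinearMap.add_apply, LinearMap.smul_apply, quant_mul_f, mul_assoc,
          x_mul_x (phaseDeg deg), mul_smul_comm, ← mul_assoc, map_smul, LinearMap.smul_apply,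
          quant_mul_f, smul_add, ← add_assoc]
        simp only [phaseDeg_inl, phaseDeg_inr]
        congr 1
        · congr 1
          · by_cases h : j = i
            · simp [h]
            · simp [h, Ne.symm h]
          · rw [neg_mul_neg, mul_comm]
        · congr 1
          exact sg_congr ⟨deg i * deg j, by ring⟩
  | zero => simp
  | add p q hp hq => simp only [add_mul, map_add, LinearMap.add_apply, hp, hq]; abel
  | smul c p hp => simp only [smul_mul_assoc, map_smul, LinearMap.smul_apply, hp, smul_add]

/-- In `leftDer_quant` the other two terms depend only on the operator `quant k deg q`, so they
vanish with it. -/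
theorem quant_leftDer_eq_zero {q : Phase k deg} (h : quant k deg q = 0) (i : ι) :
    quant k deg (Sym.leftDer (phaseDeg deg) (Sum.inl i) q) = 0 := by
  refine LinearMap.ext fun y => ?_
  have := leftDer_quant i q y
  rw [quant_f_mul, h] at this
  simpa using this.symm

theorem quant_rightDer_eq_zero {q : Phase k deg} (h : quant k deg q = 0) (i : ι) :
    quant k deg (Sym.rightDer (phaseDeg deg) (Sum.inr i) q) = 0 := by
  refine LinearMap.ext fun y => ?_
  have := quant_apply_x_mul i q y
  rw [quant_mul_a, h] at this
  simpa using this.symm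

/-- Applied to `1`, the constant term of the operator is the constant term of its symbol:
derivatives kill `1`, and multiplications have no constant term. -/
theorem aug_quant_one (q : Phase k deg) :
    aug k deg (quant k deg q 1) = aug k (phaseDeg deg) q := by
  induction q using sym_induction with
  | mon L =>
    cases L with
    | nil => simp [quant_one]
    | cons p L =>
      rw [aug_mon_cons, mon_cons]
      rcases p with j | j
      · rw [quant_a_mul]; simp
      · rw [quant_f_mul]; simp
  | zero => simp
  | add p q hp hq => simp only [map_add, LinearMap.add_apply, hp, hq]
  | smul c p hp => simp only [map_smul, LinearMap.smul_apply, hp]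

/-- The faithfulness needed for reading equations off operators. The kernel of `quant` is stable
under both kinds of derivatives and is annihilated by the augmentation, hence by every coefficient
functional. -/
theorem coeffAt_eq_zero_of_quant {q : Phase k deg} (h : quant k deg q = 0) (J K : List ι) :
    coeffAt deg J K q = 0 := by
  induction J generalizing q with
  | nil =>
    induction K generalizing q with
    | nil =>
      change aug k (phaseDeg deg) q = 0
      rw [← aug_quant_one, h]
      simp
    | cons i K ih => exact ih (quant_rightDer_eq_zero h i)
  | cons i J ih => exact ih (quant_leftDer_eq_zero h i)

end Quantization

/-! ### The star product and Wick's formula -/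

section StarProduct

variable {k : Type u} [Field k] {ι : Type w} [Fintype ι] [DecidableEq ι] {deg : ι → ℤ}

variable (deg) in
/-- `contract` as a bilinear map. -/
def contractL : ℕ → Phase k deg →ₗ[k] Phase k deg →ₗ[k] Phase k deg
  | 0 => LinearMap.mul k (Phase k deg)
  | l + 1 => ∑ i : ι, (contractL l).compl₁₂ (Sym.rightDer (phaseDeg deg) (Sum.inr i))
      (Sym.leftDer (phaseDeg deg) (Sum.inl i))

theorem contract_eq (l : ℕ) (p q : Phase k deg) : contract deg l p q = contractL deg l p q := by
  induction l generalizing p q with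
  | zero => rfl
  | succ l ih => simp [contract, contractL, ih]

theorem contractL_zero (p q : Phase k deg) : contractL deg 0 p q = p * q := rfl

theorem contractL_succ (l : ℕ) (p q : Phase k deg) : contractL deg (l + 1) p q =
    ∑ i, contractL deg l (Sym.rightDer (phaseDeg deg) (Sum.inr i) p)
      (Sym.leftDer (phaseDeg deg) (Sum.inl i) q) := by
  simp [contractL]

/-- The last `φ^i` of the left factor is either left alone, and can then be moved to the right
factor, where no contraction sees it, or it takes part in one of the `l + 1` ordered contractions.
-/
theorem contractL_mul_f (l : ℕ) (i : ι) (p q : Phase k deg) :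
    contractL deg (l + 1) (p * Sym.x (phaseDeg deg) (Sum.inr i)) q =
      contractL deg (l + 1) p (Sym.x (phaseDeg deg) (Sum.inr i) * q) +
        ((l + 1 : ℕ) : k) • contractL deg l p (Sym.leftDer (phaseDeg deg) (Sum.inl i) q) := by
  induction l generalizing p q with
  | zero =>
    simp only [contractL_succ, contractL_zero, rightDer_mul_x, leftDer_x_mul, add_mul,
      Finset.sum_add_distrib, reduceCtorEq, if_false, zero_add,
      Sum.inr.injEq, ite_mul, zero_mul, Finset.sum_ite_eq, Finset.mem_univ, if_true]
    rw [add_comm, Nat.cast_one, one_smul]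
    congr 1
    refine Finset.sum_congr rfl fun j _ => ?_
    rw [smul_mul_assoc, mul_smul_comm, mul_assoc]
    congr 1
    exact sg_congr ⟨deg j * deg i, by simp⟩
  | succ l ih =>
    rw [contractL_succ, contractL_succ (l + 1)]
    have h1 : ∀ j, contractL deg (l + 1)
        (Sym.rightDer (phaseDeg deg) (Sum.inr j) (p * Sym.x (phaseDeg deg) (Sum.inr i)))
        (Sym.leftDer (phaseDeg deg) (Sum.inl j) q) =
        (if i = j then contractL deg (l + 1) p (Sym.leftDer (phaseDeg deg) (Sum.inl j) q) else 0) +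
        (contractL deg (l + 1) (Sym.rightDer (phaseDeg deg) (Sum.inr j) p)
          (Sym.leftDer (phaseDeg deg) (Sum.inl j) (Sym.x (phaseDeg deg) (Sum.inr i) * q)) +
        ((l + 1 : ℕ) : k) • contractL deg l (Sym.rightDer (phaseDeg deg) (Sum.inr j) p)
          (Sym.leftDer (phaseDeg deg) (Sum.inl j)
            (Sym.leftDer (phaseDeg deg) (Sum.inl i) q))) := by
      intro j
      rw [rightDer_mul_x, map_add, LinearMap.add_apply, map_smul, LinearMap.smul_apply, ih,
        leftDer_x_mul, leftDer_leftDer (Sum.inl i) (Sum.inl j)]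
      simp only [reduceCtorEq, if_false, zero_add, map_smul, smul_add, smul_smul, Sum.inr.injEq,
        phaseDeg_inl, phaseDeg_inr]
      congr 1
      · split_ifs <;> simp
      · congr 2
        · exact sg_congr ⟨deg j * deg i, by ring⟩
        · rw [mul_comm, mul_assoc, neg_mul_neg, mul_comm (deg j), sg_mul_self, mul_one]
    simp only [h1, Finset.sum_add_distrib, Finset.sum_ite_eq, Finset.mem_univ, if_true]
    rw [← Finset.smul_sum, ← contractL_succ, ← contractL_succ, Nat.cast_succ (l + 1), add_smul, one_smul]
    abel

theorem contractL_aMon (l : ℕ) (J : List ι) (q : Phase k deg) :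
    contractL deg (l + 1) (aMon k deg J) q = 0 := by
  rw [contractL_succ]
  refine Finset.sum_eq_zero fun i _ => ?_
  have := rightDer_aMon_mul (k := k) deg i J 1
  rw [mul_one] at this
  rw [this, show Sym.rightDer (phaseDeg deg) (Sum.inr i) (1 : Phase k deg) = 0 from
    skew_one _ _ _ _ _, mul_zero, map_zero, LinearMap.zero_apply]

variable (deg) in
/-- The product of symbols corresponding to the composition of operators, truncated at `N`
contractions. -/
def star (N : ℕ) : Phase k deg →ₗ[k] Phase k deg →ₗ[k] Phase k deg :=
  ∑ l ∈ Finset.range (N + 1), (l.factorial : k)⁻¹ • contractL deg l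

theorem star_apply (N : ℕ) (p q : Phase k deg) : star deg N p q =
    ∑ l ∈ Finset.range (N + 1), (l.factorial : k)⁻¹ • contractL deg l p q := by
  simp [star]

variable [CharZero k]

/-- The factor `l + 1` from the choice of the contracted pair reduces `1/(l + 1)!` to `1/l!`, so the
contracted terms again form a star product. -/
theorem star_mul_f (N : ℕ) (i : ι) (p q : Phase k deg) :
    star deg (N + 1) (p * Sym.x (phaseDeg deg) (Sum.inr i)) q =
      star deg (N + 1) p (Sym.x (phaseDeg deg) (Sum.inr i) * q) +
        star deg N p (Sym.leftDer (phaseDeg deg) (Sum.inl i) q) := by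
  simp only [star_apply]
  rw [Finset.sum_range_succ', Finset.sum_range_succ' _ (N + 1)]
  simp only [contractL_mul_f, smul_add, Finset.sum_add_distrib, contractL_zero, mul_assoc,
    smul_smul]
  have h : ∀ l : ℕ, ((l + 1).factorial : k)⁻¹ * ((l + 1 : ℕ) : k) = (l.factorial : k)⁻¹ := by
    intro l
    rw [Nat.factorial_succ, Nat.cast_mul, mul_inv, mul_comm, ← mul_assoc, mul_inv_cancel₀, one_mul]
    exact Nat.cast_ne_zero.2 l.succ_ne_zero
  simp only [h]
  abel

/-- Wick's formula. Removing the last `φ` of the left factor gives the same recursion on both sides,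
by `leftDer_quant` for operators and by `star_mul_f` for symbols. Truncation is harmless once `N` is
at least the number of `φ`'s. -/
theorem quant_mul_quant_mon (J I : List ι) (N : ℕ) (hN : I.length ≤ N) (q : Phase k deg) :
    quant k deg (aMon k deg J * fMon k deg I) * quant k deg q =
      quant k deg (star deg N (aMon k deg J * fMon k deg I) q) := by
  induction I using List.reverseRecOn generalizing N q with
  | nil =>
    rw [fMon_nil, mul_one, star_apply, Finset.sum_range_succ']
    simp only [contractL_aMon, smul_zero, Finset.sum_const_zero, zero_add, contractL_zero,
      Nat.factorial_zero, Nat.cast_one, inv_one, one_smul]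
    refine LinearMap.ext fun y => ?_
    have := quant_aMon_mul J (1 : Phase k deg) (quant k deg q y)
    rw [mul_one, quant_one] at this
    rw [quant_aMon_mul, Module.End.mul_apply, this]
    rfl
  | append_singleton I i ih =>
    -- One contraction is used up in the second term, so the induction hypothesis is applied with
    -- both `N + 1` and `N`.
    obtain ⟨N, rfl⟩ : ∃ N', N = N' + 1 := ⟨N - 1, by simp at hN; omega⟩
    have hI : I.length ≤ N := by simpa using hN
    have h : fMon k deg (I ++ [i]) = fMon k deg I * Sym.x (phaseDeg deg) (Sum.inr i) := by
      simp [fMon]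
    rw [h, ← mul_assoc, star_mul_f, map_add, ← ih (N + 1) (by omega), ← ih N hI]
    refine LinearMap.ext fun y => ?_
    rw [Module.End.mul_apply, quant_mul_f, leftDer_quant, map_add, add_comm]
    rfl

theorem quant_mul_quant_symbol (m n N : ℕ) (hN : n ≤ N) (c : List ι → List ι → k)
    (q : Phase k deg) : quant k deg (symbol deg m n c) * quant k deg q =
      quant k deg (star deg N (symbol deg m n c) q) := by
  rw [symbol]
  simp only [map_smul, LinearMap.smul_apply, listSum, LinearMap.sum_apply,
    Finset.sum_mul, smul_mul_assoc, map_sum]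
  congr 1
  refine Finset.sum_congr rfl fun J _ => Finset.sum_congr rfl fun K _ => ?_
  rw [quant_mul_quant_mon _ _ N (by simpa using hN)]

theorem contractL_symbol_left {m n l : ℕ} (h : n < l) {c : List ι → List ι → k}
    (hc : CoeffSymm deg c) (q : Phase k deg) : contractL deg l (symbol deg m n c) q = 0 := by
  induction l generalizing n c q with
  | zero => omega
  | succ l ih =>
    rw [contractL_succ]
    refine Finset.sum_eq_zero fun i _ => ?_
    cases n with
    | zero => rw [rightDer_symbol_zero, map_zero, LinearMap.zero_apply]
    | succ n => exact rightDer_symbol hc i m n ▸ ih (by omega) (hc.append_right [i]) _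

theorem contractL_symbol_right {m n l : ℕ} (h : m < l) {c : List ι → List ι → k}
    (hc : CoeffSymm deg c) (p : Phase k deg) : contractL deg l p (symbol deg m n c) = 0 := by
  induction l generalizing m c p with
  | zero => omega
  | succ l ih =>
    rw [contractL_succ]
    refine Finset.sum_eq_zero fun i _ => ?_
    cases m with
    | zero => rw [leftDer_symbol_zero, map_zero]
    | succ m => exact leftDer_symbol hc i m n ▸ ih (by omega) (hc.append_left [i]) _

end StarProduct

/-! ### Commutators with the derivation induced by `d` -/

section Commutators

variable {k : Type u} [Field k] {ι : Type w}

variable (k) in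
/-- The elements of odd degree. -/
def oddPart (deg : ι → ℤ) : Submodule k (Sym k deg) :=
  Submodule.span k {y | ∃ l, Odd (ldeg deg l) ∧ mon k deg l = y}

theorem mul_anticomm {deg : ι → ℤ} {p q : Sym k deg} (hp : p ∈ oddPart k deg)
    (hq : q ∈ oddPart k deg) : p * q = (-1 : k) • (q * p) := by
  induction hp using Submodule.span_induction with
  | mem p hp =>
    obtain ⟨l, hl, rfl⟩ := hp
    induction hq using Submodule.span_induction with
    | mem q hq =>
      obtain ⟨l', hl', rfl⟩ := hq
      rw [mon_mul_mon, sg_odd (hl.mul hl')]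
    | zero => simp
    | add x y _ _ hx hy => rw [mul_add, add_mul, hx, hy, smul_add]
    | smul c x _ hx => rw [mul_smul_comm, smul_mul_assoc, hx, smul_comm]
  | zero => simp
  | add x y _ _ hx hy => rw [mul_add, add_mul, hx, hy, smul_add]
  | smul c x _ hx => rw [mul_smul_comm, smul_mul_assoc, hx, smul_comm]

variable [Fintype ι] [DecidableEq ι] {deg : ι → ℤ}

theorem quant_f_mul_of_mem_degree (i : ι) {r : ℤ} {q : Phase k deg}
    (hq : q ∈ Sym.degree (phaseDeg deg) r) (y : Sym k deg) :
    quant k deg (Sym.x (phaseDeg deg) (Sum.inr i) * q) y =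
      sg k (deg i * r) • quant k deg q (Sym.leftDer deg i y) := by
  induction hq using Submodule.span_induction with
  | mem q hq =>
    obtain ⟨m, J, rfl, rfl⟩ := hq
    rw [monomial_eq_mon, quant_f_mul_mon, ldeg_ofFn]
  | zero => simp
  | add p q _ _ hp hq => simp only [mul_add, map_add, LinearMap.add_apply, hp, hq, smul_add]
  | smul c p _ hp =>
    simp only [mul_smul_comm, map_smul, LinearMap.smul_apply, hp]
    rw [smul_comm]

variable [CharZero k] {V : Type v} [AddCommGroup V] [Module k V]
  {𝒱 : ℤ → Submodule k V} [DirectSum.Decomposition 𝒱] {d : V →ₗ[k] V} (b : Module.Basis ι k V)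

theorem repr_degree (hb : ∀ i, b i ∈ 𝒱 (deg i)) (hd : ∀ i : ℤ, ∀ x ∈ 𝒱 i, d x ∈ 𝒱 (i + 1))
    (i j : ι) (h : b.repr (d (b j)) i ≠ 0) : deg i = deg j + 1 :=
  deg_eq_of_repr_ne_zero b hb (hd _ _ (hb j)) h

theorem repr_comp_eq_zero (hdd : d ∘ₗ d = 0) (i j : ι) :
    ∑ a, b.repr (d (b a)) i * b.repr (d (b j)) a = 0 := by
  have h : d (d (b j)) = 0 := LinearMap.congr_fun hdd (b j)
  have h2 : d (d (b j)) = ∑ a, b.repr (d (b j)) a • d (b a) := by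
    conv_lhs => rw [← b.sum_repr (d (b j))]
    rw [map_sum]
    simp only [map_smul]
  have h3 := congrArg (fun v => b.repr v i) h2
  simp only [h, map_zero, Finsupp.coe_zero, Pi.zero_apply, map_sum, map_smul, Finsupp.coe_finsetSum,
    Finset.sum_apply, Finsupp.coe_smul, Pi.smul_apply, smul_eq_mul] at h3
  rw [h3]
  exact Finset.sum_congr rfl fun a _ => mul_comm _ _

/-- The graded commutator of the derivation with a normally ordered operator acts on symbols as
`phaseD`. Letters `a_i` enter through the Leibniz rule, letters `φ^i` through `leftDer_der`, whose
matrix is the transpose occurring in the differential of the `φ`'s. -/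
theorem der_quant_mon (hb : ∀ i, b i ∈ 𝒱 (deg i)) (hd : ∀ i : ℤ, ∀ x ∈ 𝒱 i, d x ∈ 𝒱 (i + 1))
    (L : List (ι ⊕ ι)) (y : Sym k deg) :
    Sym.der deg (fun i j => b.repr (d (b j)) i) (quant k deg (mon k (phaseDeg deg) L) y) =
      quant k deg (phaseD b deg d (mon k (phaseDeg deg) L)) y +
        sg k (ldeg (phaseDeg deg) L) • quant k deg (mon k (phaseDeg deg) L)
          (Sym.der deg (fun i j => b.repr (d (b j)) i) y) := by
  have hc := repr_degree b hb hd
  induction L generalizing y with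
  | nil => simp [quant_one, phaseD]
  | cons p L ih =>
    have hp : phaseD b deg d (Sym.x (phaseDeg deg) p * mon k (phaseDeg deg) L) =
        phaseD b deg d (Sym.x (phaseDeg deg) p) * mon k (phaseDeg deg) L +
        sg k (phaseDeg deg p) • (Sym.x (phaseDeg deg) p * phaseD b deg d (mon k (phaseDeg deg) L)) :=
      der_x_mul _ _ _ _
    rw [mon_cons, hp]
    rcases p with i | i
    · rw [quant_a_mul, der_x_mul, ih, phaseD_inl b hb hd, der_x_eq hc, Finset.sum_mul,
        Finset.sum_mul, map_add, map_sum, LinearMap.add_apply, LinearMap.sum_apply, map_smul,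
        LinearMap.smul_apply, quant_a_mul, quant_a_mul, mul_add, smul_add, add_assoc]
      congr 1
      · refine Finset.sum_congr rfl fun a _ => ?_
        rw [smul_mul_assoc, smul_mul_assoc, map_smul, LinearMap.smul_apply, quant_a_mul]
      · rw [mul_smul_comm, smul_smul, ← sg_add, ldeg_cons]
        rfl
    · have hm : phaseD b deg d (mon k (phaseDeg deg) L) ∈
          Sym.degree (phaseDeg deg) (ldeg (phaseDeg deg) L + 1) :=
        der_mem_degree _ (mon_mem_degree L)
      have h1 : quant k deg (phaseD b deg d (Sym.x (phaseDeg deg) (Sum.inr i)) *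
          mon k (phaseDeg deg) L) y =
          (-sg k (deg i + deg i * ldeg (phaseDeg deg) L + ldeg (phaseDeg deg) L)) •
          quant k deg (mon k (phaseDeg deg) L)
            (∑ a, b.repr (d (b a)) i • Sym.leftDer deg a y) := by
        rw [phaseD_inr b hb hd, Finset.sum_mul, map_sum, LinearMap.sum_apply, map_sum,
          Finset.smul_sum]
        refine Finset.sum_congr rfl fun a _ => ?_
        rw [smul_mul_assoc, map_smul, LinearMap.smul_apply, quant_f_mul_mon, map_smul, smul_smul,
          smul_smul]
        -- A nonzero matrix entry fixes the degree of `a` relative to `i`, which allows a common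
        -- sign.
        by_cases h : b.repr (d (b a)) i = 0
        · rw [h, mul_zero, zero_mul, mul_zero]
        · rw [hc i a h]
          congr 1
          rw [add_assoc, sg_add (deg a + 1), sg_congr (a := (deg a + 1) * ldeg (phaseDeg deg) L +
            ldeg (phaseDeg deg) L) (b := deg a * ldeg (phaseDeg deg) L)
            ⟨ldeg (phaseDeg deg) L, by ring⟩]
          ring
      rw [quant_f_mul_mon, map_smul, ih, map_add, LinearMap.add_apply, h1, map_smul,
        LinearMap.smul_apply, quant_f_mul_of_mem_degree i hm, quant_f_mul_mon, leftDer_der hc,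
        map_add, map_smul, ldeg_cons, phaseDeg_inr]
      simp only [smul_add, smul_smul, ← sg_add]
      have e1 : sg k (-deg i + deg i * (ldeg (phaseDeg deg) L + 1)) =
          sg k (deg i * ldeg (phaseDeg deg) L) := sg_congr ⟨0, by ring⟩
      have e2 : sg k (-deg i + ldeg (phaseDeg deg) L + deg i * ldeg (phaseDeg deg) L) =
          sg k (deg i + deg i * ldeg (phaseDeg deg) L + ldeg (phaseDeg deg) L) :=
        sg_congr ⟨-deg i, by ring⟩
      have e3 : sg k (-deg i + ldeg (phaseDeg deg) L + (deg i * ldeg (phaseDeg deg) L + deg i)) =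
          sg k (deg i * ldeg (phaseDeg deg) L + ldeg (phaseDeg deg) L) :=
        sg_congr ⟨0, by ring⟩
      rw [e1, e2, e3]
      module

theorem der_quant_odd (hb : ∀ i, b i ∈ 𝒱 (deg i)) (hd : ∀ i : ℤ, ∀ x ∈ 𝒱 i, d x ∈ 𝒱 (i + 1))
    {p : Phase k deg} (hp : p ∈ oddPart k (phaseDeg deg)) (y : Sym k deg) :
    Sym.der deg (fun i j => b.repr (d (b j)) i) (quant k deg p y) +
      quant k deg p (Sym.der deg (fun i j => b.repr (d (b j)) i) y) =
      quant k deg (phaseD b deg d p) y := by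
  induction hp using Submodule.span_induction with
  | mem p hp =>
    obtain ⟨l, hl, rfl⟩ := hp
    rw [der_quant_mon b hb hd, sg_odd hl]
    module
  | zero => simp
  | add p q _ _ hp hq =>
    simp only [map_add, LinearMap.add_apply]
    rw [← hp, ← hq]
    abel
  | smul c p _ hp =>
    simp only [map_smul, LinearMap.smul_apply]
    rw [← hp, smul_add]

end Commutators

/-! ### Indices with fixed `χ` -/

section Shells

/-- The indices `(m, n, G)` with `2 G + m + n - 2 = χ`. -/
def shell (χ : ℕ) : Finset (ℕ × ℕ × ℕ) :=
  (Finset.range (χ + 3) ×ˢ Finset.range (χ + 3) ×ˢ Finset.range (χ + 3)).filter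
    fun t => 2 * t.2.2 + t.1 + t.2.1 = χ + 2

theorem mem_shell {χ : ℕ} {t : ℕ × ℕ × ℕ} :
    t ∈ shell χ ↔ 2 * t.2.2 + t.1 + t.2.1 = χ + 2 := by
  simp only [shell, Finset.mem_filter, Finset.mem_product, Finset.mem_range]
  omega

theorem sum_shell {M : Type*} [AddCommMonoid M] (χ : ℕ) (F : ℕ → ℕ → ℕ → M) :
    (∑ m ∈ Finset.range (χ + 3), ∑ n ∈ Finset.range (χ + 3), ∑ G ∈ Finset.range (χ + 3),
      if 2 * G + m + n = χ + 2 then F m n G else 0) = ∑ t ∈ shell χ, F t.1 t.2.1 t.2.2 := by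
  rw [shell, Finset.sum_filter, Finset.sum_product]
  simp only [Finset.sum_product]

/-- Additivity of `χ`: gluing along `j + 1` edges removes `2 (j + 1)` legs and raises the genus by
`j`, so a pair of vertices is the same as a splitting of the glued one. Nonzero terms have enough
legs for the edges, and values of `2 G + m + n` of at least 2, so truncated subtraction does no
harm. -/
theorem sum_antidiagonal_shell {M : Type*} [AddCommMonoid M] (χ : ℕ)
    (C : ℕ → ℕ × ℕ × ℕ → ℕ × ℕ × ℕ → M)
    (hC : ∀ j t₁ t₂, C j t₁ t₂ ≠ 0 → j + 1 ≤ t₁.2.1 ∧ j + 1 ≤ t₂.1 ∧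
      2 ≤ 2 * t₁.2.2 + t₁.1 + t₁.2.1 ∧ 2 ≤ 2 * t₂.2.2 + t₂.1 + t₂.2.1) :
    (∑ s ∈ Finset.HasAntidiagonal.antidiagonal χ, ∑ j ∈ Finset.range (χ + 2),
      ∑ t₁ ∈ shell s.1, ∑ t₂ ∈ shell s.2, C j t₁ t₂) =
    ∑ t ∈ shell χ, ∑ p ∈ Finset.HasAntidiagonal.antidiagonal t.1,
      ∑ q ∈ Finset.HasAntidiagonal.antidiagonal t.2.1,
      ∑ r ∈ Finset.HasAntidiagonal.antidiagonal t.2.2,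
      ∑ s ∈ Finset.HasAntidiagonal.antidiagonal r.1,
        C r.2 (p.1, q.1 + (r.2 + 1), s.1) ((r.2 + 1) + p.2, q.2, s.2) := by
  simp only [Finset.sum_sigma']
  symm
  refine Finset.sum_bij_ne_zero (fun x _ _ =>
    let p := x.2.1
    let q := x.2.2.1
    let r := x.2.2.2.1
    let s := x.2.2.2.2
    ⟨(2 * s.1 + p.1 + (q.1 + (r.2 + 1)) - 2, 2 * s.2 + ((r.2 + 1) + p.2) + q.2 - 2),
      r.2, (p.1, q.1 + (r.2 + 1), s.1), ((r.2 + 1) + p.2, q.2, s.2)⟩) ?_ ?_ ?_ ?_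
  · rintro ⟨⟨m, n, G⟩, ⟨m₁, m₂⟩, ⟨n₁, n₂⟩, ⟨G', j⟩, ⟨G₁, G₂⟩⟩ hx h0
    obtain ⟨-, -, h₁, h₂⟩ := hC _ _ _ h0
    simp only [Finset.mem_sigma, Finset.HasAntidiagonal.mem_antidiagonal, mem_shell,
      Finset.mem_range] at hx h₁ h₂ ⊢
    omega
  · rintro ⟨⟨m, n, G⟩, ⟨m₁, m₂⟩, ⟨n₁, n₂⟩, ⟨G', j⟩, ⟨G₁, G₂⟩⟩ hx -
      ⟨⟨m', n', G''⟩, ⟨m₁', m₂'⟩, ⟨n₁', n₂'⟩, ⟨G''', j'⟩, ⟨G₁', G₂'⟩⟩ hx' - h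
    simp only [Finset.mem_sigma, Finset.HasAntidiagonal.mem_antidiagonal, mem_shell] at hx hx'
    simp only [Sigma.mk.injEq, heq_eq_eq, Prod.mk.injEq] at h
    obtain ⟨-, rfl, ⟨rfl, h₁, rfl⟩, h₂, rfl, rfl⟩ := h
    obtain rfl : n₁ = n₁' := by omega
    obtain rfl : m₂ = m₂' := by omega
    obtain ⟨-, rfl, rfl, rfl, rfl⟩ := hx
    obtain ⟨-, rfl, rfl, rfl, rfl⟩ := hx'
    rfl
  · rintro ⟨⟨s₁, s₂⟩, j, ⟨m₁, n₁, G₁⟩, ⟨m₂, n₂, G₂⟩⟩ hx h0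
    obtain ⟨h₁, h₂, -, -⟩ := hC _ _ _ h0
    simp only [Finset.mem_sigma, Finset.HasAntidiagonal.mem_antidiagonal, mem_shell,
      Finset.mem_range] at hx h₁ h₂
    obtain ⟨n₁, rfl⟩ := Nat.exists_eq_add_of_le' h₁
    obtain ⟨m₂, rfl⟩ := Nat.exists_eq_add_of_le h₂
    refine ⟨⟨(m₁ + m₂, n₁ + n₂, G₁ + G₂ + j), (m₁, m₂), (n₁, n₂), (G₁ + G₂, j), (G₁, G₂)⟩,
      ?_, h0, ?_⟩
    · simp only [Finset.mem_sigma, Finset.HasAntidiagonal.mem_antidiagonal, mem_shell, and_true]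
      omega
    · simp only [Sigma.mk.injEq, heq_eq_eq, Prod.mk.injEq, and_true]
      exact ⟨by omega, by omega⟩
  · rintro x hx h0
    rfl

end Shells

/-! ### The operator `D + L` and its square -/

section MasterOperator

variable {k : Type u} [Field k] [CharZero k] {V : Type v} [AddCommGroup V] [Module k V]
  {𝒱 : ℤ → Submodule k V} [DirectSum.Decomposition 𝒱] {d : V →ₗ[k] V}
  {ι : Type w} [Fintype ι] [DecidableEq ι] (b : Module.Basis ι k V) {deg : ι → ℤ} {ne : Bool}
  {f : ∀ m n _G : ℕ, EndV k V m n}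

theorem quant_aphi {m n : ℕ} (J : Fin m → ι) (I : Fin n → ι) :
    quant k deg (aphi k deg J I) = LinearMap.mulLeft k (Sym.monomial deg J) ∘ₗ
      (List.ofFn fun r => (Sym.leftDer deg (I r) : Module.End k (Sym k deg))).prod := by
  refine LinearMap.ext fun y => ?_
  rw [aphi_eq, quant_aMon_mul, monomial_eq_mon]
  have := quant_mul_fMon (1 : Phase k deg) (List.ofFn I)
  rw [one_mul, quant_one, one_mul, List.map_ofFn] at this
  rw [this]
  rfl

theorem diffOp_eq (f : ∀ m n _G : ℕ, EndV k V m n) (χ : ℕ) :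
    diffOp b deg f χ = quant k deg (∑ t ∈ shell χ, generating b deg f t.1 t.2.1 t.2.2) := by
  rw [diffOp, sum_shell χ fun m n G => ((m.factorial * n.factorial : ℕ) : k)⁻¹ •
    ∑ J : Fin m → ι, ∑ I : Fin n → ι, coord b (f m n G) J I •
      (LinearMap.mulLeft k (Sym.monomial deg J) ∘ₗ
        (List.ofFn fun r => (Sym.leftDer deg (I r) : Module.End k (Sym k deg))).prod), map_sum]
  refine Finset.sum_congr rfl fun t _ => ?_
  simp only [generating, map_smul, map_sum, quant_aphi]

theorem prod_leftDer_mem_degree (l : List ι) {r : ℤ} {y : Sym k deg}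
    (hy : y ∈ Sym.degree deg r) :
    (l.map fun i => (Sym.leftDer deg i : Module.End k (Sym k deg))).prod y ∈
      Sym.degree deg (r - ldeg deg l) := by
  induction l with
  | nil => simpa using hy
  | cons i l ih =>
    rw [List.map_cons, List.prod_cons, Module.End.mul_apply]
    exact mem_degree_of_eq (by rw [ldeg_cons]; ring) (leftDer_mem_degree i ih)

theorem diffOp_mem_degree (hb : ∀ i, b i ∈ 𝒱 (deg i)) (hf : IsOperations 𝒱 ne f) (χ : ℕ) {r : ℤ}
    {y : Sym k deg} (hy : y ∈ Sym.degree deg r) :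
    diffOp b deg f χ y ∈ Sym.degree deg (r + 1) := by
  rw [diffOp]
  simp only [LinearMap.sum_apply]
  refine Submodule.sum_mem _ fun m _ => Submodule.sum_mem _ fun n _ => Submodule.sum_mem _ fun G _ => ?_
  split_ifs
  · simp only [LinearMap.smul_apply, LinearMap.sum_apply]
    refine Submodule.smul_mem _ _ (Submodule.sum_mem _ fun J _ => Submodule.sum_mem _ fun I _ => ?_)
    by_cases h : coord b (f m n G) J I = 0
    · rw [h, zero_smul]
      exact zero_mem _
    · refine Submodule.smul_mem _ _ ?_
      rw [coord_eq] at h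
      have hdeg := matCoeff_degree b hb (hf.degree m n G) h
      rw [ldeg_reverse] at hdeg
      have h2 := mon_mul_mem_degree (List.ofFn J) (prod_leftDer_mem_degree (List.ofFn I) hy)
      rw [List.map_ofFn, ← monomial_eq_mon] at h2
      refine mem_degree_of_eq ?_ h2
      rw [hdeg]
      ring
  · exact zero_mem _

theorem masterOp_mem_degree (hb : ∀ i, b i ∈ 𝒱 (deg i)) (hf : IsOperations 𝒱 ne f) {r : ℤ}
    {F : ℕ → Sym k deg} (hF : ∀ c, F c ∈ Sym.degree deg r) (c : ℕ) :
    masterOp b deg d f F c ∈ Sym.degree deg (r + 1) := by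
  refine add_mem ?_ (Submodule.sum_mem _ fun p _ => diffOp_mem_degree b hb hf _ (hF _))
  exact neg_mem (der_mem_degree _ (hF c))

variable (deg d f) in
/-- The coefficients of the square of the operator `D + L`. -/
def squareCoeff (χ : ℕ) : Module.End k (Sym k deg) :=
  baseOp b deg d ∘ₗ diffOp b deg f χ + diffOp b deg f χ ∘ₗ baseOp b deg d +
    ∑ s ∈ Finset.HasAntidiagonal.antidiagonal χ, diffOp b deg f s.1 ∘ₗ diffOp b deg f s.2

theorem baseOp_apply (y : Sym k deg) :
    baseOp b deg d y = (-1 : k) • Sym.der deg (fun i j => b.repr (d (b j)) i) y := by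
  rw [baseOp, LinearMap.neg_apply]
  exact (neg_one_smul k _).symm

theorem baseOp_baseOp (hb : ∀ i, b i ∈ 𝒱 (deg i)) (hd : ∀ i : ℤ, ∀ x ∈ 𝒱 i, d x ∈ 𝒱 (i + 1))
    (hdd : d ∘ₗ d = 0) (y : Sym k deg) : baseOp b deg d (baseOp b deg d y) = 0 := by
  rw [baseOp_apply, baseOp_apply, map_smul,
    der_der (repr_degree b hb hd) (repr_comp_eq_zero b hdd), smul_zero, smul_zero]

/-- The square of the derivation drops out, and the rest is the associativity of products of power
series. -/
theorem masterOp_masterOp (hb : ∀ i, b i ∈ 𝒱 (deg i)) (hd : ∀ i : ℤ, ∀ x ∈ 𝒱 i, d x ∈ 𝒱 (i + 1))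
    (hdd : d ∘ₗ d = 0) (F : ℕ → Sym k deg) (c : ℕ) :
    masterOp b deg d f (masterOp b deg d f F) c =
      ∑ p ∈ Finset.HasAntidiagonal.antidiagonal c, squareCoeff d b deg f p.1 (F p.2) := by
  simp only [masterOp, squareCoeff, map_add, map_sum, LinearMap.add_apply, LinearMap.comp_apply,
    LinearMap.sum_apply, Finset.sum_add_distrib, baseOp_baseOp b hb hd hdd, zero_add]
  rw [← add_assoc]
  congr 1
  simp only [Finset.sum_sigma']
  refine Finset.sum_nbij' (fun x => ⟨(x.1.1 + x.2.1, x.2.2), (x.1.1, x.2.1)⟩)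
    (fun x => ⟨(x.2.1, x.2.2 + x.1.2), (x.2.2, x.1.2)⟩) ?_ ?_ ?_ ?_ ?_
  · rintro ⟨⟨a, e⟩, ⟨g, h⟩⟩ hx
    simp only [Finset.mem_sigma, Finset.HasAntidiagonal.mem_antidiagonal] at hx ⊢
    exact ⟨by omega, trivial⟩
  · rintro ⟨⟨a, e⟩, ⟨g, h⟩⟩ hx
    simp only [Finset.mem_sigma, Finset.HasAntidiagonal.mem_antidiagonal] at hx ⊢
    exact ⟨by omega, trivial⟩
  · rintro ⟨⟨a, e⟩, ⟨g, h⟩⟩ hx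
    simp only [Finset.mem_sigma, Finset.HasAntidiagonal.mem_antidiagonal] at hx ⊢
    obtain ⟨rfl, rfl⟩ := hx
    rfl
  · rintro ⟨⟨a, e⟩, ⟨g, h⟩⟩ hx
    simp only [Finset.mem_sigma, Finset.HasAntidiagonal.mem_antidiagonal] at hx ⊢
    obtain ⟨rfl, rfl⟩ := hx
    rfl
  · intro x _
    rfl

theorem masterOp_sq_eq_zero_iff (hb : ∀ i, b i ∈ 𝒱 (deg i))
    (hd : ∀ i : ℤ, ∀ x ∈ 𝒱 i, d x ∈ 𝒱 (i + 1)) (hdd : d ∘ₗ d = 0) :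
    (∀ F : ℕ → Sym k deg, masterOp b deg d f (masterOp b deg d f F) = 0) ↔
      ∀ χ, squareCoeff d b deg f χ = 0 := by
  constructor
  · intro h χ
    refine LinearMap.ext fun y => ?_
    -- A constant power series isolates the coefficient of `τ^χ`.
    have h1 := congrFun (h (Pi.single 0 y)) χ
    rw [masterOp_masterOp b hb hd hdd, Finset.sum_eq_single (χ, 0)] at h1
    · simpa using h1
    · rintro ⟨a, e⟩ hp hne
      have : e ≠ 0 := by
        rintro rfl
        simp only [Finset.HasAntidiagonal.mem_antidiagonal] at hp
        exact hne (by rw [← hp, add_zero])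
      simp [this]
    · intro h
      simp at h
  · intro h F
    funext c
    rw [masterOp_masterOp b hb hd hdd]
    simp [h]

theorem symbolOf_mem_oddPart (hb : ∀ i, b i ∈ 𝒱 (deg i)) {m n : ℕ} {g : EndV k V m n}
    (hg : HasDeg 𝒱 g 1) : symbolOf b deg g ∈ oddPart k (phaseDeg deg) := by
  rw [symbolOf_apply, symbol]
  refine Submodule.smul_mem _ _ (Submodule.sum_mem _ fun J _ => Submodule.sum_mem _ fun K _ => ?_)
  by_cases h : matCoeff b g (List.ofFn J) (List.ofFn K) = 0
  · beta_reduce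
    rw [h, zero_smul]
    exact zero_mem _
  · refine Submodule.smul_mem _ _ (Submodule.subset_span
      ⟨(List.ofFn J).map Sum.inl ++ (List.ofFn K).reverse.map Sum.inr, ?_, mon_append _ _ _⟩)
    rw [ldeg_append, ldeg_map_inl, ldeg_map_inr, ldeg_reverse, matCoeff_degree b hb hg h,
      add_neg_cancel_comm]
    exact odd_one

/-- Exchanging the two factors reverses the sign of each product of odd elements and preserves the
sum, which is thus its own negative; 2 is invertible. -/
theorem sum_mul_antidiagonal_eq_zero {P : ℕ → Phase k deg}
    (hP : ∀ χ, P χ ∈ oddPart k (phaseDeg deg)) (χ : ℕ) :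
    ∑ s ∈ Finset.HasAntidiagonal.antidiagonal χ, P s.1 * P s.2 = 0 := by
  set x := ∑ s ∈ Finset.HasAntidiagonal.antidiagonal χ, P s.1 * P s.2 with hx
  have h : x = (-1 : k) • x := by
    conv_lhs => rw [hx, ← Finset.Nat.sum_antidiagonal_swap]
    rw [hx, Finset.smul_sum]
    exact Finset.sum_congr rfl fun s _ => mul_anticomm (hP _) (hP _)
  have h2 : (2 : k) • x = 0 := by
    rw [← one_add_one_eq_two, add_smul, one_smul]
    conv_lhs => enter [1]; rw [h]
    exact (congrArg (· + x) (neg_one_smul k x)).trans (neg_add_cancel x)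
  exact (smul_eq_zero.1 h2).resolve_left two_ne_zero

theorem adm_of_generating_ne_zero (hf : IsOperations 𝒱 ne f) {m n G : ℕ}
    (h : generating b deg f m n G ≠ 0) : Adm ne m n G := by
  by_contra h'
  exact h (by rw [generating_eq, hf.support m n G h', map_zero])

theorem le_of_contractL_generating_ne_zero (hb : ∀ i, b i ∈ 𝒱 (deg i)) (hf : IsOperations 𝒱 ne f)
    {l m₁ n₁ G₁ m₂ n₂ G₂ : ℕ} (h : contractL deg l (generating b deg f m₁ n₁ G₁)
      (generating b deg f m₂ n₂ G₂) ≠ 0) :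
    l ≤ n₁ ∧ l ≤ m₂ ∧ Adm ne m₁ n₁ G₁ ∧ Adm ne m₂ n₂ G₂ := by
  refine ⟨?_, ?_, adm_of_generating_ne_zero (deg := deg) b hf fun e => h ?_,
    adm_of_generating_ne_zero (deg := deg) b hf fun e => h ?_⟩
  · rw [generating_eq, symbolOf_apply] at h
    by_contra h'
    exact h (contractL_symbol_left (by omega) (coeffSymm_matCoeff b hb (hf.symm _ _ _)) _)
  · rw [generating_eq b f m₂, symbolOf_apply] at h
    by_contra h'
    exact h (contractL_symbol_right (by omega) (coeffSymm_matCoeff b hb (hf.symm _ _ _)) _)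
  · rw [e]
    exact LinearMap.map_zero₂ _ _
  · rw [e, map_zero]

theorem quant_mul_quant_generating {m n N : ℕ} (G : ℕ) (hN : n ≤ N) (q : Phase k deg) :
    quant k deg (generating b deg f m n G) * quant k deg q =
      quant k deg (star deg N (generating b deg f m n G) q) := by
  rw [generating_eq, symbolOf_apply]
  exact quant_mul_quant_symbol _ _ _ hN _ _

theorem quant_mul_quant_shell (s : ℕ) {N : ℕ} (hN : s + 2 ≤ N) (q : Phase k deg) :
    quant k deg (∑ t ∈ shell s, generating b deg f t.1 t.2.1 t.2.2) * quant k deg q =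
      quant k deg (star deg N (∑ t ∈ shell s, generating b deg f t.1 t.2.1 t.2.2) q) := by
  simp only [map_sum, Finset.sum_mul, LinearMap.sum_apply]
  refine Finset.sum_congr rfl fun t ht => quant_mul_quant_generating b _ ?_ q
  rw [mem_shell] at ht
  omega

/-- The terms without contraction cancel by anticommutativity, and those with `j + 1` contractions
are regrouped by their glued vertex into `circ`. -/
theorem sum_star_shell (hb : ∀ i, b i ∈ 𝒱 (deg i)) (hf : IsOperations 𝒱 ne f) (χ : ℕ) :
    ∑ s ∈ Finset.HasAntidiagonal.antidiagonal χ,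
      star deg (χ + 2) (∑ t ∈ shell s.1, generating b deg f t.1 t.2.1 t.2.2)
        (∑ t ∈ shell s.2, generating b deg f t.1 t.2.1 t.2.2) =
    ∑ t ∈ shell χ, circ deg (generating b deg f) (generating b deg f) t.1 t.2.1 t.2.2 := by
  have hodd : ∀ s, ∑ t ∈ shell s, generating b deg f t.1 t.2.1 t.2.2 ∈ oddPart k (phaseDeg deg) :=
    fun s => Submodule.sum_mem _ fun t _ => by
      rw [generating_eq]
      exact symbolOf_mem_oddPart b hb (hf.degree _ _ _)
  have h0 := sum_mul_antidiagonal_eq_zero hodd χ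
  simp only [star_apply]
  -- Splits off the term with no contraction, after which the index counts the contractions beyond
  -- the first.
  simp only [Finset.sum_range_succ' _ (χ + 2), contractL_zero, Nat.factorial_zero, Nat.cast_one,
    inv_one, one_smul, Finset.sum_add_distrib]
  rw [h0, add_zero]
  simp only [map_sum, LinearMap.sum_apply, Finset.smul_sum, circ, contract_eq]
  have h1 := sum_antidiagonal_shell χ (fun j t₁ t₂ => ((j + 1).factorial : k)⁻¹ •
    contractL deg (j + 1) (generating b deg f t₁.1 t₁.2.1 t₁.2.2)
      (generating b deg f t₂.1 t₂.2.1 t₂.2.2)) fun j t₁ t₂ h => by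
    obtain ⟨h₁, h₂, a₁, a₂⟩ := le_of_contractL_generating_ne_zero b hb hf (right_ne_zero_of_smul h)
    exact ⟨h₁, h₂, a₁.1.le, a₂.1.le⟩
  refine Eq.trans ?_ h1
  refine Finset.sum_congr rfl fun s _ => Finset.sum_congr rfl fun j _ => ?_
  rw [Finset.sum_comm]

/-- The anticommutator with the derivation contributes `-phaseD`, since the symbols are odd, and the
products contribute the star product. -/
theorem squareCoeff_eq (hb : ∀ i, b i ∈ 𝒱 (deg i)) (hd : ∀ i : ℤ, ∀ x ∈ 𝒱 i, d x ∈ 𝒱 (i + 1))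
    (hf : IsOperations 𝒱 ne f) (χ : ℕ) : squareCoeff d b deg f χ =
      quant k deg (∑ t ∈ shell χ, (-phaseD b deg d (generating b deg f t.1 t.2.1 t.2.2) +
        circ deg (generating b deg f) (generating b deg f) t.1 t.2.1 t.2.2)) := by
  have hodd : ∑ t ∈ shell χ, generating b deg f t.1 t.2.1 t.2.2 ∈ oddPart k (phaseDeg deg) :=
    Submodule.sum_mem _ fun t _ => by
      rw [generating_eq]
      exact symbolOf_mem_oddPart b hb (hf.degree _ _ _)
  have hneg : ∀ x y : Phase k deg, -x + y = (-1 : k) • x + y := fun x y =>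
    congrArg (· + y) (neg_one_smul k x).symm
  simp only [hneg]
  rw [Finset.sum_add_distrib, map_add, ← sum_star_shell b hb hf, squareCoeff, ← Finset.smul_sum,
    ← map_sum]
  congr 1
  · refine LinearMap.ext fun y => ?_
    rw [LinearMap.add_apply, LinearMap.comp_apply, LinearMap.comp_apply, baseOp_apply, baseOp_apply,
      map_smul, ← smul_add, diffOp_eq, der_quant_odd b hb hd hodd, map_smul, LinearMap.smul_apply]
  · rw [map_sum]
    refine Finset.sum_congr rfl fun s hs => ?_
    rw [diffOp_eq, diffOp_eq]
    refine quant_mul_quant_shell b s.1 ?_ _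
    rw [Finset.HasAntidiagonal.mem_antidiagonal] at hs
    -- In the left factor the number of derivatives is at most `s.1 + 2`, so `χ + 2` contractions
    -- are enough.
    omega

theorem circ_generating_eq_zero (hb : ∀ i, b i ∈ 𝒱 (deg i)) (hf : IsOperations 𝒱 ne f) {m n G : ℕ} (h : ¬ Adm ne m n G) :
    circ deg (generating b deg f) (generating b deg f) m n G = 0 := by
  refine Finset.sum_eq_zero fun p hp => Finset.sum_eq_zero fun q hq => Finset.sum_eq_zero fun r hr =>
    Finset.sum_eq_zero fun s hs => ?_
  rw [Finset.HasAntidiagonal.mem_antidiagonal] at hp hq hr hs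
  rw [contract_eq]
  by_contra h'
  obtain ⟨-, -, a₁, a₂⟩ := le_of_contractL_generating_ne_zero b hb hf (right_ne_zero_of_smul h')
  have := a₁.comp a₂
  rw [hp, hq, hs, hr] at this
  exact h this

/-- An operator coefficient mixes all indices with the same `χ`. The coefficient functionals for
words of lengths `m` and `n` separate them. -/
theorem masterEq_iff_squareCoeff (hb : ∀ i, b i ∈ 𝒱 (deg i))
    (hd : ∀ i : ℤ, ∀ x ∈ 𝒱 i, d x ∈ 𝒱 (i + 1)) (hf : IsOperations 𝒱 ne f) :
    MasterEq b deg d (generating b deg f) ↔ ∀ χ, squareCoeff d b deg f χ = 0 := by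
  constructor
  · intro h χ
    rw [squareCoeff_eq b hb hd hf, Finset.sum_eq_zero fun t _ => h _ _ _, map_zero]
  · intro h m n G
    by_cases ha : Adm ne m n G
    · obtain ⟨χ, hχ⟩ : ∃ χ, 2 * G + m + n = χ + 2 := ⟨2 * G + m + n - 2, by have := ha.1; omega⟩
      have h1 := h χ
      rw [squareCoeff_eq b hb hd hf] at h1
      simp only [← symbolOf_relation b hb hd hf] at h1 ⊢
      have hs : ∀ m n G (ρ : Fin m ≃ Fin m) (σ : Fin n ≃ Fin n),
          endAct 𝒱 ρ σ (quadratic 𝒱 f m n G - endD 𝒱 d (f m n G)) =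
            quadratic 𝒱 f m n G - endD 𝒱 d (f m n G) := fun m n G ρ σ => by
        change endActL 𝒱 ρ σ _ = _
        rw [map_sub]
        refine congrArg₂ (· - ·) (endAct_quadratic G ρ σ) ?_
        change endAct 𝒱 ρ σ (endD 𝒱 d (f m n G)) = _
        rw [← endD_endAct hd, hf.symm]
      rw [eq_zero_of_matCoeff b (f := quadratic 𝒱 f m n G - endD 𝒱 d (f m n G)), map_zero]
      intro J K hJ hK
      have h2 := coeffAt_eq_zero_of_quant h1 J K
      -- Within a shell the lengths `m` and `n` determine the genus, so a single term survives.
      rw [map_sum, Finset.sum_eq_single (m, n, G)] at h2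
      · rwa [symbolOf_apply, coeffAt_symbol (coeffSymm_matCoeff b hb (hs _ _ _)),
          if_pos ⟨hJ.symm, hK.symm⟩] at h2
      · rintro ⟨m', n', G'⟩ ht hne
        rw [mem_shell] at ht
        rw [symbolOf_apply, coeffAt_symbol (coeffSymm_matCoeff b hb (hs _ _ _)), if_neg]
        rintro ⟨h3, h4⟩
        simp only at h3 h4 ht
        refine hne ?_
        rw [Prod.mk.injEq, Prod.mk.injEq]
        omega
      · intro h3
        exact absurd (mem_shell.2 hχ) h3
    -- An index that is not allowed lies in no relevant shell equation, but there both terms of the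
    -- master equation vanish by the support condition.
    · rw [circ_generating_eq_zero b hb hf ha, generating_eq, hf.support m n G ha, map_zero, map_zero]
      simp

theorem isIBL_iff_masterOp (hb : ∀ i, b i ∈ 𝒱 (deg i))
    (hd : ∀ i : ℤ, ∀ x ∈ 𝒱 i, d x ∈ 𝒱 (i + 1)) (hdd : d ∘ₗ d = 0) (hf : IsOperations 𝒱 ne f) :
    IsIBL 𝒱 d ne f ↔ ∀ F : ℕ → Sym k deg, masterOp b deg d f (masterOp b deg d f F) = 0 := by
  rw [masterOp_sq_eq_zero_iff b hb hd hdd, ← masterEq_iff_squareCoeff b hb hd hf,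
    isIBL_iff_masterEq b hb hd hf]

end MasterOperator

end IBL

end

theorem theorem34 {k : Type u} [Field k] [CharZero k] {V : Type v} [AddCommGroup V] [Module k V]
    (𝒱 : ℤ → Submodule k V) [DirectSum.Decomposition 𝒱] (d : V →ₗ[k] V)
    (hd : ∀ i : ℤ, ∀ x ∈ 𝒱 i, d x ∈ 𝒱 (i + 1)) (hdd : d ∘ₗ d = 0) (ne : Bool) :
    Set.BijOn (fun α : IBL.CobarAlgebra 𝒱 d (IBL.frob k ne) => IBL.operations 𝒱 d α)
      Set.univ {f | IBL.IsIBL 𝒱 d ne f} ∧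
    ∀ (ι : Type w) [Fintype ι] [DecidableEq ι] (b : Module.Basis ι k V) (deg : ι → ℤ)
      (_ : ∀ i, b i ∈ 𝒱 (deg i)),
      Set.BijOn (IBL.generating b deg) {f | IBL.IsOperations 𝒱 ne f}
        {L | IBL.IsSymbol deg ne L} ∧
      Set.BijOn (fun α : IBL.CobarAlgebra 𝒱 d (IBL.frob k ne) =>
          IBL.generating b deg (IBL.operations 𝒱 d α))
        Set.univ {L | IBL.IsSymbol deg ne L ∧ IBL.MasterEq b deg d L} ∧
      ∀ f, IBL.IsOperations 𝒱 ne f →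
        (∀ (r : ℤ) (F : ℕ → IBL.Sym k deg), (∀ c, F c ∈ IBL.Sym.degree deg r) →
          ∀ c, IBL.masterOp b deg d f F c ∈ IBL.Sym.degree deg (r + 1)) ∧
        (IBL.IsIBL 𝒱 d ne f ↔ ∀ F : ℕ → IBL.Sym k deg,
          IBL.masterOp b deg d f (IBL.masterOp b deg d f F) = 0) := by
  refine ⟨IBL.bijOn_operations hd, fun ι _ _ b deg hb => ⟨IBL.bijOn_generating b hb,
    IBL.bijOn_generating_operations b hb hd, fun f hf =>
      ⟨fun r F hF c => IBL.masterOp_mem_degree b hb hf hF c,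
        IBL.isIBL_iff_masterOp b hb hd hdd hf⟩⟩⟩
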